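/- Fix an integer $k>3$ and put $\epsilon_k:=\frac{1}{2^k\,(k+4)!}$. Let $N$ run through the positive integers, tending to infinity. Let $w=w(N)$ be a real function with $w(N)\to\infty$ as $N\to\infty$ and $w(N)\le\frac12\log\log N$ for all sufficiently large $N$, and put $W:=\prod_{p\le w}p$, the product running over primes. Let $M=M(N)$ be a function with prime values such that, for some fixed $\varepsilon>0$, $N^{\varepsilon}<M\le N$ for all sufficiently large $N$. Write $\mathbb Z_M:=\mathbb Z/M\mathbb Z$ and identify it with the set $\{N,N+1,\dots,N+M-1\}$ of representatives. Put $R:=M^{k^{-1}2^{-k-4}}$, let $\Lambda_R(n):=\sum_{d\mid n,\ d\le R}\mu(d)\log(R/d)$ with $\mu$ the Möbius function, let $\phi$ be Euler's totient function, and define $\nu=\nu_N:\mathbb Z_M\to[0,\infty)$ by $$\nu(n):=\begin{cases}\dfrac{\phi(W)}{W}\,\dfrac{\Lambda_R(Wn+1)^2}{\log R}&\text{if }\epsilon_kM\le n-N\le 2\epsilon_kM,\\[2mm]1&\text{otherwise,}\end{cases}\qquad N\le n<N+M.$$ **Proposition.** The function $\nu$ satisfies the $(k\cdot2^{k-1},\,3k-4,\,k)$-linear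 forms condition. That is, for every $\delta>0$ there is an $N_0$ such that for all $N\ge N_0$ the following holds. Let $m\le k\cdot 2^{k-1}$ and $t\le 3k-4$, let $(L_{ij})_{1\le i\le m,\,1\le j\le t}$ be rational numbers whose numerators and denominators (in lowest terms) are at most $k$ in absolute value, such that the $t$-tuples $(L_{ij})_{1\le j\le t}$, $1\le i\le m$, are non-zero and no one of them is a rational multiple of another, and let $b_1,\dots,b_m\in\mathbb Z_M$. Put $\psi_i(\mathbf x):=\sum_{j=1}^tL_{ij}x_j+b_i$ for $\mathbf x\in\mathbb Z_M^t$, where the $L_{ij}$ are interpreted as elements of the field $\mathbb Z_M$. Then $$\Bigl|\frac1{M^t}\sum_{\mathbf x\in\mathbb Z_M^t}\nu(\psi_1(\mathbf x))\cdots\nu(\psi_m(\mathbf x))-1\Bigr|\le\delta.$$ -/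

import Mathlib

open Filter
open scoped BigOperators

noncomputable section

namespace ShortIntervalPrimes

/-- The truncated divisor sum: the sum of `μ(d) log (R / d)` over the divisors `d ≤ R` of `n`. -/
def truncatedDivisorSum (R : ℝ) (n : ℕ) : ℝ :=
  ∑ d ∈ n.divisors.filter (fun d : ℕ => (d : ℝ) ≤ R),
    ((ArithmeticFunction.moebius d : ℤ) : ℝ) * Real.log (R / d)

/-- `ε_k = 1 / (2 ^ k * (k + 4)!)`. -/
def epsilon (k : ℕ) : ℝ := 1 / (2 ^ k * (Nat.factorial (k + 4) : ℝ))

/-- The sieve level `R = M ^ (k⁻¹ 2^(-k-4))`. -/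
def sieveLevel (k M : ℕ) : ℝ := (M : ℝ) ^ (1 / ((k : ℝ) * 2 ^ (k + 4)))

/-- `W = ∏_{p ≤ w} p`, the product of the primes up to the real number `w`. -/
def primeProduct (w : ℝ) : ℕ := ∏ p ∈ Finset.range (⌊w⌋₊ + 1) with p.Prime, p

/-- The representative of `x : ℤ/Mℤ` in the complete residue system `{N, N + 1, …, N + M - 1}`. -/
def representative (N M : ℕ) (x : ZMod M) : ℕ := N + (x - (N : ZMod M)).val

/-- The two-piece majorant `ν` on `ℤ/Mℤ`. With `n` the representative of `x` in `[N, N + M)`, it is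
`(φ(W) / W) * Λ_R(W n + 1)² / log R` when `ε_k M ≤ n - N ≤ 2 ε_k M`, and `1` otherwise. -/
def majorant (k N M : ℕ) (w : ℝ) (x : ZMod M) : ℝ :=
  if epsilon k * M ≤ (representative N M x : ℝ) - N ∧
      (representative N M x : ℝ) - N ≤ 2 * epsilon k * M then
    (Nat.totient (primeProduct w) : ℝ) / (primeProduct w : ℝ) *
      (truncatedDivisorSum (sieveLevel k M) (primeProduct w * representative N M x + 1) ^ 2 /
        Real.log (sieveLevel k M))
  else 1

/-- The majorant takes values in the nonnegative reals. -/
theorem majorant_nonneg (k N M : ℕ) (hM : 0 < M) (w : ℝ) (x : ZMod M) :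
    0 ≤ majorant k N M w x := by
  unfold majorant
  have hM1 : (1 : ℝ) ≤ M := by exact_mod_cast hM
  have hR : 1 ≤ sieveLevel k M := Real.one_le_rpow hM1 (by positivity)
  have hlog : 0 ≤ Real.log (sieveLevel k M) := Real.log_nonneg hR
  split_ifs
  · positivity
  · exact zero_le_one

/-- The `(m₀, t₀, L₀)`-linear forms condition for a family `ν N : ℤ/M(N)ℤ → ℝ`, with the error term
`o(1)` taken as `N → ∞`. It is uniform in the number of forms `m ≤ m₀`, the number of variables
`t ≤ t₀`, the admissible rational coefficients `L i j` and the constant terms `b i`.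
Rational coefficients act on the field `ℤ/M(N)ℤ` through the cast `a / b ↦ a * b⁻¹`. -/
def LinearFormsCondition (M : ℕ → ℕ) [∀ N, Fact (M N).Prime] (ν : ∀ N, ZMod (M N) → ℝ)
    (m₀ t₀ L₀ : ℕ) : Prop :=
  ∀ δ : ℝ, 0 < δ → ∀ᶠ N in atTop,
    ∀ m ≤ m₀, ∀ t ≤ t₀, ∀ L : Fin m → Fin t → ℚ,
      (∀ i j, |(L i j).num| ≤ (L₀ : ℤ) ∧ (L i j).den ≤ L₀) →
      (∀ i, L i ≠ 0) →
      (∀ i i', i ≠ i' → ∀ q : ℚ, L i ≠ q • L i') →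
      ∀ b : Fin m → ZMod (M N),
        |(𝔼 x : Fin t → ZMod (M N),
            ∏ i, ν N (∑ j, ((L i j : ℚ) : ZMod (M N)) * x j + b i)) - 1| ≤ δ

end ShortIntervalPrimes

end

namespace ShortIntervalPrimes

/-! The average is computed on short boxes, where it becomes a sieve sum with an explicit Euler
product.

Local to global. Clear denominators by substituting `k! * x`, so that the forms are integral with
coefficients bounded in terms of `k`. By translation invariance the average over `x` is the average
over base points `a` of averages over `a + z`, with `z` in a box of side `H = √M + 1`. As `H` is
small compared with `M`, for most `a` no form crosses an endpoint of the window during its box. Each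
factor is then either constantly `1` or a sieve weight at an integral affine form, and only averages
of sieve weights over subsystems are needed. The exceptional `a` have density `O(H / M)`, and a
crude bound on them suffices.

Sieve averages. Since `W n + 1` has no prime factor up to `w`, only divisors built from primes in
`(w, R]` matter. As `R ^ (5 m)` is small compared with `H`, a box average may be replaced by the
average over a full period, and the Chinese remainder theorem factors that into local factors. The
factors are kept formal: they live in the monoid algebra of `(I × Bool → ℕ)`, which acts on bounded
functions by commuting dilations of norm at most `1`, and the average is the value at `1` of their
product applied to `logWeight`, the function `e ↦ ∏ log⁺ (R / e j)`. This replaces contour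
integration by operator norm estimates.

Comparison with a model. For `p > w` the forms are nonzero and pairwise independent modulo `p`, so
one form vanishes with probability `1 / p` and two together with probability `1 / p ^ 2`. If `x i`,
`y i` are the dilations by `p` in the two coordinates of `i`, the local factor is `∏ (1 - x i / p)
(1 - y i / p) / (1 - x i y i / p)` up to `O(1 / p ^ 2)`, and over `p > w` these errors multiply to
`1 + O(1 / w)` (`abs_dilationAct_prod_sub_le`). The model separates over `i`, and its value is a
power of `∑ T(R / g) ^ 2 / g` over `g ≤ R` coprime to `W`, where `T = mobiusLogSum W`.

Evaluation. The prime number theorem, in the form `∑ μ(n) / n * log (x / n) → 1`, gives `T → W /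
φ(W)` with uniformity in `W` (`abs_mobiusLogError_prod_le_add`). The sum of `1 / g` over `g ≤ R`
coprime to `W` is about `φ(W) / W * log R`. The model is thus asymptotic to `(W / φ(W) * log R) ^
m`, which the normalization of the majorant cancels. The prime number theorem itself comes from a
Tauberian theorem and the nonvanishing of `ζ` on the line `Re s = 1`. -/

/-! ### A Tauberian theorem for Laplace transforms -/

open MeasureTheory Topology FourierTransform in
/-- The convolution of a bounded function with the Fourier transform of a test function tends to
zero when its Laplace transform extends continuously to the closed right half plane. -/
theorem tendsto_convolution_fourier_of_laplace {f : ℝ → ℂ} {C : ℝ} (hfm : Measurable f)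
    (hfC : ∀ u, ‖f u‖ ≤ C) (hf0 : ∀ u < 0, f u = 0) {F : ℂ → ℂ}
    (hF : ContinuousOn F {s | 0 ≤ s.re})
    (hFf : ∀ s : ℂ, 0 < s.re → ∫ u : ℝ, f u * Complex.exp (-s * u) = F s)
    (φ : SchwartzMap ℝ ℂ) (hφ : HasCompactSupport φ) :
    Tendsto (fun v : ℝ => ∫ u : ℝ, f u * (𝓕 (φ : ℝ → ℂ)) (v - u)) atTop (𝓝 0) := by
  have hC : 0 ≤ C := (norm_nonneg _).trans (hfC 0)
  have hφi : Integrable (φ : ℝ → ℂ) := φ.integrable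
  have hKi : Integrable (𝓕 (φ : ℝ → ℂ)) := by
    have := (𝓕 φ).integrable (μ := volume)
    simpa [SchwartzMap.fourier_coe] using this
  -- Since `f` need not be integrable, damp it by `exp (-σ u)`, apply Fubini, and let `σ → 0+` on
  -- both sides.
  have key : ∀ v : ℝ, ∫ u : ℝ, f u * (𝓕 (φ : ℝ → ℂ)) (v - u)
      = 𝓕 (fun t : ℝ => φ t * F (-(2 * Real.pi * t) * Complex.I)) v := by
    intro v
    have fubini : ∀ σ : ℝ, 0 < σ →
        ∫ u : ℝ, f u * Complex.exp (-σ * u) * (𝓕 (φ : ℝ → ℂ)) (v - u)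
        = ∫ t : ℝ, Complex.exp (-(2 * Real.pi * t * v) * Complex.I) *
            (φ t * F (σ - (2 * Real.pi * t) * Complex.I)) := by
      intro σ hσ
      have hfe : Integrable (fun u : ℝ => f u * Complex.exp (-σ * u)) := by
        have h1 : IntegrableOn (fun u : ℝ => C * Real.exp (-σ * u)) (Set.Ioi 0) :=
          (integrableOn_exp_mul_Ioi (by linarith : -σ < 0) 0).const_mul C
        have h2 : IntegrableOn (fun u : ℝ => f u * Complex.exp (-σ * u)) (Set.Ioi 0) := by
          refine h1.mono' (by fun_prop) (Eventually.of_forall fun u => ?_)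
          rw [norm_mul, Complex.norm_exp]
          simp only [Complex.mul_re, Complex.neg_re, Complex.ofReal_re, Complex.neg_im,
            Complex.ofReal_im, neg_zero, zero_mul, sub_zero]
          gcongr
          exact hfC u
        have h3 : IntegrableOn (fun u : ℝ => f u * Complex.exp (-σ * u)) (Set.Ici 0) :=
          (integrableOn_Ici_iff_integrableOn_Ioi ..).mpr h2
        refine h3.integrable_of_forall_notMem_eq_zero fun u hu => ?_
        rw [hf0 u (by simpa using hu), zero_mul]
      have hprod : Integrable (fun z : ℝ × ℝ => f z.1 * Complex.exp (-σ * z.1) * φ z.2 *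
          Complex.exp (-(2 * Real.pi * z.2 * (v - z.1)) * Complex.I)) := by
        refine (hfe.mul_prod hφi).mul_bdd (c := 1) (by fun_prop) ?_
        refine Eventually.of_forall fun z => ?_
        rw [show (-(2 * Real.pi * z.2 * (v - z.1)) * Complex.I : ℂ)
          = ((-(2 * Real.pi * z.2 * (v - z.1)) : ℝ) : ℂ) * Complex.I by push_cast; ring,
          Complex.norm_exp_ofReal_mul_I]
      have hswap := integral_integral_swap (f := fun u t : ℝ => f u * Complex.exp (-σ * u) * φ t *
          Complex.exp (-(2 * Real.pi * t * (v - u)) * Complex.I)) hprod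
      calc _ = ∫ u : ℝ, ∫ t : ℝ, f u * Complex.exp (-σ * u) * φ t *
          Complex.exp (-(2 * Real.pi * t * (v - u)) * Complex.I) := by
            congr 1 with u
            rw [Real.fourier_real_eq_integral_exp_smul, ← integral_const_mul]
            congr 1 with t
            rw [smul_eq_mul]
            push_cast
            ring_nf
        _ = ∫ t : ℝ, ∫ u : ℝ, f u * Complex.exp (-σ * u) * φ t *
          Complex.exp (-(2 * Real.pi * t * (v - u)) * Complex.I) := hswap
        _ = _ := by
            congr 1 with t
            rw [← hFf _ (by simpa using hσ), ← integral_const_mul, ← integral_const_mul]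
            congr 1 with u
            have : Complex.exp (-(2 * Real.pi * t * (v - u)) * Complex.I) * Complex.exp (-σ * u)
              = Complex.exp (-(2 * Real.pi * t * v) * Complex.I) *
                Complex.exp (-(σ - (2 * Real.pi * t) * Complex.I) * u) := by
              rw [← Complex.exp_add, ← Complex.exp_add]; ring_nf
            linear_combination (f u * φ t) * this
    have lim1 : Tendsto (fun σ : ℝ => ∫ u : ℝ, f u * Complex.exp (-σ * u) *
        (𝓕 (φ : ℝ → ℂ)) (v - u)) (𝓝[>] 0) (𝓝 (∫ u : ℝ, f u * (𝓕 (φ : ℝ → ℂ)) (v - u))) := by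
      refine tendsto_integral_filter_of_dominated_convergence
        (fun u => C * ‖(𝓕 (φ : ℝ → ℂ)) (v - u)‖) ?_ ?_ ?_ ?_
      · refine Eventually.of_forall fun σ => ?_
        exact (hfm.mul (by fun_prop)).aestronglyMeasurable.mul
          ((hKi.comp_sub_left v).aestronglyMeasurable)
      · filter_upwards [self_mem_nhdsWithin] with σ hσ
        refine Eventually.of_forall fun u => ?_
        rw [norm_mul]
        gcongr
        rcases lt_or_ge u 0 with hu | hu
        · simp [hf0 u hu, hC]
        · rw [norm_mul, Complex.norm_exp]
          simp only [Complex.mul_re, Complex.neg_re, Complex.ofReal_re, Complex.neg_im,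
            Complex.ofReal_im, neg_zero, zero_mul, sub_zero]
          have : Real.exp (-σ * u) ≤ 1 := by
            rw [Real.exp_le_one_iff]
            have : 0 ≤ σ * u := mul_nonneg (le_of_lt hσ) hu
            linarith
          calc _ ≤ C * 1 := by gcongr; exact hfC u
            _ = C := mul_one C
      · exact (hKi.comp_sub_left v).norm.const_mul C
      · refine Eventually.of_forall fun u => ?_
        have : Tendsto (fun σ : ℝ => f u * Complex.exp (-σ * u) * (𝓕 (φ : ℝ → ℂ)) (v - u)) (𝓝 0)
            (𝓝 (f u * Complex.exp (-(0 : ℝ) * u) * (𝓕 (φ : ℝ → ℂ)) (v - u))) := by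
          apply Continuous.tendsto' (by fun_prop); rfl
        simpa using this.mono_left nhdsWithin_le_nhds
    -- The compact support of `φ` makes continuity of `F` up to the boundary enough for a dominating
    -- function.
    obtain ⟨B, hB⟩ : ∃ B : ℝ, ∀ σ : ℝ, 0 ≤ σ → σ ≤ 1 → ∀ t : ℝ, φ t ≠ 0 →
        ‖F (σ - (2 * Real.pi * t) * Complex.I)‖ ≤ B := by
      have hcomp : IsCompact (Set.Icc (0 : ℝ) 1 ×ˢ tsupport φ) := isCompact_Icc.prod hφ
      have hcont : ContinuousOn (fun z : ℝ × ℝ => F (z.1 - (2 * Real.pi * z.2) * Complex.I))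
          (Set.Icc (0 : ℝ) 1 ×ˢ tsupport φ) := by
        refine hF.comp (by fun_prop) ?_
        rintro ⟨a, b⟩ ⟨ha, -⟩
        simpa using ha.1
      obtain ⟨B, hB⟩ := hcomp.exists_bound_of_continuousOn hcont
      exact ⟨B, fun σ h0 h1 t ht => hB (σ, t) ⟨⟨h0, h1⟩, subset_tsupport _ ht⟩⟩
    have hcσ : ∀ σ : ℝ, 0 ≤ σ → Continuous (fun t : ℝ => F (σ - (2 * Real.pi * t) * Complex.I)) := by
      intro σ hσ
      refine hF.comp_continuous (by fun_prop) fun t => ?_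
      simpa using hσ
    have lim2 : Tendsto (fun σ : ℝ => ∫ t : ℝ, Complex.exp (-(2 * Real.pi * t * v) * Complex.I) *
            (φ t * F (σ - (2 * Real.pi * t) * Complex.I))) (𝓝[>] 0)
        (𝓝 (∫ t : ℝ, Complex.exp (-(2 * Real.pi * t * v) * Complex.I) *
            (φ t * F ((0 : ℝ) - (2 * Real.pi * t) * Complex.I)))) := by
      refine tendsto_integral_filter_of_dominated_convergence
        (fun t => ‖φ t‖ * B) ?_ ?_ ?_ ?_
      · filter_upwards [self_mem_nhdsWithin] with σ hσ
        have := hcσ σ (le_of_lt hσ)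
        have h2 := φ.continuous
        exact (Continuous.mul (by fun_prop) (h2.mul this)).aestronglyMeasurable
      · filter_upwards [Ioc_mem_nhdsGT (zero_lt_one (α := ℝ))] with σ hσ
        refine Eventually.of_forall fun t => ?_
        rw [norm_mul, show (-(2 * Real.pi * t * v) * Complex.I : ℂ)
          = ((-(2 * Real.pi * t * v) : ℝ) : ℂ) * Complex.I by push_cast; ring,
          Complex.norm_exp_ofReal_mul_I, one_mul, norm_mul]
        by_cases h : φ t = 0
        · simp [h]
        · gcongr
          exact hB σ hσ.1.le hσ.2 t h
      · exact hφi.norm.mul_const B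
      · refine Eventually.of_forall fun t => ?_
        refine Tendsto.const_mul _ (Tendsto.const_mul _ ?_)
        have h1 : ContinuousOn (fun σ : ℝ => F (σ - (2 * Real.pi * t) * Complex.I)) (Set.Ici 0) := by
          refine hF.comp (by fun_prop) ?_
          intro a ha
          simpa using ha
        exact (h1 0 Set.self_mem_Ici).mono_left (nhdsWithin_mono _ Set.Ioi_subset_Ici_self)
    have lim1' := lim1.congr' (by
      filter_upwards [self_mem_nhdsWithin] with σ hσ using fubini σ hσ)
    rw [tendsto_nhds_unique lim1' lim2, Real.fourier_real_eq_integral_exp_smul]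
    congr 1 with t
    rw [smul_eq_mul]
    push_cast
    ring_nf
  -- Riemann–Lebesgue.
  have hRL := (Real.zero_at_infty_fourier
    (fun t : ℝ => φ t * F (-(2 * Real.pi * t) * Complex.I))).mono_left atTop_le_cocompact
  exact hRL.congr fun v => (key v).symm

open MeasureTheory Topology FourierTransform in
/-- A Tauberian theorem: a bounded Lipschitz function whose Laplace transform extends continuously
to the closed right half plane tends to zero. -/
theorem tendsto_zero_of_laplace {f : ℝ → ℂ} {C : ℝ} (hfC : ∀ u, ‖f u‖ ≤ C)
    (hfL : ∀ u v, ‖f u - f v‖ ≤ C * |u - v|) (hf0 : ∀ u < 0, f u = 0) {F : ℂ → ℂ}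
    (hF : ContinuousOn F {s | 0 ≤ s.re})
    (hFf : ∀ s : ℂ, 0 < s.re → ∫ u : ℝ, f u * Complex.exp (-s * u) = F s) :
    Tendsto f atTop (𝓝 0) := by
  have hC : 0 ≤ C := (norm_nonneg _).trans (hfC 0)
  have hcont : Continuous f := by
    refine (LipschitzWith.of_dist_le_mul (K := C.toNNReal) fun u v => ?_).continuous
    rw [dist_eq_norm, Real.dist_eq, Real.coe_toNNReal C hC]
    exact hfL u v
  -- Any test function equal to `1` at the origin would do: by Fourier inversion its transform `K`
  -- then has total mass `1`.
  let b : ContDiffBump (0 : ℝ) := ⟨1, 2, one_pos, one_lt_two⟩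
  have hbs : HasCompactSupport (fun t : ℝ => ((b t : ℝ) : ℂ)) :=
    b.hasCompactSupport.comp_left (g := fun x : ℝ => (x : ℂ)) Complex.ofReal_zero
  let φ : SchwartzMap ℝ ℂ := hbs.toSchwartzMap
    (Complex.ofRealCLM.contDiff.comp b.contDiff)
  have hφ0 : φ 0 = 1 := by
    change ((b 0 : ℝ) : ℂ) = 1
    rw [b.one_of_mem_closedBall (by simp [b])]
    simp
  set K : ℝ → ℂ := 𝓕 (φ : ℝ → ℂ) with hK
  have hKφ : K = (𝓕 φ : SchwartzMap ℝ ℂ) := by rw [hK, SchwartzMap.fourier_coe]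
  have hKi : Integrable K := by rw [hKφ]; exact (𝓕 φ).integrable
  have hKx : Integrable (fun x : ℝ => |x| * ‖K x‖) := by
    have := (𝓕 φ).integrable_pow_mul (μ := volume) 1
    simpa [hKφ] using this
  have hK1 : ∫ x, K x = 1 := by
    have h := φ.continuous.fourierInv_fourier_eq φ.integrable hKi
    have h0 := congrFun h 0
    rw [hφ0, Real.fourierInv_eq'] at h0
    simpa using h0
  set J : ℝ := ∫ x : ℝ, |x| * ‖K x‖ with hJ
  have hJ0 : 0 ≤ J := integral_nonneg fun x => by positivity
  rw [Metric.tendsto_atTop']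
  intro ε hε
  -- Stretching `f` by `l` makes it Lipschitz with constant `C / l`, so smoothing by `K`, whose
  -- first absolute moment is `J`, moves it by at most `C * J / l < ε / 2`.
  set l : ℝ := 2 * (C * J + 1) / ε with hl
  have hlpos : 0 < l := by positivity
  have hconv := tendsto_convolution_fourier_of_laplace (f := fun u => f (u / l)) (C := C)
    (F := fun s => l * F (l * s)) (by fun_prop) (fun u => hfC _)
    (fun u hu => hf0 _ (div_neg_of_neg_of_pos hu hlpos))
    (by
      refine ContinuousOn.mul continuousOn_const (hF.comp (by fun_prop) ?_)
      intro s hs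
      simpa using mul_nonneg hlpos.le hs)
    (by
      intro s hs
      rw [← hFf _ (by simpa using mul_pos hlpos hs)]
      have := Measure.integral_comp_div (fun y : ℝ => f y * Complex.exp (-(l * s) * y)) l
      rw [abs_of_pos hlpos, Complex.real_smul] at this
      rw [← this]
      congr 1 with u
      congr 2
      push_cast
      have : (l : ℂ) ≠ 0 := by exact_mod_cast hlpos.ne'
      field_simp)
    φ hbs
  rw [Metric.tendsto_atTop'] at hconv
  obtain ⟨V, hV⟩ := hconv (ε / 2) (by positivity)
  refine ⟨V / l, fun u hu => ?_⟩
  have hv := hV (u * l) (by rwa [gt_iff_lt, div_lt_iff₀ hlpos] at hu)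
  rw [dist_zero_right] at hv ⊢
  have hshift : ∀ v : ℝ, Integrable (fun x => K (v - x)) := fun v => hKi.comp_sub_left v
  have e1 : f u = ∫ x, f u * K (u * l - x) := by
    rw [integral_const_mul, integral_sub_left_eq_self K volume, hK1, mul_one]
  have hint2 : Integrable (fun x : ℝ => f (x / l) * K (u * l - x)) :=
    (hshift _).bdd_mul (c := C) (by fun_prop) (Eventually.of_forall fun x => hfC _)
  have e2 : ‖f u - ∫ x, f (x / l) * K (u * l - x)‖ ≤ C / l * J := by
    nth_rw 1 [e1]
    rw [← integral_sub ((hshift _).const_mul _) hint2, hJ, ← integral_const_mul,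
      ← integral_sub_left_eq_self (fun x : ℝ => C / l * (|x| * ‖K x‖)) volume (u * l)]
    refine norm_integral_le_of_norm_le ((hKx.const_mul _).comp_sub_left _)
      (Eventually.of_forall fun x => ?_)
    rw [← sub_mul, norm_mul, ← mul_assoc]
    gcongr
    refine (hfL _ _).trans_eq ?_
    rw [show u - x / l = (u * l - x) / l by field_simp, abs_div, abs_of_pos hlpos]
    ring
  have e3 : C / l * J < ε / 2 := by
    rw [hl, div_div_eq_mul_div, div_mul_eq_mul_div, div_lt_div_iff₀ (by positivity) (by positivity)]
    nlinarith
  calc ‖f u‖ ≤ ‖f u - ∫ x, f (x / l) * K (u * l - x)‖ + ‖∫ x, f (x / l) * K (u * l - x)‖ := by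
        simpa using norm_add_le (f u - ∫ x, f (x / l) * K (u * l - x))
          (∫ x, f (x / l) * K (u * l - x))
    _ < ε := by linarith

/-! ### Möbius sums and the prime number theorem -/

open ArithmeticFunction Real in
/-- The sum of `μ(n) / n * log⁺ (x / n)` over the `n ≤ x` coprime to `q`. -/
noncomputable def mobiusLogSum (q : ℕ) (x : ℝ) : ℝ :=
  ∑ n ∈ Finset.Icc 1 ⌊x⌋₊ with n.Coprime q, (moebius n : ℝ) / n * posLog (x / n)

theorem posLog_div_eq_zero {x : ℝ} (hx : 0 ≤ x) {n : ℕ} (h : ⌊x⌋₊ < n) :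
    Real.posLog (x / n) = 0 := by
  have hn : (0 : ℝ) < n := by exact_mod_cast (Nat.zero_le _).trans_lt h
  rw [Real.posLog_eq_zero_iff, abs_of_nonneg (by positivity), div_le_one hn]
  exact ((Nat.floor_lt hx).mp h).le

theorem abs_moebius_le_one (n : ℕ) : |((ArithmeticFunction.moebius n : ℤ) : ℝ)| ≤ 1 := by
  exact_mod_cast ArithmeticFunction.abs_moebius_le_one

/-- The index set is flexible: `log⁺` kills the terms beyond `x` and `μ` kills the terms that are
not squarefree. -/
theorem mobiusLogSum_eq_sum {q : ℕ} {x : ℝ} (hx : 0 ≤ x) (s : Finset ℕ)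
    (hs : ∀ n ∈ s, 0 < n ∧ n.Coprime q)
    (hs' : ∀ n, 0 < n → n ≤ ⌊x⌋₊ → n.Coprime q → Squarefree n → n ∈ s) :
    mobiusLogSum q x =
      ∑ n ∈ s, (ArithmeticFunction.moebius n : ℝ) / n * Real.posLog (x / n) := by
  classical
  unfold mobiusLogSum
  set f : ℕ → ℝ := fun n => (ArithmeticFunction.moebius n : ℝ) / n * Real.posLog (x / n)
  set a := {n ∈ Finset.Icc 1 ⌊x⌋₊ | n.Coprime q}
  have h1 : ∑ n ∈ a ∩ s, f n = ∑ n ∈ a, f n := by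
    refine Finset.sum_subset Finset.inter_subset_left fun n hn hn' => ?_
    simp only [a, Finset.mem_inter, Finset.mem_filter, Finset.mem_Icc, not_and] at hn hn'
    have : ¬ Squarefree n := fun hsq => hn' hn (hs' n (by omega) hn.1.2 hn.2 hsq)
    simp [f, ArithmeticFunction.moebius_eq_zero_of_not_squarefree this]
  have h2 : ∑ n ∈ a ∩ s, f n = ∑ n ∈ s, f n := by
    refine Finset.sum_subset Finset.inter_subset_right fun n hn hn' => ?_
    have h3 : ⌊x⌋₊ < n := by
      by_contra hlt
      refine hn' (Finset.mem_inter.mpr ⟨?_, hn⟩)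
      simp only [a, Finset.mem_filter, Finset.mem_Icc]
      exact ⟨⟨(hs n hn).1, by omega⟩, (hs n hn).2⟩
    simp [f, posLog_div_eq_zero hx h3]
  rw [← h1, h2]

theorem mobiusLogSum_of_lt_one {q : ℕ} {x : ℝ} (hx : x < 1) : mobiusLogSum q x = 0 := by
  simp [mobiusLogSum, Nat.floor_eq_zero.mpr hx]

theorem mobiusLogSum_one_eq_sum {x : ℝ} (hx : 0 ≤ x) {B : ℕ} (hB : ⌊x⌋₊ ≤ B) :
    mobiusLogSum 1 x =
      ∑ n ∈ Finset.Icc 1 B, (ArithmeticFunction.moebius n : ℝ) / n * Real.posLog (x / n) :=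
  mobiusLogSum_eq_sum hx _ (fun n hn => ⟨(Finset.mem_Icc.mp hn).1, by simp⟩)
    (fun n h1 h2 _ _ => Finset.mem_Icc.mpr ⟨h1, h2.trans hB⟩)

/-- Möbius inversion for a finitely supported function. -/
theorem sum_moebius_mul_sum {f : ℕ → ℝ} {N : ℕ} (hN : 1 ≤ N) (hf : ∀ j, N < j → f j = 0) :
    ∑ d ∈ Finset.Icc 1 N, (ArithmeticFunction.moebius d : ℝ) *
      ∑ g ∈ Finset.Icc 1 N, f (d * g) = f 1 := by
  classical
  simp_rw [Finset.mul_sum]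
  rw [← Finset.sum_product']
  have hmaps : ∀ z ∈ Finset.Icc 1 N ×ˢ Finset.Icc 1 N, z.1 * z.2 ∈ Finset.Icc 1 (N * N) := by
    intro z hz
    simp only [Finset.mem_product, Finset.mem_Icc] at hz ⊢
    exact ⟨Nat.mul_pos hz.1.1 hz.2.1, Nat.mul_le_mul hz.1.2 hz.2.2⟩
  -- Group the pairs by their product `j`; the sum of `μ` over the divisors of `j` vanishes unless
  -- `j = 1`.
  rw [← Finset.sum_fiberwise_of_maps_to hmaps, Finset.sum_eq_single 1]
  · have : {z ∈ Finset.Icc 1 N ×ˢ Finset.Icc 1 N | z.1 * z.2 = 1} = {((1 : ℕ), (1 : ℕ))} := by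
      ext ⟨a, b⟩
      simp only [Finset.mem_filter, Finset.mem_product, Finset.mem_Icc, mul_eq_one,
        Finset.mem_singleton, Prod.mk.injEq]
      constructor
      · exact fun h => h.2
      · rintro ⟨rfl, rfl⟩; omega
    rw [this]
    simp
  · intro j hj hj1
    rcases lt_or_ge N j with h | h
    · refine Finset.sum_eq_zero fun z hz => ?_
      rw [(Finset.mem_filter.mp hz).2, hf j h, mul_zero]
    · have hj0 : j ≠ 0 := by have := (Finset.mem_Icc.mp hj).1; omega
      have : {z ∈ Finset.Icc 1 N ×ˢ Finset.Icc 1 N | z.1 * z.2 = j} = j.divisorsAntidiagonal := by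
        ext ⟨a, b⟩
        simp only [Finset.mem_filter, Finset.mem_product, Finset.mem_Icc,
          Nat.mem_divisorsAntidiagonal]
        constructor
        · rintro ⟨-, h2⟩
          exact ⟨h2, hj0⟩
        · rintro ⟨h2, -⟩
          have ha : a ≠ 0 := by rintro rfl; omega
          have hb : b ≠ 0 := by rintro rfl; omega
          refine ⟨⟨⟨by omega, ?_⟩, ⟨by omega, ?_⟩⟩, h2⟩
          · exact (Nat.le_mul_of_pos_right a (by omega)).trans (h2.le.trans h)
          · exact (Nat.le_mul_of_pos_left b (by omega)).trans (h2.le.trans h)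
      rw [this]
      have h1 : ∀ z ∈ j.divisorsAntidiagonal,
          (ArithmeticFunction.moebius z.1 : ℝ) * f (z.1 * z.2)
          = (ArithmeticFunction.moebius z.1 : ℝ) * f j := by
        intro z hz
        rw [(Nat.mem_divisorsAntidiagonal.mp hz).1]
      rw [Finset.sum_congr rfl h1, ← Finset.sum_mul,
        Nat.sum_divisorsAntidiagonal (fun d _ => (ArithmeticFunction.moebius d : ℝ))]
      have h2 := ArithmeticFunction.coe_moebius_mul_coe_zeta (R := ℝ)
      have h3 := congrArg (fun g : ArithmeticFunction ℝ => g j) h2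
      simp only [ArithmeticFunction.coe_mul_zeta_apply,
        ArithmeticFunction.intCoe_apply, ArithmeticFunction.one_apply, hj1, if_false] at h3
      rw [h3, zero_mul]
  · intro h
    exact absurd (Finset.mem_Icc.mpr ⟨le_rfl, Nat.mul_pos hN hN⟩) h

/-- Möbius inversion of the indicator of `[1, N]` gives `∑ μ(d) ⌊N / d⌋ = 1`. Dropping the floors
costs at most `N`, so `N` times the sum is at most `N + 1`. -/
theorem abs_sum_moebius_div_le (N : ℕ) :
    |∑ n ∈ Finset.Icc 1 N, (ArithmeticFunction.moebius n : ℝ) / n| ≤ 2 := by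
  rcases Nat.eq_zero_or_pos N with rfl | hN
  · simp
  have hNr : (1 : ℝ) ≤ N := by exact_mod_cast hN
  have h := sum_moebius_mul_sum (f := fun j => if j ≤ N then (1 : ℝ) else 0) hN
    (fun j hj => if_neg (by omega))
  rw [if_pos (Nat.succ_le_of_lt hN)] at h
  have h1 : ∀ d ∈ Finset.Icc 1 N,
      ∑ g ∈ Finset.Icc 1 N, (if d * g ≤ N then (1 : ℝ) else 0) = ((N / d : ℕ) : ℝ) := by
    intro d hd
    have hd0 := (Finset.mem_Icc.mp hd).1
    rw [← Finset.sum_filter, Finset.sum_const, nsmul_eq_mul, mul_one]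
    have : {g ∈ Finset.Icc 1 N | d * g ≤ N} = Finset.Icc 1 (N / d) := by
      ext g
      simp only [Finset.mem_filter, Finset.mem_Icc, Nat.le_div_iff_mul_le hd0, mul_comm d g]
      constructor
      · rintro ⟨⟨h1, h2⟩, h3⟩; exact ⟨h1, h3⟩
      · rintro ⟨h1, h2⟩; exact ⟨⟨h1, (Nat.le_mul_of_pos_right g hd0).trans h2⟩, h2⟩
    rw [this, Nat.card_Icc, Nat.add_sub_cancel]
  rw [Finset.sum_congr rfl fun d hd => by rw [h1 d hd]] at h
  have h2 : |(N : ℝ) * ∑ n ∈ Finset.Icc 1 N, (ArithmeticFunction.moebius n : ℝ) / n - 1| ≤ N := by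
    conv_lhs => rw [← h]
    rw [Finset.mul_sum, ← Finset.sum_sub_distrib]
    refine (Finset.abs_sum_le_sum_abs _ _).trans ?_
    have : ∀ d ∈ Finset.Icc 1 N, |(N : ℝ) * ((ArithmeticFunction.moebius d : ℝ) / d) -
        (ArithmeticFunction.moebius d : ℝ) * ((N / d : ℕ) : ℝ)| ≤ 1 := by
      intro d hd
      rw [show (N : ℝ) * ((ArithmeticFunction.moebius d : ℝ) / d) -
        (ArithmeticFunction.moebius d : ℝ) * ((N / d : ℕ) : ℝ)
        = (ArithmeticFunction.moebius d : ℝ) * ((N : ℝ) / d - ((N / d : ℕ) : ℝ)) by ring, abs_mul]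
      have h3 : |(N : ℝ) / d - ((N / d : ℕ) : ℝ)| ≤ 1 := by
        rw [← Nat.floor_div_eq_div (K := ℝ), abs_le]
        have := Nat.floor_le (show (0 : ℝ) ≤ (N : ℝ) / d by positivity)
        have := Nat.lt_floor_add_one ((N : ℝ) / d)
        constructor <;> linarith
      calc _ ≤ (1 : ℝ) * 1 := by gcongr; exact abs_moebius_le_one d
        _ = 1 := one_mul 1
    refine (Finset.sum_le_sum this).trans ?_
    simp
  set m := ∑ n ∈ Finset.Icc 1 N, (ArithmeticFunction.moebius n : ℝ) / n
  have h3 : |(N : ℝ) * m| ≤ N + 1 := by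
    have := abs_sub_abs_le_abs_sub ((N : ℝ) * m) 1
    rw [abs_one] at this
    linarith
  rw [abs_mul, abs_of_pos (by linarith : (0 : ℝ) < N)] at h3
  nlinarith [abs_nonneg m]

theorem abs_harmonic_floor_sub_le {y : ℝ} (hy : 1 ≤ y) :
    |(harmonic ⌊y⌋₊ : ℝ) - Real.log y - Real.eulerMascheroniConstant| ≤ 2 / y := by
  set n := ⌊y⌋₊ with hn
  have hn1 : 1 ≤ n := (Nat.one_le_floor_iff y).mpr hy
  have hn1' : (1 : ℝ) ≤ n := by exact_mod_cast hn1
  have h1 := Real.eulerMascheroniSeq_lt_eulerMascheroniConstant n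
  have h2 := Real.eulerMascheroniConstant_lt_eulerMascheroniSeq' n
  rw [Real.eulerMascheroniSeq] at h1
  rw [Real.eulerMascheroniSeq', if_neg (by omega)] at h2
  have h3 : (n : ℝ) ≤ y := Nat.floor_le (by linarith)
  have h4 : y < n + 1 := Nat.lt_floor_add_one y
  have h5 : Real.log n ≤ Real.log y := Real.log_le_log (by linarith) h3
  have h6 : Real.log y ≤ Real.log (n + 1) := Real.log_le_log (by linarith) h4.le
  have h7 : Real.log (n + 1) - Real.log n ≤ 1 / n := by
    rw [← Real.log_div (by linarith) (by linarith)]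
    refine (Real.log_le_sub_one_of_pos (by positivity)).trans_eq ?_
    field_simp
    ring
  have h8 : (1 : ℝ) / n ≤ 2 / y := by
    rw [div_le_div_iff₀ (by linarith) (by linarith)]
    linarith
  rw [abs_le]
  constructor <;> linarith

/-- Möbius inversion of `1 / j` gives `1 = ∑ μ(d) / d * harmonic ⌊x / d⌋`. Insert `harmonic ⌊y⌋ =
log y + γ + O(1 / y)`: the errors add up to at most `2`, and the `γ` term is at most `4 / 3`. -/
theorem abs_mobiusLogSum_one_le (x : ℝ) : |mobiusLogSum 1 x| ≤ 5 := by
  rcases lt_or_ge x 1 with hx | hx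
  · simp [mobiusLogSum_of_lt_one hx]
  set N := ⌊x⌋₊ with hN
  have hN1 : 1 ≤ N := (Nat.one_le_floor_iff x).mpr hx
  have hx0 : 0 < x := by linarith
  have h := sum_moebius_mul_sum (f := fun j => if j ≤ N then (1 : ℝ) / j else 0) hN1
    (fun j hj => if_neg (by omega))
  rw [if_pos hN1, Nat.cast_one, div_one] at h
  have h1 : ∀ d ∈ Finset.Icc 1 N,
      ∑ g ∈ Finset.Icc 1 N, (if d * g ≤ N then (1 : ℝ) / ((d * g : ℕ) : ℝ) else 0)
        = 1 / d * (harmonic ⌊x / d⌋₊ : ℝ) := by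
    intro d hd
    have hd0 := (Finset.mem_Icc.mp hd).1
    rw [← Finset.sum_filter]
    have : {g ∈ Finset.Icc 1 N | d * g ≤ N} = Finset.Icc 1 (N / d) := by
      ext g
      simp only [Finset.mem_filter, Finset.mem_Icc, Nat.le_div_iff_mul_le hd0, mul_comm d g]
      constructor
      · rintro ⟨⟨h1, h2⟩, h3⟩; exact ⟨h1, h3⟩
      · rintro ⟨h1, h2⟩; exact ⟨⟨h1, (Nat.le_mul_of_pos_right g hd0).trans h2⟩, h2⟩
    rw [this, Nat.floor_div_natCast, harmonic_eq_sum_Icc]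
    push_cast
    rw [Finset.mul_sum]
    refine Finset.sum_congr rfl fun g _ => ?_
    rw [one_div, one_div, mul_inv]
  rw [Finset.sum_congr rfl fun d hd => by rw [h1 d hd]] at h
  set γ := Real.eulerMascheroniConstant
  have h2 : |mobiusLogSum 1 x + γ * ∑ n ∈ Finset.Icc 1 N, (ArithmeticFunction.moebius n : ℝ) / n
      - 1| ≤ 2 := by
    rw [mobiusLogSum_one_eq_sum hx0.le le_rfl]
    conv_lhs => rw [← h]
    rw [Finset.mul_sum, ← Finset.sum_add_distrib, ← Finset.sum_sub_distrib]
    refine (Finset.abs_sum_le_sum_abs _ _).trans ?_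
    have : ∀ d ∈ Finset.Icc 1 N,
        |(ArithmeticFunction.moebius d : ℝ) / d * Real.posLog (x / d) +
          γ * ((ArithmeticFunction.moebius d : ℝ) / d) -
          (ArithmeticFunction.moebius d : ℝ) * (1 / d * (harmonic ⌊x / d⌋₊ : ℝ))| ≤ 2 / x := by
      intro d hd
      have hd0 := (Finset.mem_Icc.mp hd).1
      have hd1 : (1 : ℝ) ≤ d := by exact_mod_cast hd0
      have hdx : (d : ℝ) ≤ x := (Nat.le_floor_iff hx0.le).mp (Finset.mem_Icc.mp hd).2
      have hy : 1 ≤ x / d := (one_le_div (by linarith)).mpr hdx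
      have h3 := abs_harmonic_floor_sub_le hy
      rw [Real.posLog_eq_log (hy.trans (le_abs_self _)),
        show (ArithmeticFunction.moebius d : ℝ) / d * Real.log (x / d) +
          γ * ((ArithmeticFunction.moebius d : ℝ) / d) -
          (ArithmeticFunction.moebius d : ℝ) * (1 / d * (harmonic ⌊x / d⌋₊ : ℝ))
          = -((ArithmeticFunction.moebius d : ℝ) * (1 / d) *
            ((harmonic ⌊x / d⌋₊ : ℝ) - Real.log (x / d) - γ)) by ring, abs_neg, abs_mul, abs_mul,
        abs_of_nonneg (by positivity : (0 : ℝ) ≤ 1 / d)]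
      calc _ ≤ 1 * (1 / (d : ℝ)) * (2 / (x / d)) := by
            gcongr
            exact abs_moebius_le_one d
        _ = 2 / x := by field_simp
    refine (Finset.sum_le_sum this).trans ?_
    rw [Finset.sum_const, Nat.card_Icc, Nat.add_sub_cancel, nsmul_eq_mul]
    have : (N : ℝ) ≤ x := Nat.floor_le hx0.le
    rw [mul_div_assoc', div_le_iff₀ hx0]
    linarith
  have h3 := abs_sum_moebius_div_le N
  set m := ∑ n ∈ Finset.Icc 1 N, (ArithmeticFunction.moebius n : ℝ) / n
  have hγ0 : 0 < γ := by have := Real.one_half_lt_eulerMascheroniConstant; linarith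
  have hγ1 : γ < 2 / 3 := Real.eulerMascheroniConstant_lt_two_thirds
  have h4 : |γ * m| ≤ 2 / 3 * 2 := by
    rw [abs_mul, abs_of_pos hγ0]
    gcongr
  rw [abs_le] at h2 h4 ⊢
  constructor <;> linarith [h2.1, h2.2, h4.1, h4.2]

theorem posLog_sub_posLog_le {x y : ℝ} (hx : 0 < x) (hxy : x ≤ y) :
    Real.posLog y - Real.posLog x ≤ Real.log y - Real.log x := by
  have := Real.log_le_log hx hxy
  simp only [Real.posLog_apply]
  rcases max_cases 0 (Real.log y) with h | h <;> rcases max_cases 0 (Real.log x) with h' | h' <;>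
    linarith

/-- In the variable `log x` the sum is Lipschitz, as the Tauberian theorem requires. Terms with `n ≤
x` change by `μ(n) / n * Δ`, in total at most `2 * Δ`; the new terms, at most `y ≤ 3 * x` in number,
change by at most `Δ / x` each. For `Δ ≥ 1` the uniform bound `5` suffices. -/
theorem abs_mobiusLogSum_one_sub_le {x y : ℝ} (hx : 0 < x) (hxy : x ≤ y) :
    |mobiusLogSum 1 y - mobiusLogSum 1 x| ≤ 10 * (Real.log y - Real.log x) := by
  have hy : 0 < y := hx.trans_le hxy
  have hΔ : 0 ≤ Real.log y - Real.log x := sub_nonneg.mpr (Real.log_le_log hx hxy)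
  set Δ := Real.log y - Real.log x with hΔdef
  rcases le_or_gt 1 Δ with h1 | h1
  · have := abs_sub (mobiusLogSum 1 y) (mobiusLogSum 1 x)
    have := abs_mobiusLogSum_one_le y
    have := abs_mobiusLogSum_one_le x
    linarith
  have hy3 : y ≤ 3 * x := by
    have : Real.log y < Real.log (3 * x) := by
      rw [Real.log_mul (by norm_num) hx.ne']
      have : 1 < Real.log 3 := by
        rw [Real.lt_log_iff_exp_lt (by norm_num)]
        exact Real.exp_one_lt_d9.trans (by norm_num)
      linarith
    exact ((Real.log_lt_log_iff hy (by positivity)).mp this).le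
  have hfl : ⌊x⌋₊ ≤ ⌊y⌋₊ := Nat.floor_mono hxy
  rw [mobiusLogSum_one_eq_sum hy.le le_rfl, mobiusLogSum_one_eq_sum hx.le hfl,
    ← Finset.sum_sub_distrib]
  have hsplit : Finset.Icc 1 ⌊y⌋₊ = Finset.Icc 1 ⌊x⌋₊ ∪ Finset.Ioc ⌊x⌋₊ ⌊y⌋₊ := by
    ext n; simp only [Finset.mem_Icc, Finset.mem_union, Finset.mem_Ioc]; omega
  have hdisj : Disjoint (Finset.Icc 1 ⌊x⌋₊) (Finset.Ioc ⌊x⌋₊ ⌊y⌋₊) := by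
    rw [Finset.disjoint_left]; intro n; simp only [Finset.mem_Icc, Finset.mem_Ioc]; omega
  rw [hsplit, Finset.sum_union hdisj]
  have e1 : ∑ n ∈ Finset.Icc 1 ⌊x⌋₊, ((ArithmeticFunction.moebius n : ℝ) / n * Real.posLog (y / n) -
      (ArithmeticFunction.moebius n : ℝ) / n * Real.posLog (x / n)) =
      Δ * ∑ n ∈ Finset.Icc 1 ⌊x⌋₊, (ArithmeticFunction.moebius n : ℝ) / n := by
    rw [Finset.mul_sum]
    refine Finset.sum_congr rfl fun n hn => ?_
    have hn1 : (1 : ℝ) ≤ n := by exact_mod_cast (Finset.mem_Icc.mp hn).1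
    have hnx : (n : ℝ) ≤ x := (Nat.le_floor_iff hx.le).mp (Finset.mem_Icc.mp hn).2
    have a1 : 1 ≤ x / n := (one_le_div (by linarith)).mpr hnx
    have a2 : 1 ≤ y / n := (one_le_div (by linarith)).mpr (hnx.trans hxy)
    rw [Real.posLog_eq_log (a1.trans (le_abs_self _)),
      Real.posLog_eq_log (a2.trans (le_abs_self _)), Real.log_div hx.ne' (by linarith),
      Real.log_div hy.ne' (by linarith), hΔdef]
    ring
  have e2 : |∑ n ∈ Finset.Ioc ⌊x⌋₊ ⌊y⌋₊, ((ArithmeticFunction.moebius n : ℝ) / n *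
      Real.posLog (y / n) - (ArithmeticFunction.moebius n : ℝ) / n * Real.posLog (x / n))| ≤
      3 * Δ := by
    refine (Finset.abs_sum_le_sum_abs _ _).trans ?_
    have : ∀ n ∈ Finset.Ioc ⌊x⌋₊ ⌊y⌋₊, |(ArithmeticFunction.moebius n : ℝ) / n *
        Real.posLog (y / n) - (ArithmeticFunction.moebius n : ℝ) / n * Real.posLog (x / n)| ≤
        1 / x * Δ := by
      intro n hn
      have hn1 := (Finset.mem_Ioc.mp hn).1
      have hxn : x ≤ n := ((Nat.floor_lt hx.le).mp hn1).le
      have hn0 : (0 : ℝ) < n := hx.trans_le hxn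
      have h2 := posLog_sub_posLog_le (x := x / n) (y := y / n) (by positivity) (by gcongr)
      rw [Real.log_div hy.ne' hn0.ne', Real.log_div hx.ne' hn0.ne'] at h2
      have h3 := Real.posLog_le_posLog (x := x / n) (y := y / n) (by positivity) (by gcongr)
      rw [← mul_sub, abs_mul, abs_div, Nat.abs_cast, abs_of_nonneg (sub_nonneg.mpr h3)]
      gcongr
      · exact abs_moebius_le_one n
      · linarith
    refine (Finset.sum_le_sum this).trans ?_
    rw [Finset.sum_const, Nat.card_Ioc, nsmul_eq_mul, ← mul_assoc]
    gcongr
    rw [mul_one_div, div_le_iff₀ hx]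
    have : ((⌊y⌋₊ - ⌊x⌋₊ : ℕ) : ℝ) ≤ ⌊y⌋₊ := by exact_mod_cast Nat.sub_le _ _
    have := Nat.floor_le hy.le
    linarith
  rw [e1]
  refine (abs_add_le _ _).trans ?_
  rw [abs_mul, abs_of_nonneg hΔ]
  have := mul_le_mul_of_nonneg_left (abs_sum_moebius_div_le ⌊x⌋₊) hΔ
  linarith

open MeasureTheory in
theorem integrable_max_sub_mul_exp (a : ℝ) {σ : ℝ} (hσ : 0 < σ) :
    Integrable (fun u : ℝ => max 0 (u - a) * Real.exp (-σ * u)) := by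
  have h1 : IntegrableOn (fun t : ℝ => t * Real.exp (-σ * t)) (Set.Ioi 0) := by
    have h := Real.integral_rpow_mul_exp_neg_mul_Ioi (a := 2) (r := σ) two_pos hσ
    have h2 : IntegrableOn (fun t : ℝ => t ^ ((2 : ℝ) - 1) * Real.exp (-(σ * t))) (Set.Ioi 0) := by
      -- The integral of a nonintegrable function is `0` by convention, so a nonzero value of the
      -- Gamma integral proves integrability.
      refine Integrable.of_integral_ne_zero ?_
      rw [h]
      have := Real.Gamma_pos_of_pos (two_pos (α := ℝ))
      positivity
    refine h2.congr_fun (fun t _ => ?_) measurableSet_Ioi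
    norm_num
  have h2 : Integrable (fun t : ℝ => max 0 t * Real.exp (-σ * t)) := by
    have h3 : IntegrableOn (fun t : ℝ => max 0 t * Real.exp (-σ * t)) (Set.Ioi 0) :=
      h1.congr_fun (fun t ht => by simp only [max_eq_right (le_of_lt (Set.mem_Ioi.mp ht))]) measurableSet_Ioi
    refine h3.integrable_of_forall_notMem_eq_zero fun t ht => ?_
    rw [max_eq_left (not_lt.mp ht), zero_mul]
  have h3 := (h2.comp_sub_right a).mul_const (Real.exp (-σ * a))
  refine h3.congr (Eventually.of_forall fun u => ?_)
  simp only
  rw [mul_assoc, ← Real.exp_add]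
  ring_nf

open MeasureTheory in
theorem integral_max_sub_mul_exp (a : ℝ) {s : ℂ} (hs : 0 < s.re) :
    ∫ u : ℝ, ((max 0 (u - a) : ℝ) : ℂ) * Complex.exp (-s * u) = Complex.exp (-s * a) / s ^ 2 := by
  have hs0 : s ≠ 0 := by rintro rfl; simp at hs
  have h2 : ∫ t : ℝ, ((max 0 t : ℝ) : ℂ) * Complex.exp (-s * t) = 1 / s ^ 2 := by
    have e : ∫ t : ℝ, ((max 0 t : ℝ) : ℂ) * Complex.exp (-s * t)
        = ∫ t : ℝ in Set.Ioi 0, ((max 0 t : ℝ) : ℂ) * Complex.exp (-s * t) := by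
      symm
      refine setIntegral_eq_integral_of_forall_compl_eq_zero fun t ht => ?_
      rw [max_eq_left (not_lt.mp ht)]
      simp
    rw [e]
    have hlim : Tendsto (fun t : ℝ => -(t / s + 1 / s ^ 2) * Complex.exp (-s * t)) atTop
        (nhds 0) := by
      have l1 := tendsto_rpow_mul_exp_neg_mul_atTop_nhds_zero 1 s.re hs
      have l0 := tendsto_rpow_mul_exp_neg_mul_atTop_nhds_zero 0 s.re hs
      have l2 := (l1.mul_const (‖s‖⁻¹)).add (l0.mul_const (‖s ^ 2‖⁻¹))
      rw [zero_mul, zero_mul, zero_add] at l2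
      refine squeeze_zero_norm' ?_ l2
      filter_upwards [eventually_gt_atTop 0] with t ht
      rw [norm_mul, norm_neg, Complex.norm_exp, Real.rpow_one, Real.rpow_zero]
      simp only [Complex.mul_re, Complex.neg_re, Complex.ofReal_re, Complex.neg_im,
        Complex.ofReal_im, mul_zero, sub_zero]
      have e1 : ‖(t : ℂ) / s + 1 / s ^ 2‖ ≤ t * ‖s‖⁻¹ + ‖s ^ 2‖⁻¹ := by
        refine (norm_add_le _ _).trans_eq ?_
        rw [norm_div, norm_div, Complex.norm_real, Real.norm_of_nonneg ht.le, norm_one]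
        ring
      refine (mul_le_mul_of_nonneg_right e1 (Real.exp_pos _).le).trans_eq ?_
      ring
    have hderiv : ∀ t ∈ Set.Ici (0 : ℝ), HasDerivAt
        (fun t : ℝ => -(t / s + 1 / s ^ 2) * Complex.exp (-s * t))
        (((max 0 t : ℝ) : ℂ) * Complex.exp (-s * t)) t := by
      intro t ht
      have d1 : HasDerivAt (fun t : ℝ => (t : ℂ)) 1 t := Complex.ofRealCLM.hasDerivAt
      have d2 := ((d1.div_const s).add_const (1 / s ^ 2)).neg.mul ((d1.const_mul (-s)).cexp)
      refine d2.congr_deriv ?_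
      rw [max_eq_right (Set.mem_Ici.mp ht)]
      simp only [Pi.neg_apply]
      field_simp
      ring
    have hint : IntegrableOn (fun t : ℝ => ((max 0 t : ℝ) : ℂ) * Complex.exp (-s * t))
        (Set.Ioi 0) := by
      have := integrable_max_sub_mul_exp 0 hs
      refine (this.integrableOn (s := Set.Ioi 0)).mono' (by fun_prop)
        (Eventually.of_forall fun u => ?_)
      rw [norm_mul, Complex.norm_exp, Complex.norm_real, Real.norm_of_nonneg (le_max_left _ _)]
      simp
    rw [integral_Ioi_of_hasDerivAt_of_tendsto' hderiv hint hlim]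
    simp
  have h3 := integral_sub_right_eq_self
    (fun t : ℝ => ((max 0 t : ℝ) : ℂ) * Complex.exp (-s * t)) (μ := volume) a
  rw [h2] at h3
  calc _ = ∫ u : ℝ, (((max 0 (u - a) : ℝ) : ℂ) * Complex.exp (-s * ((u - a : ℝ) : ℂ))) *
        Complex.exp (-s * a) := by
        congr 1 with u
        rw [mul_assoc, ← Complex.exp_add]
        push_cast
        ring_nf
    _ = _ := by
        rw [integral_mul_const, h3]
        ring

theorem posLog_exp_div {n : ℕ} (hn : 0 < n) (u : ℝ) :
    Real.posLog (Real.exp u / n) = max 0 (u - Real.log n) := by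
  rw [Real.posLog_apply, Real.log_div (Real.exp_pos u).ne' (by positivity), Real.log_exp]

open MeasureTheory in
/-- The Laplace transform of `mobiusLogSum 1 (exp u)`. -/
theorem integral_mobiusLogSum_mul_exp {s : ℂ} (hs : 0 < s.re) :
    Integrable (fun u : ℝ => (mobiusLogSum 1 (Real.exp u) : ℂ) * Complex.exp (-s * u)) ∧
    ∫ u : ℝ, (mobiusLogSum 1 (Real.exp u) : ℂ) * Complex.exp (-s * u)
      = 1 / (s ^ 2 * riemannZeta (1 + s)) := by
  have hs0 : s ≠ 0 := by rintro rfl; simp at hs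
  set μ' : ℕ → ℂ := fun n => ((ArithmeticFunction.moebius n : ℤ) : ℂ) with hμ'
  set F : ℕ → ℝ → ℂ := fun n u => μ' n / n *
    (((max 0 (u - Real.log n) : ℝ) : ℂ) * Complex.exp (-s * u)) with hF
  have hbase : ∀ a : ℝ, Integrable
      (fun u : ℝ => ((max 0 (u - a) : ℝ) : ℂ) * Complex.exp (-s * u)) := by
    intro a
    refine (integrable_max_sub_mul_exp a hs).mono' (by fun_prop) (Eventually.of_forall fun u => ?_)
    rw [norm_mul, Complex.norm_exp, Complex.norm_real, Real.norm_of_nonneg (le_max_left _ _)]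
    simp
  have hnormint : ∀ a : ℝ, ∫ u : ℝ, ‖((max 0 (u - a) : ℝ) : ℂ) * Complex.exp (-s * u)‖
      = Real.exp (-s.re * a) / s.re ^ 2 := by
    intro a
    have h1 := integral_max_sub_mul_exp a (s := (s.re : ℂ)) (by simpa using hs)
    have h2 : ∫ u : ℝ, (((max 0 (u - a) * Real.exp (-s.re * u) : ℝ)) : ℂ)
        = ((Real.exp (-s.re * a) / s.re ^ 2 : ℝ) : ℂ) := by
      push_cast
      exact h1
    rw [integral_complex_ofReal] at h2
    rw [← Complex.ofReal_inj.mp h2]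
    congr 1 with u
    rw [norm_mul, Complex.norm_exp, Complex.norm_real, Real.norm_of_nonneg (le_max_left _ _)]
    simp
  have hFint : ∀ n, Integrable (F n) := fun n => (hbase _).const_mul _
  have hnorm : ∀ n, ∫ u, ‖F n u‖ = ‖μ' n / n‖ * (Real.exp (-s.re * Real.log n) / s.re ^ 2) := by
    intro n
    rw [← hnormint, ← integral_const_mul]
    simp only [hF, norm_mul]
  -- Termwise integration is justified by comparison with `∑ n ^ (-(1 + Re s))`.
  have hsum : Summable fun n => ∫ u, ‖F n u‖ := by
    simp_rw [hnorm]
    have h1 : Summable (fun n : ℕ => 1 / (n : ℝ) ^ (1 + s.re) * (1 / s.re ^ 2)) :=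
      ((Real.summable_one_div_nat_rpow).mpr (by linarith)).mul_right _
    refine h1.of_nonneg_of_le (fun n => by positivity) fun n => ?_
    rcases Nat.eq_zero_or_pos n with rfl | hn
    · simp; positivity
    have hn0 : (0 : ℝ) < n := by exact_mod_cast hn
    have e1 : Real.exp (-s.re * Real.log n) = 1 / (n : ℝ) ^ s.re := by
      rw [Real.rpow_def_of_pos hn0, one_div, ← Real.exp_neg]
      ring_nf
    have e2 : ‖μ' n / n‖ ≤ 1 / n := by
      rw [norm_div, Complex.norm_natCast]
      gcongr
      have := abs_moebius_le_one n
      simpa [hμ'] using this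
    rw [e1, Real.rpow_add hn0, Real.rpow_one]
    calc _ ≤ 1 / (n : ℝ) * (1 / (n : ℝ) ^ s.re / s.re ^ 2) := by gcongr
      _ = _ := by field_simp
      _ ≤ _ := le_rfl
  have hmain := hasSum_integral_of_summable_integral_norm hFint hsum
  have htsum : ∀ u : ℝ, ∑' n, F n u =
      (mobiusLogSum 1 (Real.exp u) : ℂ) * Complex.exp (-s * u) := by
    intro u
    rw [mobiusLogSum_one_eq_sum (Real.exp_pos u).le le_rfl, Complex.ofReal_sum, Finset.sum_mul,
      tsum_eq_sum (s := Finset.Icc 1 ⌊Real.exp u⌋₊)]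
    · refine Finset.sum_congr rfl fun n hn => ?_
      rw [posLog_exp_div (Finset.mem_Icc.mp hn).1]
      simp only [hF, hμ']
      push_cast
      ring
    · intro n hn
      rcases Nat.eq_zero_or_pos n with rfl | hn0
      · simp [hF]
      have h1 : ⌊Real.exp u⌋₊ < n := by
        by_contra h
        exact hn (Finset.mem_Icc.mpr ⟨hn0, not_lt.mp h⟩)
      have h2 := posLog_div_eq_zero (Real.exp_pos u).le h1
      rw [posLog_exp_div hn0] at h2
      simp [hF, h2]
  simp_rw [htsum] at hmain
  have hL : ∀ n, ∫ u, F n u = LSeries.term μ' (1 + s) n * (1 / s ^ 2) := by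
    intro n
    simp only [hF]
    rw [integral_const_mul, integral_max_sub_mul_exp _ hs]
    rcases Nat.eq_zero_or_pos n with rfl | hn
    · simp
    rw [LSeries.term_of_ne_zero hn.ne', Complex.cpow_add _ _ (by exact_mod_cast hn.ne'),
      Complex.cpow_one, Complex.cpow_def_of_ne_zero (by exact_mod_cast hn.ne') s,
      ← Complex.natCast_log, neg_mul, Complex.exp_neg, mul_comm s]
    field_simp
  have h1s : 1 < (1 + s).re := by simpa using hs
  have hζ := ArithmeticFunction.LSeries_zeta_mul_Lseries_moebius h1s
  rw [ArithmeticFunction.LSeries_zeta_eq_riemannZeta h1s] at hζ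
  have hsumL : HasSum (fun n => ∫ u, F n u) (LSeries μ' (1 + s) * (1 / s ^ 2)) := by
    simp_rw [hL]
    exact (ArithmeticFunction.LSeriesSummable_moebius_iff.mpr h1s).hasSum.mul_right _
  have hζ0 : riemannZeta (1 + s) ≠ 0 := left_ne_zero_of_mul_eq_one hζ
  refine ⟨?_, ?_⟩
  · refine Integrable.of_integral_ne_zero ?_
    rw [hmain.unique hsumL]
    refine mul_ne_zero (right_ne_zero_of_mul_eq_one hζ) (one_div_ne_zero (pow_ne_zero 2 hs0))
  · rw [hmain.unique hsumL, eq_div_iff (mul_ne_zero (pow_ne_zero 2 hs0) hζ0)]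
    calc _ = riemannZeta (1 + s) * LSeries μ' (1 + s) := by field_simp
      _ = 1 := hζ

/-- The prime number theorem in the form `∑_{n ≤ x} μ(n) / n * log (x / n) → 1`. -/
theorem tendsto_mobiusLogSum_one : Tendsto (mobiusLogSum 1) atTop (nhds 1) := by
  -- Subtracting `1 - exp (-u)` instead of the limit `1` keeps `f` Lipschitz and zero for `u < 0`;
  -- its Laplace transform is `1 / (s * (s + 1))`.
  set f : ℝ → ℝ := fun u => mobiusLogSum 1 (Real.exp u) - (1 - Real.exp (-max u 0)) with hf
  -- Here `riemannZeta₁ (1 + s)` is `s * ζ(1 + s)` with the pole removed. The transform of `f` is `g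
  -- s / s`, and `g 0 = 0` lets it extend continuously to the origin as a divided slope.
  set g : ℂ → ℂ := fun s => (riemannZeta₁ (1 + s))⁻¹ - (s + 1)⁻¹ with hg
  have hZ : ∀ s : ℂ, 0 ≤ s.re → riemannZeta₁ (1 + s) ≠ 0 := by
    intro s hs
    by_cases h0 : s = 0
    · simp [h0]
    have h1 : riemannZeta (1 + s) ≠ 0 := riemannZeta_ne_zero_of_one_le_re (by simpa using hs)
    rw [riemannZeta_eq_inv_sub_mul (by simpa using h0)] at h1
    exact right_ne_zero_of_mul h1
  have hs1 : ∀ s : ℂ, 0 ≤ s.re → s + 1 ≠ 0 := by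
    intro s hs h
    have := congrArg Complex.re h
    simp at this
    linarith
  have hgd : ∀ s : ℂ, 0 ≤ s.re → DifferentiableAt ℂ g s := by
    intro s hs
    have h1 : DifferentiableAt ℂ (fun s => riemannZeta₁ (1 + s)) s :=
      (differentiable_riemannZeta₁.comp (differentiable_id.const_add 1)) s
    exact (h1.inv (hZ s hs)).sub ((differentiableAt_id.add_const 1).inv (hs1 s hs))
  have hg0 : g 0 = 0 := by simp [hg]
  have hcont : ContinuousOn (dslope g 0) {s : ℂ | 0 ≤ s.re} := by
    intro s hs
    refine ContinuousAt.continuousWithinAt ?_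
    by_cases h0 : s = 0
    · rw [h0]
      exact continuousAt_dslope_same.mpr (hgd 0 (by simp))
    · exact (continuousAt_dslope_of_ne h0).mpr (hgd s hs).continuousAt
  have hL : ∀ u v, |f u - f v| ≤ 11 * |u - v| := by
    have : ∀ u v : ℝ, u ≤ v → |f v - f u| ≤ 11 * (v - u) := by
      intro u v huv
      have h1 := abs_mobiusLogSum_one_sub_le (Real.exp_pos u) (Real.exp_le_exp.mpr huv)
      rw [Real.log_exp, Real.log_exp] at h1
      have h2 : max u 0 ≤ max v 0 := max_le_max_right 0 huv
      have h3 : max v 0 - max u 0 ≤ v - u := by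
        rcases max_cases u 0 with h | h <;> rcases max_cases v 0 with h' | h' <;> linarith
      have h4 : Real.exp (-max v 0) ≤ Real.exp (-max u 0) :=
        Real.exp_le_exp.mpr (by linarith)
      have h5 : Real.exp (-max u 0) - Real.exp (-max v 0) ≤ max v 0 - max u 0 := by
        have e1 : Real.exp (-max v 0) = Real.exp (-max u 0) * Real.exp (max u 0 - max v 0) := by
          rw [← Real.exp_add]; ring_nf
        have e2 := Real.add_one_le_exp (max u 0 - max v 0)
        have e3 : Real.exp (-max u 0) ≤ 1 := Real.exp_le_one_iff.mpr (by simp)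
        have e4 := Real.exp_pos (-max u 0)
        rw [e1]
        nlinarith
      rw [abs_le] at h1 ⊢
      simp only [hf]
      constructor <;> linarith [h1.1, h1.2]
    intro u v
    rcases le_total u v with h | h
    · rw [abs_sub_comm, abs_sub_comm u v, abs_of_nonneg (sub_nonneg.mpr h)]
      exact this u v h
    · rw [abs_of_nonneg (sub_nonneg.mpr h)]
      exact this v u h
  have hbd : ∀ u, |f u| ≤ 11 := by
    intro u
    have h1 := abs_mobiusLogSum_one_le (Real.exp u)
    have h2 := Real.exp_pos (-max u 0)
    have h3 : Real.exp (-max u 0) ≤ 1 := Real.exp_le_one_iff.mpr (by simp)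
    rw [abs_le] at h1 ⊢
    simp only [hf]
    constructor <;> linarith [h1.1, h1.2]
  have hlap : ∀ s : ℂ, 0 < s.re → ∫ u : ℝ, (f u : ℂ) * Complex.exp (-s * u) = dslope g 0 s := by
    intro s hs
    have hs0 : s ≠ 0 := by rintro rfl; simp at hs
    obtain ⟨hint, hval⟩ := integral_mobiusLogSum_mul_exp hs
    have i1 : MeasureTheory.IntegrableOn (fun u : ℝ => Complex.exp (-s * u)) (Set.Ioi 0) :=
      integrableOn_exp_mul_complex_Ioi (by simpa using hs) 0
    have i2 : MeasureTheory.IntegrableOn (fun u : ℝ => Complex.exp (-(s + 1) * u)) (Set.Ioi 0) :=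
      integrableOn_exp_mul_complex_Ioi (by simp; linarith) 0
    have hsub : ∫ u : ℝ, (f u : ℂ) * Complex.exp (-s * u) =
        (∫ u : ℝ, (mobiusLogSum 1 (Real.exp u) : ℂ) * Complex.exp (-s * u)) -
        ∫ u : ℝ, (Set.Ioi (0 : ℝ)).indicator
          (fun u : ℝ => Complex.exp (-s * u) - Complex.exp (-(s + 1) * u)) u := by
      have i3 : MeasureTheory.Integrable ((Set.Ioi (0 : ℝ)).indicator
          (fun u : ℝ => Complex.exp (-s * u) - Complex.exp (-(s + 1) * u))) :=
        (MeasureTheory.IntegrableOn.integrable_indicator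
          (MeasureTheory.IntegrableOn.sub i1 i2) measurableSet_Ioi)
      rw [← MeasureTheory.integral_sub hint i3]
      congr 1 with u
      by_cases hu : u ∈ Set.Ioi (0 : ℝ)
      · rw [Set.indicator_of_mem hu]
        simp only [hf, max_eq_left (le_of_lt (Set.mem_Ioi.mp hu))]
        push_cast
        rw [show -(s + 1) * (u : ℂ) = -s * u + -u by ring, Complex.exp_add]
        ring
      · rw [Set.indicator_of_notMem hu]
        simp only [hf, max_eq_right (not_lt.mp (Set.mem_Ioi.not.mp hu))]
        simp
    rw [hsub, hval, MeasureTheory.integral_indicator measurableSet_Ioi,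
      MeasureTheory.integral_sub i1 i2, integral_exp_mul_complex_Ioi (by simpa using hs),
      integral_exp_mul_complex_Ioi (by simp; linarith), dslope_of_ne _ hs0, slope_def_field, hg0,
      riemannZeta_eq_inv_sub_mul (by simpa using hs0)]
    simp only [hg]
    have h1 := hZ s hs.le
    have h2 := hs1 s hs.le
    have h3 : -1 + -s ≠ 0 := by
      intro h; apply h2; linear_combination -h
    simp
    field_simp
    ring
  have hlim := tendsto_zero_of_laplace (f := fun u => (f u : ℂ)) (C := 11)
    (fun u => by rw [Complex.norm_real]; exact hbd u)
    (fun u v => by rw [← Complex.ofReal_sub, Complex.norm_real]; exact hL u v)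
    (fun u hu => by
      have h1 : Real.exp u < 1 := Real.exp_lt_one_iff.mpr hu
      simp [hf, mobiusLogSum_of_lt_one h1, max_eq_right hu.le]) hcont hlap
  have hlim' : Tendsto f atTop (nhds 0) := by
    have := (Complex.continuous_re.tendsto 0).comp hlim
    simpa [Function.comp_def] using this
  have h1 : Tendsto (fun u => mobiusLogSum 1 (Real.exp u)) atTop (nhds 1) := by
    have h2 : Tendsto (fun u : ℝ => f u + (1 - Real.exp (-u))) atTop (nhds (0 + (1 - 0))) :=
      hlim'.add (tendsto_const_nhds.sub Real.tendsto_exp_neg_atTop_nhds_zero)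
    rw [sub_zero, zero_add] at h2
    refine h2.congr' ?_
    filter_upwards [eventually_ge_atTop 0] with u hu
    simp only [hf, max_eq_left hu]
    ring
  refine (h1.comp Real.tendsto_log_atTop).congr' ?_
  filter_upwards [eventually_gt_atTop 0] with x hx
  simp [Real.exp_log hx]

/-! ### Möbius sums over integers coprime to a modulus -/

/-- Split the `n` coprime to `q` by whether `p ∣ n`; if `n = p * m` is squarefree, then `μ(n) / n =
-μ(m) / (p * m)` with `m` coprime to `p`. -/
theorem mobiusLogSum_eq_sub {p q : ℕ} (hp : p.Prime) (hpq : ¬ p ∣ q) {x : ℝ} (hx : 0 ≤ x) :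
    mobiusLogSum q x = mobiusLogSum (p * q) x - 1 / p * mobiusLogSum (p * q) (x / p) := by
  classical
  have hp0 : (0 : ℝ) < p := by exact_mod_cast hp.pos
  set A := {n ∈ Finset.Icc 1 ⌊x⌋₊ | n.Coprime (p * q)} with hA
  set B := {n ∈ Finset.Icc 1 ⌊x / p⌋₊ | n.Coprime (p * q)} with hB
  have hpc : p.Coprime q := (Nat.Prime.coprime_iff_not_dvd hp).mpr hpq
  have hmemA : ∀ n, n ∈ A ↔ (1 ≤ n ∧ n ≤ ⌊x⌋₊) ∧ n.Coprime p ∧ n.Coprime q := by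
    intro n; simp [hA, Nat.coprime_mul_iff_right]
  have hmemB : ∀ n, n ∈ B ↔ (1 ≤ n ∧ n ≤ ⌊x / p⌋₊) ∧ n.Coprime p ∧ n.Coprime q := by
    intro n; simp [hB, Nat.coprime_mul_iff_right]
  have hdisj : Disjoint A (B.image (p * ·)) := by
    rw [Finset.disjoint_right]
    intro n hn hnA
    obtain ⟨m, -, rfl⟩ := Finset.mem_image.mp hn
    have h1 := ((hmemA _).mp hnA).2.1
    have := Nat.Coprime.eq_one_of_dvd h1.symm (Dvd.intro m rfl)
    exact hp.one_lt.ne' this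
  rw [mobiusLogSum_eq_sum hx (A ∪ B.image (p * ·)), Finset.sum_union hdisj,
    Finset.sum_image fun a _ b _ h => Nat.eq_of_mul_eq_mul_left hp.pos h]
  · rw [show mobiusLogSum (p * q) x = ∑ n ∈ A, (ArithmeticFunction.moebius n : ℝ) / n *
        Real.posLog (x / n) from rfl, show mobiusLogSum (p * q) (x / p) =
        ∑ n ∈ B, (ArithmeticFunction.moebius n : ℝ) / n * Real.posLog (x / p / n) from rfl,
      sub_eq_add_neg, Finset.mul_sum, ← Finset.sum_neg_distrib]
    congr 1
    refine Finset.sum_congr rfl fun n hn => ?_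
    have hn' := (hmemB n).mp hn
    rw [ArithmeticFunction.isMultiplicative_moebius.map_mul_of_coprime hn'.2.1.symm,
      ArithmeticFunction.moebius_apply_prime hp, div_div]
    push_cast
    ring
  · intro n hn
    rcases Finset.mem_union.mp hn with h | h
    · exact ⟨((hmemA n).mp h).1.1, ((hmemA n).mp h).2.2⟩
    · obtain ⟨m, hm, rfl⟩ := Finset.mem_image.mp h
      have hm' := (hmemB m).mp hm
      exact ⟨Nat.mul_pos hp.pos hm'.1.1, Nat.Coprime.mul_left hpc hm'.2.2⟩
  · intro n hn0 hnx hnq hsq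
    by_cases hpn : p ∣ n
    · obtain ⟨m, rfl⟩ := hpn
      refine Finset.mem_union_right _ (Finset.mem_image.mpr ⟨m, (hmemB m).mpr ?_, rfl⟩)
      refine ⟨⟨Nat.pos_of_mul_pos_left hn0, ?_⟩, ?_, ?_⟩
      · rw [Nat.floor_div_natCast, Nat.le_div_iff_mul_le hp.pos, mul_comm]
        exact hnx
      · exact (Nat.coprime_of_squarefree_mul hsq).symm
      · exact Nat.Coprime.coprime_mul_left hnq
    · refine Finset.mem_union_left _ ((hmemA n).mpr ⟨⟨hn0, hnx⟩, ?_, hnq⟩)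
      exact ((Nat.Prime.coprime_iff_not_dvd hp).mpr hpn).symm

/-- The relative error of `mobiusLogSum q x` as an approximation to `q / φ(q)`. -/
noncomputable def mobiusLogError (q : ℕ) (x : ℝ) : ℝ :=
  (q.totient : ℝ) / q * mobiusLogSum q x - 1

/-- After normalization by `φ(q) / q` the recursion is a convex combination. Hence uniform bounds
survive the adjunction of any number of primes without loss. -/
theorem mobiusLogError_prime_mul {p q : ℕ} (hp : p.Prime) (hpq : ¬ p ∣ q) {x : ℝ} (hx : 0 ≤ x) :
    mobiusLogError (p * q) x =
      (1 - 1 / (p : ℝ)) * mobiusLogError q x + 1 / p * mobiusLogError (p * q) (x / p) := by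
  have hp0 : (p : ℝ) ≠ 0 := by exact_mod_cast hp.ne_zero
  have hpc : p.Coprime q := (Nat.Prime.coprime_iff_not_dvd hp).mpr hpq
  have hφ : ((p * q).totient : ℝ) / ((p * q : ℕ) : ℝ) =
      (1 - 1 / (p : ℝ)) * ((q.totient : ℝ) / q) := by
    rw [Nat.totient_mul hpc, Nat.totient_prime hp]
    push_cast [Nat.cast_sub hp.one_le]
    rw [mul_div_mul_comm, sub_div, div_self hp0]
  unfold mobiusLogError
  rw [hφ, mobiusLogSum_eq_sub hp hpq hx]
  ring

/-- Induction on `⌊x⌋`, since `x / p` is smaller. For `x < 1` the error equals `-1`, whence the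
condition `1 ≤ C`. -/
theorem abs_mobiusLogError_prime_mul_le {p q : ℕ} (hp : p.Prime) (hpq : ¬ p ∣ q) {C : ℝ}
    (hC : 1 ≤ C) (h : ∀ x, 0 ≤ x → |mobiusLogError q x| ≤ C) {x : ℝ} (hx : 0 ≤ x) :
    |mobiusLogError (p * q) x| ≤ C := by
  have hp2 : (2 : ℝ) ≤ p := by exact_mod_cast hp.two_le
  have key : ∀ n : ℕ, ∀ x : ℝ, 0 ≤ x → ⌊x⌋₊ ≤ n → |mobiusLogError (p * q) x| ≤ C := by
    intro n
    induction n with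
    | zero =>
      intro x hx hn
      have : x < 1 := Nat.floor_eq_zero.mp (by omega)
      simpa [mobiusLogError, mobiusLogSum_of_lt_one this] using hC
    | succ n ih =>
      intro x hx hn
      have h1 : |mobiusLogError (p * q) (x / p)| ≤ C := by
        refine ih _ (by positivity) ?_
        rw [Nat.floor_div_natCast]
        rcases Nat.eq_zero_or_pos ⌊x⌋₊ with h0 | h0
        · simp [h0]
        · have := Nat.div_lt_self h0 hp.one_lt
          omega
      rw [mobiusLogError_prime_mul hp hpq hx]
      have h2 := h x hx
      have h3 : 1 / (p : ℝ) ≤ 1 := by rw [div_le_one (by linarith)]; linarith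
      have h4 : 0 ≤ 1 / (p : ℝ) := by positivity
      refine (abs_add_le _ _).trans ?_
      rw [abs_mul, abs_mul, abs_of_nonneg h4, abs_of_nonneg (sub_nonneg.mpr h3)]
      nlinarith
  exact key _ x hx le_rfl

/-- Each use of the recursion divides `x` by `p` and at least halves the excess over `δ`, because `1
/ p ≤ 1 / 2`. -/
theorem abs_mobiusLogError_prime_mul_le_add {p q : ℕ} (hp : p.Prime) (hpq : ¬ p ∣ q) {C X δ : ℝ}
    (hC : 1 ≤ C) (hX : 0 ≤ X) (h : ∀ x, 0 ≤ x → |mobiusLogError q x| ≤ C)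
    (hδ : ∀ x, X ≤ x → |mobiusLogError q x| ≤ δ) (n : ℕ) {x : ℝ} (hx : X * p ^ n ≤ x) :
    |mobiusLogError (p * q) x| ≤ δ + C / 2 ^ n := by
  have hp2 : (2 : ℝ) ≤ p := by exact_mod_cast hp.two_le
  have hp0 : (0 : ℝ) < p := by linarith
  have hδ0 : 0 ≤ δ := (abs_nonneg _).trans (hδ X le_rfl)
  induction n generalizing x with
  | zero =>
    have hx' : 0 ≤ x := by rw [pow_zero, mul_one] at hx; linarith
    have := abs_mobiusLogError_prime_mul_le hp hpq hC h hx'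
    rw [pow_zero, div_one]
    linarith
  | succ n ih =>
    have hx0 : 0 ≤ x := (by positivity : 0 ≤ X * (p : ℝ) ^ (n + 1)).trans hx
    have hXx : X ≤ x := (le_mul_of_one_le_right hX (one_le_pow₀ (by linarith))).trans hx
    have h1 := ih (x := x / p) (by rw [le_div_iff₀ hp0, mul_assoc, ← pow_succ]; exact hx)
    have h2 := hδ x hXx
    rw [mobiusLogError_prime_mul hp hpq hx0]
    have h3 : 1 / (p : ℝ) ≤ 1 / 2 := one_div_le_one_div_of_le two_pos hp2
    have h4 : 0 ≤ 1 / (p : ℝ) := by positivity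
    have h5 : 0 ≤ C / 2 ^ n := by positivity
    refine (abs_add_le _ _).trans ?_
    rw [abs_mul, abs_mul, abs_of_nonneg h4, abs_of_nonneg (by linarith : 0 ≤ 1 - 1 / (p : ℝ))]
    have h6 : C / 2 ^ (n + 1) = 1 / 2 * (C / 2 ^ n) := by rw [pow_succ]; field_simp
    rw [h6]
    nlinarith

theorem not_dvd_prod_primes {P : Finset ℕ} (hP : ∀ p ∈ P, p.Prime) {p : ℕ} (hp : p.Prime)
    (hpP : p ∉ P) : ¬ p ∣ ∏ r ∈ P, r := by
  intro h
  obtain ⟨r, hr, hpr⟩ := (Prime.dvd_finsetProd_iff hp.prime _).mp h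
  exact hpP ((Nat.prime_dvd_prime_iff_eq hp (hP r hr)).mp hpr ▸ hr)

theorem abs_mobiusLogError_one_le (x : ℝ) : |mobiusLogError 1 x| ≤ 6 := by
  have h := abs_le.mp (abs_mobiusLogSum_one_le x)
  rw [mobiusLogError, abs_le]
  simp only [Nat.totient_one, Nat.cast_one, div_one, one_mul]
  constructor <;> linarith [h.1, h.2]

theorem abs_mobiusLogError_prod_le {P : Finset ℕ} (hP : ∀ p ∈ P, p.Prime) {x : ℝ} (hx : 0 ≤ x) :
    |mobiusLogError (∏ p ∈ P, p) x| ≤ 6 := by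
  classical
  induction P using Finset.induction_on generalizing x with
  | empty => simpa using abs_mobiusLogError_one_le x
  | insert p P hpP ih =>
    have hP' : ∀ r ∈ P, r.Prime := fun r hr => hP r (Finset.mem_insert_of_mem hr)
    have hp := hP p (Finset.mem_insert_self p P)
    rw [Finset.prod_insert hpP]
    exact abs_mobiusLogError_prime_mul_le hp (not_dvd_prod_primes hP' hp hpP) (by norm_num)
      (fun x hx => ih hP' hx) hx

/-- Each prime of `P` raises the threshold by a factor `p ^ n` and the error by `6 / 2 ^ n`. The
parameter `n` is free, and large `n` beats the number of primes. -/
theorem abs_mobiusLogError_prod_le_add {P : Finset ℕ} (hP : ∀ p ∈ P, p.Prime) {X δ : ℝ}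
    (hX : 0 ≤ X) (hδ : ∀ x, X ≤ x → |mobiusLogError 1 x| ≤ δ) (n : ℕ) {x : ℝ}
    (hx : X * ((∏ p ∈ P, p : ℕ) : ℝ) ^ n ≤ x) :
    |mobiusLogError (∏ p ∈ P, p) x| ≤ δ + 6 * P.card / 2 ^ n := by
  classical
  induction P using Finset.induction_on generalizing x with
  | empty =>
    simp at hx ⊢
    exact hδ x hx
  | insert p P hpP ih =>
    have hP' : ∀ r ∈ P, r.Prime := fun r hr => hP r (Finset.mem_insert_of_mem hr)
    have hp := hP p (Finset.mem_insert_self p P)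
    rw [Finset.prod_insert hpP] at hx ⊢
    have := abs_mobiusLogError_prime_mul_le_add hp (not_dvd_prod_primes hP' hp hpP)
      (X := X * ((∏ p ∈ P, p : ℕ) : ℝ) ^ n) (by norm_num : (1 : ℝ) ≤ 6) (by positivity)
      (fun x hx => abs_mobiusLogError_prod_le hP' hx) (fun x hx => ih hP' hx) n (x := x)
      (by push_cast at hx ⊢; rw [mul_pow] at hx; linarith)
    refine this.trans_eq ?_
    rw [Finset.card_insert_of_notMem hpP]
    push_cast
    ring

/-! ### Harmonic sums over integers coprime to `W` -/

/-- The sum of `1 / g` over the `g ≤ x` coprime to `W`. -/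
noncomputable def coprimeHarmonic (W : ℕ) (x : ℝ) : ℝ :=
  ∑ g ∈ Finset.Icc 1 ⌊x⌋₊ with g.Coprime W, 1 / (g : ℝ)

theorem coprimeHarmonic_mono (W : ℕ) {x y : ℝ} (h : x ≤ y) :
    coprimeHarmonic W x ≤ coprimeHarmonic W y := by
  refine Finset.sum_le_sum_of_subset_of_nonneg ?_ fun _ _ _ => by positivity
  exact Finset.filter_subset_filter _ (Finset.Icc_subset_Icc_right (Nat.floor_mono h))

theorem coprimeHarmonic_natCast_eq_harmonic_le (W n : ℕ) :
    coprimeHarmonic W n ≤ harmonic n := by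
  rw [coprimeHarmonic, harmonic_eq_sum_Icc, Nat.floor_natCast]
  push_cast
  simp_rw [one_div]
  exact Finset.sum_le_sum_of_subset_of_nonneg (Finset.filter_subset _ _)
    fun _ _ _ => by positivity

theorem coprimeHarmonic_succ_block {W : ℕ} (J : ℕ) :
    coprimeHarmonic W (((J + 1) * W : ℕ) : ℝ) = coprimeHarmonic W ((J * W : ℕ) : ℝ) +
      ∑ g ∈ Finset.Ico (J * W + 1) (J * W + 1 + W) with W.Coprime g, 1 / (g : ℝ) := by
  classical
  unfold coprimeHarmonic
  rw [Nat.floor_natCast, Nat.floor_natCast, ← Finset.sum_union]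
  · congr 1
    ext n
    simp only [Finset.mem_filter, Finset.mem_union, Finset.mem_Icc, Finset.mem_Ico,
      Nat.coprime_comm (n := W), add_mul, one_mul]
    constructor
    · rintro ⟨h1, h2⟩
      by_cases h : n ≤ J * W
      · exact Or.inl ⟨⟨h1.1, h⟩, h2⟩
      · exact Or.inr ⟨by omega, h2⟩
    · rintro (⟨h1, h2⟩ | ⟨h1, h2⟩)
      · exact ⟨by omega, h2⟩
      · exact ⟨by omega, h2⟩
  · rw [Finset.disjoint_left]
    intro n h1 h2
    simp only [Finset.mem_filter, Finset.mem_Icc, Finset.mem_Ico] at h1 h2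
    omega

/-- Each block of `W` consecutive integers contains exactly `φ(W)` coprime to `W`, and `1 / g` is
bounded by its values at the ends of the block. The first block has no useful lower end and is
bounded by the full harmonic sum. -/
theorem coprimeHarmonic_block_bounds {W : ℕ} (hW : 0 < W) (J : ℕ) :
    (W.totient : ℝ) / W * harmonic J ≤ coprimeHarmonic W ((J * W : ℕ) : ℝ) ∧
    coprimeHarmonic W (((J + 1) * W : ℕ) : ℝ) ≤
      1 + Real.log W + (W.totient : ℝ) / W * harmonic J := by
  have hW0 : (0 : ℝ) < W := by exact_mod_cast hW
  have hcard : ∀ J : ℕ, (({g ∈ Finset.Ico (J * W + 1) (J * W + 1 + W) | W.Coprime g}.card : ℕ) : ℝ)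
      = W.totient := by
    intro J; rw [Nat.filter_coprime_Ico_eq_totient]
  induction J with
  | zero =>
    constructor
    · simp [coprimeHarmonic]
    · rw [zero_add, one_mul, harmonic_zero, Rat.cast_zero, mul_zero, add_zero]
      exact (coprimeHarmonic_natCast_eq_harmonic_le W W).trans (harmonic_le_one_add_log W)
  | succ J ih =>
    have hharm : ((harmonic (J + 1) : ℚ) : ℝ) = harmonic J + 1 / (J + 1) := by
      rw [harmonic_succ]; push_cast; rw [one_div]
    constructor
    · rw [coprimeHarmonic_succ_block, hharm, mul_add]
      refine add_le_add ih.1 ?_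
      have h : ∀ g ∈ {g ∈ Finset.Ico (J * W + 1) (J * W + 1 + W) | W.Coprime g},
          1 / ((J + 1 : ℝ) * W) ≤ 1 / (g : ℝ) := by
        intro g hg
        simp only [Finset.mem_filter, Finset.mem_Ico] at hg
        have h1 : (0 : ℝ) < g := by exact_mod_cast (by omega : 0 < g)
        refine one_div_le_one_div_of_le h1 ?_
        have : g ≤ (J + 1) * W := by rw [add_mul, one_mul]; omega
        exact_mod_cast this
      refine le_trans (le_of_eq ?_) (Finset.card_nsmul_le_sum _ _ _ h)
      rw [nsmul_eq_mul, hcard]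
      field_simp
    · rw [coprimeHarmonic_succ_block, hharm, mul_add, ← add_assoc]
      refine add_le_add ih.2 ?_
      have h : ∀ g ∈ {g ∈ Finset.Ico ((J + 1) * W + 1) ((J + 1) * W + 1 + W) | W.Coprime g},
          1 / (g : ℝ) ≤ 1 / ((J + 1 : ℝ) * W) := by
        intro g hg
        simp only [Finset.mem_filter, Finset.mem_Ico] at hg
        refine one_div_le_one_div_of_le (by positivity) ?_
        have : (J + 1) * W ≤ g := by omega
        exact_mod_cast this
      refine (Finset.sum_le_card_nsmul _ _ _ h).trans (le_of_eq ?_)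
      rw [nsmul_eq_mul, hcard]
      field_simp

theorem abs_coprimeHarmonic_sub_le {W : ℕ} (hW : 0 < W) {R : ℝ} (hR : 1 ≤ R) :
    |coprimeHarmonic W R - (W.totient : ℝ) / W * Real.log R| ≤ 2 + Real.log W := by
  have hW1 : (1 : ℝ) ≤ W := by exact_mod_cast hW
  have hW0 : (0 : ℝ) < W := by linarith
  have hlogW : 0 ≤ Real.log W := Real.log_nonneg hW1
  have hlogR : 0 ≤ Real.log R := Real.log_nonneg hR
  set r : ℝ := (W.totient : ℝ) / W with hr
  have hr0 : 0 ≤ r := by positivity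
  have hr1 : r ≤ 1 := by
    rw [hr, div_le_one hW0]; exact_mod_cast Nat.totient_le W
  set J := ⌊R / W⌋₊ with hJ
  have h1 : (J : ℝ) ≤ R / W := Nat.floor_le (by positivity)
  have h2 : R / W < J + 1 := Nat.lt_floor_add_one _
  have h3 : coprimeHarmonic W ((J * W : ℕ) : ℝ) ≤ coprimeHarmonic W R := by
    refine coprimeHarmonic_mono W ?_
    push_cast
    rwa [← le_div_iff₀ hW0]
  have h4 : coprimeHarmonic W R ≤ coprimeHarmonic W (((J + 1) * W : ℕ) : ℝ) := by
    refine coprimeHarmonic_mono W ?_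
    push_cast
    rw [← div_le_iff₀ hW0]
    exact h2.le
  obtain ⟨h5, -⟩ := coprimeHarmonic_block_bounds hW J
  obtain ⟨-, h6⟩ := coprimeHarmonic_block_bounds hW J
  have h7 : Real.log R - Real.log W ≤ harmonic J := by
    rw [← Real.log_div (by linarith) hW0.ne', hJ]
    exact log_le_harmonic_floor _ (by positivity)
  have h8 : (harmonic J : ℝ) ≤ 1 + Real.log R := by
    refine (harmonic_le_one_add_log J).trans ?_
    rcases Nat.eq_zero_or_pos J with h0 | h0
    · rw [h0]; simpa using hlogR
    · gcongr
      exact h1.trans (div_le_self (by linarith) hW1)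
  have h9 : r * (Real.log R - Real.log W) ≤ r * harmonic J := mul_le_mul_of_nonneg_left h7 hr0
  have h10 : r * harmonic J ≤ r * (1 + Real.log R) := mul_le_mul_of_nonneg_left h8 hr0
  have h11 : r * Real.log W ≤ Real.log W := mul_le_of_le_one_left hlogW hr1
  rw [abs_le]
  constructor <;> nlinarith

/-! ### The bilinear sieve sum and its asymptotics -/

/-- The bilinear sum `∑_{g ≤ R, (g, W) = 1} T(R / (g a)) T(R / (g b)) / g`, with
`T = mobiusLogSum W`. -/
noncomputable def bilinearSieveSum (W : ℕ) (R : ℝ) (a b : ℕ) : ℝ :=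
  ∑ g ∈ Finset.Icc 1 ⌊R⌋₊ with g.Coprime W,
    1 / (g : ℝ) * (mobiusLogSum W (R / (g * a : ℕ)) * mobiusLogSum W (R / (g * b : ℕ)))

theorem totient_div_mul_mobiusLogSum (W : ℕ) (x : ℝ) :
    (W.totient : ℝ) / W * mobiusLogSum W x = 1 + mobiusLogError W x := by
  rw [mobiusLogError]; ring

/-- Each normalized factor is at most `1 + 6 = 7`. Uniformity in `a` and `b` matters: this becomes
the sup norm bound for the model function. -/
theorem abs_bilinearSieveSum_le {P : Finset ℕ} (hP : ∀ p ∈ P, p.Prime) {R : ℝ} (hR : 1 ≤ R)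
    (a b : ℕ) :
    |(((∏ p ∈ P, p : ℕ).totient : ℝ) / (∏ p ∈ P, p : ℕ)) ^ 2 *
      bilinearSieveSum (∏ p ∈ P, p) R a b| ≤ 49 * coprimeHarmonic (∏ p ∈ P, p) R := by
  set W := ∏ p ∈ P, p with hW
  rw [bilinearSieveSum, coprimeHarmonic, Finset.mul_sum, Finset.mul_sum]
  refine (Finset.abs_sum_le_sum_abs _ _).trans (Finset.sum_le_sum fun g _ => ?_)
  rw [show ((W.totient : ℝ) / W) ^ 2 * (1 / (g : ℝ) *
      (mobiusLogSum W (R / (g * a : ℕ)) * mobiusLogSum W (R / (g * b : ℕ))))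
      = 1 / (g : ℝ) * ((W.totient : ℝ) / W * mobiusLogSum W (R / (g * a : ℕ))) *
        ((W.totient : ℝ) / W * mobiusLogSum W (R / (g * b : ℕ))) by ring,
    totient_div_mul_mobiusLogSum, totient_div_mul_mobiusLogSum, abs_mul, abs_mul,
    abs_of_nonneg (by positivity : (0 : ℝ) ≤ 1 / g)]
  have hb : ∀ c : ℕ, |1 + mobiusLogError W (R / c)| ≤ 7 := by
    intro c
    have h := abs_mobiusLogError_prod_le hP (x := R / c) (by positivity)
    have := abs_add_le 1 (mobiusLogError W (R / c))
    rw [abs_one] at this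
    linarith
  have h1 := hb (g * a)
  have h2 := hb (g * b)
  calc _ ≤ 1 / (g : ℝ) * 7 * 7 := by gcongr
    _ = _ := by ring

/-- For `g ≤ R / Z` the normalized factor is within `η` of `1`. The range `R / Z < g ≤ R` has
harmonic mass at most `1 + log Z`, and there the deviation of the square from `1` is at most `8 *
6`. -/
theorem abs_bilinearSieveSum_sub_le {P : Finset ℕ} (hP : ∀ p ∈ P, p.Prime) {R Z η : ℝ}
    (hR : 1 ≤ R) (hZ : 1 ≤ Z) (hη : ∀ x, Z ≤ x → |mobiusLogError (∏ p ∈ P, p) x| ≤ η) :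
    |(((∏ p ∈ P, p : ℕ).totient : ℝ) / (∏ p ∈ P, p : ℕ)) ^ 2 *
      bilinearSieveSum (∏ p ∈ P, p) R 1 1 - coprimeHarmonic (∏ p ∈ P, p) R| ≤
      8 * η * coprimeHarmonic (∏ p ∈ P, p) R + 48 * (1 + Real.log Z) := by
  classical
  set W := ∏ p ∈ P, p with hW
  have hη0 : 0 ≤ η := (abs_nonneg _).trans (hη Z le_rfl)
  rw [bilinearSieveSum, coprimeHarmonic, Finset.mul_sum, ← Finset.sum_sub_distrib]
  refine (Finset.abs_sum_le_sum_abs _ _).trans ?_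
  have hterm : ∀ g ∈ {g ∈ Finset.Icc 1 ⌊R⌋₊ | g.Coprime W},
      |((W.totient : ℝ) / W) ^ 2 * (1 / (g : ℝ) *
      (mobiusLogSum W (R / (g * 1 : ℕ)) * mobiusLogSum W (R / (g * 1 : ℕ)))) - 1 / (g : ℝ)| ≤
      8 * η * (1 / (g : ℝ)) + (if R / Z < g then 48 * (1 / (g : ℝ)) else 0) := by
    intro g hg
    have hg1 : (1 : ℝ) ≤ g := by
      exact_mod_cast (Finset.mem_Icc.mp (Finset.mem_filter.mp hg).1).1
    rw [mul_one, show ((W.totient : ℝ) / W) ^ 2 * (1 / (g : ℝ) *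
      (mobiusLogSum W (R / g) * mobiusLogSum W (R / g))) - 1 / (g : ℝ)
      = 1 / (g : ℝ) * (((W.totient : ℝ) / W * mobiusLogSum W (R / g)) ^ 2 - 1) by ring,
      totient_div_mul_mobiusLogSum, abs_mul, abs_of_nonneg (by positivity : (0 : ℝ) ≤ 1 / g)]
    set e := mobiusLogError W (R / g) with he
    have h6 : |e| ≤ 6 := abs_mobiusLogError_prod_le hP (by positivity)
    have h7 : |(1 + e) ^ 2 - 1| ≤ 8 * |e| := by
      rw [show (1 + e) ^ 2 - 1 = (2 + e) * e by ring, abs_mul]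
      gcongr
      have := abs_add_le 2 e
      rw [abs_of_pos (two_pos (α := ℝ))] at this
      linarith
    have hg0 : 0 ≤ 1 / (g : ℝ) := by positivity
    split_ifs with h
    · have : 1 / (g : ℝ) * |(1 + e) ^ 2 - 1| ≤ 1 / (g : ℝ) * 48 := by gcongr; linarith
      have : 0 ≤ 8 * η * (1 / (g : ℝ)) := by positivity
      linarith
    · have h8 : |e| ≤ η := by
        refine hη _ ?_
        rw [not_lt, le_div_iff₀ (by linarith)] at h
        rw [le_div_iff₀ (by linarith)]
        linarith
      have : 1 / (g : ℝ) * |(1 + e) ^ 2 - 1| ≤ 1 / (g : ℝ) * (8 * η) := by gcongr; linarith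
      linarith
  refine (Finset.sum_le_sum hterm).trans ?_
  rw [Finset.sum_add_distrib, ← Finset.mul_sum]
  gcongr
  rw [← Finset.sum_filter, ← Finset.mul_sum]
  gcongr
  have hsub : {g ∈ {g ∈ Finset.Icc 1 ⌊R⌋₊ | g.Coprime W} | R / Z < ((g : ℕ) : ℝ)} ⊆
      Finset.Icc 1 ⌊R⌋₊ \ Finset.Icc 1 ⌊R / Z⌋₊ := by
    intro g hg
    simp only [Finset.mem_filter, Finset.mem_sdiff, Finset.mem_Icc, not_and, not_le] at hg ⊢
    exact ⟨hg.1.1, fun _ => (Nat.floor_lt (by positivity)).mpr hg.2⟩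
  refine (Finset.sum_le_sum_of_subset_of_nonneg hsub fun _ _ _ => by positivity).trans ?_
  have hle : R / Z ≤ R := div_le_self (by linarith) hZ
  have h1 := Finset.sum_sdiff (f := fun g : ℕ => 1 / (g : ℝ))
    (Finset.Icc_subset_Icc_right (a := 1) (Nat.floor_mono hle))
  have h2 := harmonic_floor_le_one_add_log R hR
  have h3 := log_le_harmonic_floor (R / Z) (by positivity)
  rw [Real.log_div (by linarith) (by linarith)] at h3
  rw [harmonic_eq_sum_Icc] at h2 h3
  push_cast at h2 h3
  simp_rw [one_div] at h1 ⊢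
  linarith

theorem primeProduct_pos (w : ℝ) : 0 < primeProduct w :=
  Finset.prod_pos fun _ hp => (Finset.mem_filter.mp hp).2.pos

theorem primeProduct_le_four_pow (w : ℝ) : primeProduct w ≤ 4 ^ ⌊w⌋₊ :=
  primorial_le_four_pow _

theorem log_primeProduct_le (w : ℝ) : Real.log (primeProduct w) ≤ 2 * ⌊w⌋₊ := by
  have h1 : Real.log (primeProduct w) ≤ Real.log ((4 : ℝ) ^ ⌊w⌋₊) :=
    Real.log_le_log (by exact_mod_cast primeProduct_pos w)
      (by exact_mod_cast primeProduct_le_four_pow w)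
  have h2 : Real.log 4 ≤ 2 := by
    rw [show (4 : ℝ) = 2 ^ 2 by norm_num, Real.log_pow]
    have := Real.log_two_lt_d9
    push_cast
    linarith
  rw [Real.log_pow] at h1
  nlinarith [Nat.cast_nonneg (α := ℝ) ⌊w⌋₊]

/-- The density `φ(W) / W` of the integers coprime to `W = primeProduct w`. -/
noncomputable def coprimeDensity (w : ℝ) : ℝ :=
  ((primeProduct w).totient : ℝ) / primeProduct w

theorem coprimeDensity_pos (w : ℝ) : 0 < coprimeDensity w := by
  have h1 := primeProduct_pos w
  have h2 := Nat.totient_pos.mpr h1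
  unfold coprimeDensity
  positivity

theorem coprimeDensity_le_one (w : ℝ) : coprimeDensity w ≤ 1 := by
  rw [coprimeDensity, div_le_one (by exact_mod_cast primeProduct_pos w)]
  exact_mod_cast Nat.totient_le _

theorem one_le_primeProduct_mul_coprimeDensity (w : ℝ) :
    1 ≤ primeProduct w * coprimeDensity w := by
  have h1 : (0 : ℝ) < primeProduct w := by exact_mod_cast primeProduct_pos w
  rw [coprimeDensity, mul_div_cancel₀ _ h1.ne']
  exact_mod_cast Nat.totient_pos.mpr (primeProduct_pos w)

/-- As `W` times its density is `φ(W) ≥ 1`, errors of size `⌊w⌋ ^ 2` are negligible against the main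
term `φ(W) / W * log R`. -/
theorem le_mul_coprimeDensity_mul_log {w R κ : ℝ}
    (h : primeProduct w * (⌊w⌋₊ + 1 : ℝ) ^ 2 ≤ κ * Real.log R) :
    (⌊w⌋₊ + 1 : ℝ) ^ 2 ≤ κ * (coprimeDensity w * Real.log R) := by
  have h1 := one_le_primeProduct_mul_coprimeDensity w
  have h2 := coprimeDensity_pos w
  calc (⌊w⌋₊ + 1 : ℝ) ^ 2 ≤ (primeProduct w * coprimeDensity w) * (⌊w⌋₊ + 1 : ℝ) ^ 2 :=
        le_mul_of_one_le_left (by positivity) h1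
    _ = coprimeDensity w * (primeProduct w * (⌊w⌋₊ + 1 : ℝ) ^ 2) := by ring
    _ ≤ coprimeDensity w * (κ * Real.log R) := by gcongr
    _ = _ := by ring

theorem abs_coprimeHarmonic_primeProduct_sub_le {w R κ : ℝ} (hR : 1 ≤ R)
    (h : primeProduct w * (⌊w⌋₊ + 1 : ℝ) ^ 2 ≤ κ * Real.log R) :
    |coprimeHarmonic (primeProduct w) R - coprimeDensity w * Real.log R| ≤
      2 * κ * (coprimeDensity w * Real.log R) := by
  have h1 := abs_coprimeHarmonic_sub_le (primeProduct_pos w) hR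
  have h2 := log_primeProduct_le w
  have h3 := le_mul_coprimeDensity_mul_log h
  have h4 : (0 : ℝ) ≤ ⌊w⌋₊ := Nat.cast_nonneg _
  refine h1.trans ?_
  nlinarith

section Asymptotics

variable {α : Type*} {l : Filter α} {w R : α → ℝ}

/-- The constant is `49 * 2`: the coprime harmonic sum is eventually at most twice its main term. -/
theorem eventually_abs_bilinearSieveSum_le (hR : Tendsto R l atTop)
    (hκ : Tendsto (fun a => primeProduct (w a) * (⌊w a⌋₊ + 1 : ℝ) ^ 2 / Real.log (R a)) l
      (nhds 0)) :
    ∀ᶠ a in l, ∀ c d : ℕ, |coprimeDensity (w a) *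
      bilinearSieveSum (primeProduct (w a)) (R a) c d| ≤ 98 * Real.log (R a) := by
  filter_upwards [hR.eventually_gt_atTop 1, hκ.eventually_le_const (show (0 : ℝ) < 1 / 2 by
    norm_num)] with a ha hk c d
  have hlog : 0 < Real.log (R a) := Real.log_pos ha
  rw [div_le_iff₀ hlog] at hk
  have h1 := abs_coprimeHarmonic_primeProduct_sub_le ha.le hk
  have h2 := abs_bilinearSieveSum_le
    (P := {p ∈ Finset.range (⌊w a⌋₊ + 1) | p.Prime}) (fun p hp => (Finset.mem_filter.mp hp).2)
    ha.le c d
  change |coprimeDensity (w a) ^ 2 * bilinearSieveSum (primeProduct (w a)) (R a) c d| ≤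
    49 * coprimeHarmonic (primeProduct (w a)) (R a) at h2
  have hr := coprimeDensity_pos (w a)
  have h3 := (abs_le.mp h1).2
  rw [pow_two, mul_assoc, abs_mul, abs_of_pos hr] at h2
  have h4 : coprimeDensity (w a) *
      |coprimeDensity (w a) * bilinearSieveSum (primeProduct (w a)) (R a) c d| ≤
      coprimeDensity (w a) * (98 * Real.log (R a)) := by linarith
  exact le_of_mul_le_mul_left h4 hr

theorem eventually_abs_bilinearSieveSum_sub_le (hw : Tendsto w l atTop) (hR : Tendsto R l atTop)
    (hκ : Tendsto (fun a => primeProduct (w a) * (⌊w a⌋₊ + 1 : ℝ) ^ 2 / Real.log (R a)) l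
      (nhds 0)) {δ : ℝ} (hδ : 0 < δ) :
    ∀ᶠ a in l, |coprimeDensity (w a) * bilinearSieveSum (primeProduct (w a)) (R a) 1 1 /
      Real.log (R a) - 1| ≤ δ := by
  obtain ⟨X, hX1, hX⟩ : ∃ X : ℝ, 1 ≤ X ∧ ∀ x, X ≤ x → |mobiusLogError 1 x| ≤ δ / 64 := by
    have h := Metric.tendsto_atTop.mp tendsto_mobiusLogSum_one (δ / 64) (by positivity)
    obtain ⟨X, hX⟩ := h
    refine ⟨max X 1, le_max_right _ _, fun x hx => ?_⟩
    have := hX x ((le_max_left _ _).trans hx)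
    rw [Real.dist_eq] at this
    simpa [mobiusLogError] using this.le
  have hv : Tendsto (fun a => ⌊w a⌋₊) l atTop := tendsto_nat_floor_atTop.comp hw
  have hpow : Tendsto (fun n : ℕ => 6 * ((n : ℝ) + 1) / 2 ^ n) atTop (nhds 0) := by
    have h1 := tendsto_pow_const_div_const_pow_of_one_lt 1 (show (1 : ℝ) < 2 by norm_num)
    have h0 := tendsto_pow_const_div_const_pow_of_one_lt 0 (show (1 : ℝ) < 2 by norm_num)
    have := (h1.add h0).const_mul 6
    rw [add_zero, mul_zero] at this
    refine this.congr fun n => ?_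
    ring
  -- The first entry absorbs `48 * (1 + log Z)` for `Z = X * W ^ ⌊w⌋`, using `log W ≤ 2 * ⌊w⌋`; the
  -- second bounds the error of the harmonic sum by `δ / 4`; the third makes that sum at most twice
  -- its main term.
  set c : ℝ := min (δ / (4 * (48 * (3 + Real.log X)))) (min (δ / 8) (1 / 2)) with hc
  have hlogX : 0 ≤ Real.log X := Real.log_nonneg hX1
  have hc0 : 0 < c := by positivity
  filter_upwards [hR.eventually_gt_atTop 1, hκ.eventually_le_const hc0,
    (hpow.comp hv).eventually_le_const (show (0 : ℝ) < δ / 64 by positivity)] with a ha hk hpw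
  simp only [Function.comp_apply] at hpw
  have hlog : 0 < Real.log (R a) := Real.log_pos ha
  rw [div_le_iff₀ hlog] at hk
  have h1 := abs_coprimeHarmonic_primeProduct_sub_le ha.le hk
  have h0 := le_mul_coprimeDensity_mul_log hk
  set v := ⌊w a⌋₊ with hvdef
  set W := primeProduct (w a) with hW
  set r := coprimeDensity (w a) with hrdef
  have hr : 0 < r := coprimeDensity_pos (w a)
  set P : Finset ℕ := {p ∈ Finset.range (v + 1) | p.Prime} with hP
  have hPp : ∀ p ∈ P, p.Prime := fun p hp => (Finset.mem_filter.mp hp).2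
  have hcard : (P.card : ℝ) ≤ v + 1 := by
    have := Finset.card_filter_le (Finset.range (v + 1)) Nat.Prime
    rw [Finset.card_range] at this
    exact_mod_cast this
  have hW1 : (1 : ℝ) ≤ W := by exact_mod_cast primeProduct_pos (w a)
  -- The free exponent is taken to be `⌊w⌋`: then `(number of primes) / 2 ^ ⌊w⌋` tends to `0`, while
  -- `log (W ^ ⌊w⌋)` is only `O(⌊w⌋ ^ 2)`.
  have hη : ∀ x, X * (W : ℝ) ^ v ≤ x → |mobiusLogError W x| ≤ δ / 32 := by
    intro x hx
    have h := abs_mobiusLogError_prod_le_add hPp (by linarith) hX v (x := x) hx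
    refine h.trans ?_
    have : 6 * (P.card : ℝ) / 2 ^ v ≤ 6 * (v + 1) / 2 ^ v := by gcongr
    linarith
  have hZ1 : 1 ≤ X * (W : ℝ) ^ v := one_le_mul_of_one_le_of_one_le hX1 (one_le_pow₀ hW1)
  have h2 := abs_bilinearSieveSum_sub_le hPp ha.le hZ1 hη
  change |r ^ 2 * bilinearSieveSum W (R a) 1 1 - coprimeHarmonic W (R a)| ≤
    8 * (δ / 32) * coprimeHarmonic W (R a) + 48 * (1 + Real.log (X * (W : ℝ) ^ v)) at h2
  rw [Real.log_mul (by linarith) (by positivity), Real.log_pow] at h2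
  have h3 : Real.log W ≤ 2 * v := log_primeProduct_le (w a)
  have hv0 : (0 : ℝ) ≤ v := Nat.cast_nonneg _
  set h := coprimeHarmonic W (R a) with hh
  set D := r * Real.log (R a) with hD
  have hD0 : 0 < D := mul_pos hr hlog
  have c1 : c ≤ δ / (4 * (48 * (3 + Real.log X))) := min_le_left _ _
  have c2 : c ≤ δ / 8 := (min_le_right _ _).trans (min_le_left _ _)
  have c3 : c ≤ 1 / 2 := (min_le_right _ _).trans (min_le_right _ _)
  have c1' : c * (48 * (3 + Real.log X)) ≤ δ / 4 := by
    rw [le_div_iff₀ (by positivity)] at c1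
    linarith
  have h4 : 48 * (1 + (Real.log X + v * Real.log W)) ≤ δ / 4 * D := by
    have e1 : v * Real.log W ≤ 2 * (v + 1 : ℝ) ^ 2 := by nlinarith
    have e2 : 1 ≤ (v + 1 : ℝ) ^ 2 := by nlinarith
    have e3 : 48 * (1 + (Real.log X + v * Real.log W)) ≤
        48 * (3 + Real.log X) * (v + 1 : ℝ) ^ 2 := by nlinarith
    have e4 : 48 * (3 + Real.log X) * (v + 1 : ℝ) ^ 2 ≤ 48 * (3 + Real.log X) * (c * D) :=
      mul_le_mul_of_nonneg_left h0 (by positivity)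
    have e5 : c * (48 * (3 + Real.log X)) * D ≤ δ / 4 * D :=
      mul_le_mul_of_nonneg_right c1' hD0.le
    linarith
  have h5 : h ≤ 2 * D := by
    have := (abs_le.mp h1).2
    nlinarith
  have h6 : 2 * c * D ≤ δ / 4 * D := by nlinarith
  have h7 : |r ^ 2 * bilinearSieveSum W (R a) 1 1 - D| ≤ δ * D := by
    have e := abs_sub_le (r ^ 2 * bilinearSieveSum W (R a) 1 1) h D
    have : 8 * (δ / 32) * h ≤ δ / 4 * (2 * D) := by nlinarith
    linarith
  have h8 : r * bilinearSieveSum W (R a) 1 1 / Real.log (R a) - 1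
      = (r ^ 2 * bilinearSieveSum W (R a) 1 1 - D) / D := by
    rw [hD]; field_simp
  rw [h8, abs_div, abs_of_pos hD0, div_le_iff₀ hD0]
  exact h7

end Asymptotics

/-! ### Comparison of Euler products through an algebra homomorphism -/

section Comparison

variable {A B : Type*} [CommRing A] [Algebra ℝ A] [NormedRing B] [NormedAlgebra ℝ B]

/-- Comparison of Euler products: if each local factor `a p * d p` is close to `m p`, whose image
has a left inverse, then `∏ a p * ∏ d p` is close to `∏ m p`. -/
theorem exists_mul_eq_mul_prod {ι : Type*} (Φ : A →ₐ[ℝ] B) (s : Finset ι) (a d m : ι → A)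
    (m' : ι → B) (η : ι → ℝ) (hm : ∀ p ∈ s, m' p * Φ (m p) = 1)
    (hη : ∀ p ∈ s, ‖Φ (a p * d p - m p)‖ * ‖m' p‖ ≤ η p) :
    ∃ H : B, Φ (∏ p ∈ s, a p) * Φ (∏ p ∈ s, d p) = H * Φ (∏ p ∈ s, m p) ∧
      ‖H - 1‖ ≤ ∏ p ∈ s, (1 + η p) - 1 := by
  classical
  induction s using Finset.induction_on with
  | empty => exact ⟨1, by simp, by simp⟩
  | insert q s hq ih =>
    obtain ⟨H, h1, h2⟩ := ih (fun p hp => hm p (Finset.mem_insert_of_mem hp))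
      (fun p hp => hη p (Finset.mem_insert_of_mem hp))
    -- The relative error at `q`. Only elements in the image of `Φ` are known to commute, so error
    -- factors are kept on the left.
    set E : B := Φ (a q * d q - m q) * m' q with hE
    have hmq := hm q (Finset.mem_insert_self q s)
    have hE1 : ‖E‖ ≤ η q := (norm_mul_le _ _).trans (hη q (Finset.mem_insert_self q s))
    have hEm : (1 + E) * Φ (m q) = Φ (a q * d q) := by
      rw [add_mul, one_mul, hE, mul_assoc, hmq, mul_one, map_sub]
      abel
    refine ⟨H * (1 + E), ?_, ?_⟩
    · rw [Finset.prod_insert hq, Finset.prod_insert hq, Finset.prod_insert hq]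
      calc Φ (a q * ∏ p ∈ s, a p) * Φ (d q * ∏ p ∈ s, d p)
          = (Φ (∏ p ∈ s, a p) * Φ (∏ p ∈ s, d p)) * Φ (a q * d q) := by
            simp only [← map_mul]; congr 1; ring
        _ = H * Φ (∏ p ∈ s, m p) * Φ (a q * d q) := by rw [h1]
        _ = H * (Φ (a q * d q) * Φ (∏ p ∈ s, m p)) := by
            rw [mul_assoc, ← map_mul, ← map_mul, mul_comm]
        _ = H * (1 + E) * Φ (m q * ∏ p ∈ s, m p) := by
            rw [← hEm, map_mul]; simp only [mul_assoc]
    · rw [Finset.prod_insert hq]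
      have h3 : H * (1 + E) - 1 = (H - 1) + (H - 1) * E + E := by noncomm_ring
      have h4 : ‖(H - 1) * E‖ ≤ ‖H - 1‖ * ‖E‖ := norm_mul_le _ _
      have h5 : 0 ≤ ‖H - 1‖ := norm_nonneg _
      have h6 : 0 ≤ ‖E‖ := norm_nonneg _
      rw [h3]
      refine (norm_add₃_le).trans ?_
      nlinarith [mul_nonneg h5 (sub_nonneg.mpr hE1), mul_nonneg (h6.trans hE1) (sub_nonneg.mpr h2)]

/-- First-order expansion with a quadratic error, measured after `Φ` because `A` itself carries no
norm. -/
theorem norm_map_prod_one_sub_sub_le {ι : Type*} (Φ : A →ₐ[ℝ] B) (s : Finset ι) (x : ι → A)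
    (hx : ∀ j ∈ s, ‖Φ (x j)‖ ≤ 1) {c : ℝ} (hc0 : 0 ≤ c) (hc1 : c ≤ 1) :
    ‖Φ (∏ j ∈ s, (1 - c • x j) - (1 - c • ∑ j ∈ s, x j))‖ ≤ c ^ 2 * 4 ^ s.card := by
  classical
  induction s using Finset.induction_on with
  | empty => simp; positivity
  | insert q s hq ih =>
    have ih' := ih fun j hj => hx j (Finset.mem_insert_of_mem hj)
    have hxq := hx q (Finset.mem_insert_self q s)
    rw [Finset.prod_insert hq, Finset.sum_insert hq, Finset.card_insert_of_notMem hq]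
    set r := ∏ j ∈ s, (1 - c • x j) - (1 - c • ∑ j ∈ s, x j) with hr
    have hS : ‖Φ (∑ j ∈ s, x j)‖ ≤ s.card := by
      rw [map_sum]
      refine (norm_sum_le _ _).trans ?_
      refine (Finset.sum_le_sum fun j hj => hx j (Finset.mem_insert_of_mem hj)).trans ?_
      simp
    have e : (1 - c • x q) * ∏ j ∈ s, (1 - c • x j) - (1 - c • (x q + ∑ j ∈ s, x j))
        = r - c • (x q * r) + (c ^ 2) • (x q * ∑ j ∈ s, x j) := by
      rw [hr]
      simp only [Algebra.smul_def, map_pow]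
      ring
    rw [e, map_add, map_sub, map_smul, map_smul, map_mul, map_mul]
    have b1 : ‖c • (Φ (x q) * Φ r)‖ ≤ 1 * (1 * ‖Φ r‖) := by
      rw [norm_smul, Real.norm_of_nonneg hc0]
      refine mul_le_mul hc1 ((norm_mul_le _ _).trans ?_) (norm_nonneg _) zero_le_one
      gcongr
    have b2 : ‖c ^ 2 • (Φ (x q) * Φ (∑ j ∈ s, x j))‖ ≤ c ^ 2 * (1 * s.card) := by
      rw [norm_smul, Real.norm_of_nonneg (by positivity)]
      refine mul_le_mul_of_nonneg_left ((norm_mul_le _ _).trans ?_) (by positivity)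
      gcongr
    have b3 : (s.card : ℝ) ≤ 4 ^ s.card := by
      exact_mod_cast (Nat.lt_pow_self (by norm_num : 1 < 4)).le
    refine (norm_add_le _ _).trans ?_
    refine (add_le_add (norm_sub_le _ _) b2).trans ?_
    have b4 : c ^ 2 * (s.card : ℝ) ≤ c ^ 2 * 4 ^ s.card := by gcongr
    have b5 : 0 ≤ c ^ 2 * 4 ^ s.card := by positivity
    rw [pow_succ (4 : ℝ)]
    linarith

theorem norm_map_prod_le_pow {ι : Type*} (Φ : A →ₐ[ℝ] B) (h1 : ‖(1 : B)‖ ≤ 1) (s : Finset ι)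
    (x : ι → A) {C : ℝ} (hx : ∀ j ∈ s, ‖Φ (x j)‖ ≤ C) :
    ‖Φ (∏ j ∈ s, x j)‖ ≤ C ^ s.card := by
  classical
  induction s using Finset.induction_on with
  | empty => simpa using h1
  | insert q s hq ih =>
    have hxq := hx q (Finset.mem_insert_self q s)
    rw [Finset.prod_insert hq, Finset.card_insert_of_notMem hq, pow_succ', map_mul]
    refine (norm_mul_le _ _).trans ?_
    exact mul_le_mul hxq (ih fun j hj => hx j (Finset.mem_insert_of_mem hj)) (norm_nonneg _)
      ((norm_nonneg _).trans hxq)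

/-- Since `c ≤ 1 / 2`, each factor is inverted by a Neumann series of norm at most `2`. -/
theorem exists_left_inverse_prod_one_sub [CompleteSpace B] {ι : Type*} (Φ : A →ₐ[ℝ] B)
    (h1 : ‖(1 : B)‖ ≤ 1) (s : Finset ι) (x : ι → A) (hx : ∀ j ∈ s, ‖Φ (x j)‖ ≤ 1) {c : ℝ}
    (hc0 : 0 ≤ c) (hc : c ≤ 1 / 2) :
    ∃ v : B, v * Φ (∏ j ∈ s, (1 - c • x j)) = 1 ∧ ‖v‖ ≤ 2 ^ s.card := by
  classical
  induction s using Finset.induction_on with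
  | empty => exact ⟨1, by simp, by simpa using h1⟩
  | insert q s hq ih =>
    obtain ⟨v, hv1, hv2⟩ := ih fun j hj => hx j (Finset.mem_insert_of_mem hj)
    have hxq : ‖Φ (c • x q)‖ ≤ 1 / 2 := by
      rw [map_smul, norm_smul, Real.norm_of_nonneg hc0]
      calc c * ‖Φ (x q)‖ ≤ 1 / 2 * 1 := by
            gcongr
            exact hx q (Finset.mem_insert_self q s)
        _ = 1 / 2 := mul_one _
    have hlt : ‖Φ (c • x q)‖ < 1 := by linarith
    set g : B := ∑' n : ℕ, Φ (c • x q) ^ n with hg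
    have hg1 : g * (1 - Φ (c • x q)) = 1 := geom_series_mul_neg _ hlt
    have hg2 : ‖g‖ ≤ 2 := by
      refine (tsum_geometric_le_of_norm_lt_one _ hlt).trans ?_
      have : (1 - ‖Φ (c • x q)‖)⁻¹ ≤ 2 := by
        rw [inv_le_comm₀ (by linarith) two_pos]
        linarith
      linarith
    refine ⟨v * g, ?_, ?_⟩
    · rw [Finset.prod_insert hq, map_mul, map_sub, map_one]
      calc v * g * ((1 - Φ (c • x q)) * Φ (∏ j ∈ s, (1 - c • x j)))
          = v * (g * (1 - Φ (c • x q))) * Φ (∏ j ∈ s, (1 - c • x j)) := by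
            simp only [mul_assoc]
        _ = 1 := by rw [hg1, mul_one, hv1]
    · rw [Finset.card_insert_of_notMem hq, pow_succ]
      exact (norm_mul_le _ _).trans (mul_le_mul hv2 hg2 (norm_nonneg _) (by positivity))

end Comparison

/-! ### The local factor at one prime -/

section LocalFactor

variable {A B : Type*} [CommRing A] [Algebra ℝ A] [NormedRing B] [NormedAlgebra ℝ B]
variable {I Z : Type*} [Fintype I] [DecidableEq I] [Fintype Z]

/-- The average over `z` of `∏_{i ∈ S z} (1 - x i) (1 - y i)`. -/
noncomputable def localFactor (S : Z → Finset I) (x : I × Bool → A) : A :=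
  (1 / (Fintype.card Z : ℝ)) • ∑ z, ∏ i ∈ S z, ((1 - x (i, false)) * (1 - x (i, true)))

/-- The constant in the comparison of local factors for `m` linear forms. -/
def localErrorConst (m : ℕ) : ℝ :=
  m ^ 2 * (4 ^ m + 1 + 3 * m) * (1 + m + 4 ^ m) + 3 * m ^ 2 + (1 + 3 * m) * 4 ^ m + 16 ^ m

/-- Write `(1 - x) (1 - y) = 1 - u`. The product over `S z` equals `1 - ∑ u` exactly when `S z` has
at most one element, and the average of this linear part is determined by `hS1`. By `hS2` and a
union over pairs, the other `z` have proportion at most `m ^ 2 * c ^ 2`. -/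
theorem norm_map_localFactor_sub_le [Nonempty Z] (Φ : A →ₐ[ℝ] B) (h1 : ‖(1 : B)‖ ≤ 1)
    (S : Z → Finset I) (x : I × Bool → A) (hx : ∀ j, ‖Φ (x j)‖ ≤ 1) {c : ℝ}
    (hS1 : ∀ i, ((Finset.univ.filter fun z => i ∈ S z).card : ℝ) = c * Fintype.card Z)
    (hS2 : ∀ i j, i ≠ j → ((Finset.univ.filter fun z => i ∈ S z ∧ j ∈ S z).card : ℝ) ≤
      c ^ 2 * Fintype.card Z) :
    ‖Φ (localFactor S x - (1 - c • ∑ i, (x (i, false) + x (i, true) - x (i, false) * x (i, true))))‖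
      ≤ c ^ 2 * ((Fintype.card I : ℝ) ^ 2 * (4 ^ Fintype.card I + 1 + 3 * Fintype.card I)) := by
  classical
  set m := Fintype.card I with hm
  set n : ℝ := (Fintype.card Z : ℝ) with hn
  have hn0 : 0 < n := by rw [hn]; exact_mod_cast Fintype.card_pos
  set u : I → A := fun i => x (i, false) + x (i, true) - x (i, false) * x (i, true) with hu
  have hu3 : ∀ i, ‖Φ (u i)‖ ≤ 3 := by
    intro i
    simp only [hu, map_sub, map_add, map_mul]
    refine (norm_sub_le _ _).trans ?_
    have := norm_add_le (Φ (x (i, false))) (Φ (x (i, true)))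
    have := (norm_mul_le (Φ (x (i, false))) (Φ (x (i, true)))).trans
      (mul_le_one₀ (hx _) (norm_nonneg _) (hx (i, true)))
    linarith [hx (i, false), hx (i, true)]
  have h1u : ∀ i, (1 - x (i, false)) * (1 - x (i, true)) = 1 - u i := by
    intro i; simp only [hu]; ring
  set r : Z → A := fun z => ∏ i ∈ S z, (1 - u i) - (1 - ∑ i ∈ S z, u i) with hr
  have hr0 : ∀ z, (S z).card ≤ 1 → r z = 0 := by
    intro z hz
    rcases Nat.le_one_iff_eq_zero_or_eq_one.mp hz with h | h
    · rw [Finset.card_eq_zero] at h; simp [hr, h]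
    · obtain ⟨i, hi⟩ := Finset.card_eq_one.mp h; simp [hr, hi]
  set K : ℝ := 4 ^ m + 1 + 3 * m with hK
  have hK0 : 0 ≤ K := by positivity
  have hrK : ∀ z, ‖Φ (r z)‖ ≤ K := by
    intro z
    have hcard : (S z).card ≤ m := Finset.card_le_univ _
    have b1 : ‖Φ (∏ i ∈ S z, (1 - u i))‖ ≤ 4 ^ m := by
      refine (norm_map_prod_le_pow Φ h1 (S z) _ (C := 4) fun i _ => ?_).trans
        (pow_le_pow_right₀ (by norm_num) hcard)
      rw [map_sub, map_one]
      refine (norm_sub_le _ _).trans ?_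
      linarith [hu3 i]
    have b2 : ‖Φ (∑ i ∈ S z, u i)‖ ≤ 3 * m := by
      rw [map_sum]
      refine (norm_sum_le _ _).trans ((Finset.sum_le_sum fun i _ => hu3 i).trans ?_)
      rw [Finset.sum_const, nsmul_eq_mul, mul_comm]
      gcongr
    simp only [hr, map_sub, map_one]
    refine (norm_sub_le _ _).trans ?_
    have := norm_sub_le (1 : B) (Φ (∑ i ∈ S z, u i))
    linarith
  have hsumS : ∑ z, ∑ i ∈ S z, u i = (c * n) • ∑ i, u i := by
    calc ∑ z, ∑ i ∈ S z, u i = ∑ z, ∑ i, if i ∈ S z then u i else 0 := by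
          refine Finset.sum_congr rfl fun z _ => ?_
          rw [Finset.sum_ite_mem, Finset.univ_inter]
      _ = ∑ i, ∑ z, if i ∈ S z then u i else 0 := Finset.sum_comm
      _ = _ := by
          rw [Finset.smul_sum]
          refine Finset.sum_congr rfl fun i _ => ?_
          rw [← Finset.sum_filter, Finset.sum_const, ← hS1 i, Nat.cast_smul_eq_nsmul]
  have key : localFactor S x - (1 - c • ∑ i, u i) = (1 / n) • ∑ z, r z := by
    have e1 : ∑ z, r z = ∑ z, ∏ i ∈ S z, (1 - u i) - (n • (1 : A) - (c * n) • ∑ i, u i) := by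
      simp only [hr, Finset.sum_sub_distrib, hsumS]
      rw [Finset.sum_const, Finset.card_univ, hn, Nat.cast_smul_eq_nsmul]
    rw [e1, localFactor]
    simp_rw [h1u]
    rw [smul_sub, smul_sub, smul_smul, smul_smul, one_div_mul_cancel hn0.ne', one_smul,
      show 1 / n * (c * n) = c by field_simp]
  rw [key, map_smul, map_sum, norm_smul, Real.norm_of_nonneg (by positivity)]
  have hbad : (∑ z, ‖Φ (r z)‖) ≤ (m : ℝ) ^ 2 * (c ^ 2 * n) * K := by
    have hpt : ∀ z, ‖Φ (r z)‖ ≤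
        ∑ ij ∈ (Finset.univ : Finset I).offDiag, if ij.1 ∈ S z ∧ ij.2 ∈ S z then K else 0 := by
      intro z
      by_cases hz : (S z).card ≤ 1
      · rw [hr0 z hz, map_zero, norm_zero]
        exact Finset.sum_nonneg fun _ _ => by split_ifs <;> simp [hK0]
      · obtain ⟨i, hi, j, hj, hij⟩ := Finset.one_lt_card.mp (not_le.mp hz)
        refine (hrK z).trans ?_
        have := Finset.single_le_sum (s := (Finset.univ : Finset I).offDiag)
          (f := fun ij : I × I => if ij.1 ∈ S z ∧ ij.2 ∈ S z then K else 0)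
          (fun _ _ => by split_ifs <;> simp [hK0])
          (show (i, j) ∈ (Finset.univ : Finset I).offDiag by simp [hij])
        simpa [hi, hj] using this
    refine (Finset.sum_le_sum fun z _ => hpt z).trans ?_
    rw [Finset.sum_comm]
    have hpair : ∀ ij ∈ (Finset.univ : Finset I).offDiag,
        (∑ z : Z, if ij.1 ∈ S z ∧ ij.2 ∈ S z then K else 0) ≤ (c ^ 2 * n) * K := by
      intro ij hij
      rw [← Finset.sum_filter, Finset.sum_const, nsmul_eq_mul]
      exact mul_le_mul_of_nonneg_right (hS2 _ _ (Finset.mem_offDiag.mp hij).2.2) hK0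
    refine (Finset.sum_le_sum hpair).trans ?_
    rw [Finset.sum_const, nsmul_eq_mul, mul_assoc ((m : ℝ) ^ 2)]
    refine mul_le_mul_of_nonneg_right ?_ (by positivity)
    have : (Finset.univ : Finset I).offDiag.card ≤ m ^ 2 := by
      rw [Finset.offDiag_card, Finset.card_univ, ← hm, pow_two]
      exact Nat.sub_le _ _
    exact_mod_cast this
  calc 1 / n * ‖∑ z, Φ (r z)‖ ≤ 1 / n * ((m : ℝ) ^ 2 * (c ^ 2 * n) * K) := by
        gcongr
        exact (norm_sum_le _ _).trans hbad
    _ = c ^ 2 * ((m : ℝ) ^ 2 * K) := by field_simp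

/-- The linear term of the local factor is `x + y - x * y` for each `i`. The extra factor `1 - c * x
* y` removes the cross term to first order, leaving a product in which all variables separate. -/
theorem norm_map_localFactor_mul_sub_le [Nonempty Z] (Φ : A →ₐ[ℝ] B) (h1 : ‖(1 : B)‖ ≤ 1)
    (S : Z → Finset I) (x : I × Bool → A) (hx : ∀ j, ‖Φ (x j)‖ ≤ 1) {c : ℝ} (hc0 : 0 ≤ c)
    (hc1 : c ≤ 1)
    (hS1 : ∀ i, ((Finset.univ.filter fun z => i ∈ S z).card : ℝ) = c * Fintype.card Z)
    (hS2 : ∀ i j, i ≠ j → ((Finset.univ.filter fun z => i ∈ S z ∧ j ∈ S z).card : ℝ) ≤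
      c ^ 2 * Fintype.card Z) :
    ‖Φ (localFactor S x * ∏ i, (1 - c • (x (i, false) * x (i, true))) - ∏ j, (1 - c • x j))‖
      ≤ localErrorConst (Fintype.card I) * c ^ 2 := by
  set m := Fintype.card I with hm
  have hα := norm_map_localFactor_sub_le Φ h1 S x hx hS1 hS2
  have hxy : ∀ i : I, ‖Φ (x (i, false) * x (i, true))‖ ≤ 1 := by
    intro i
    rw [map_mul]
    exact (norm_mul_le _ _).trans (mul_le_one₀ (hx _) (norm_nonneg _) (hx _))
  have hβ := norm_map_prod_one_sub_sub_le Φ Finset.univ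
    (fun i : I => x (i, false) * x (i, true)) (fun i _ => hxy i) hc0 hc1
  have hγ := norm_map_prod_one_sub_sub_le Φ Finset.univ x (fun i _ => hx i) hc0 hc1
  rw [Finset.card_univ] at hβ hγ
  rw [Fintype.card_prod, Fintype.card_bool, mul_comm (Fintype.card I), pow_mul,
    show (4 : ℝ) ^ 2 = 16 by norm_num, Fintype.sum_prod_type] at hγ
  simp only [Fintype.sum_bool] at hγ
  set su := ∑ i, (x (i, false) + x (i, true) - x (i, false) * x (i, true)) with hsu
  set sp := ∑ i, x (i, false) * x (i, true) with hsp
  set sx := ∑ i, (x (i, true) + x (i, false)) with hsx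
  set D := ∏ i, (1 - c • (x (i, false) * x (i, true))) with hD
  set M := ∏ j, (1 - c • x j) with hM
  set L := localFactor S x with hL
  set α := L - (1 - c • su) with hαdef
  set β := D - (1 - c • sp) with hβdef
  set γ := M - (1 - c • sx) with hγdef
  have hsum : su + sp = sx := by
    rw [hsu, hsp, hsx, ← Finset.sum_add_distrib]
    exact Finset.sum_congr rfl fun i _ => by ring
  have hsp' : ‖Φ sp‖ ≤ m := by
    rw [hsp, map_sum]
    refine (norm_sum_le _ _).trans ((Finset.sum_le_sum fun i _ => hxy i).trans ?_)
    simp [hm]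
  have hsu' : ‖Φ su‖ ≤ 3 * m := by
    rw [hsu, map_sum]
    refine (norm_sum_le _ _).trans ((Finset.sum_le_sum (g := fun _ => (3 : ℝ)) fun i _ => ?_).trans ?_)
    · rw [map_sub, map_add]
      refine (norm_sub_le _ _).trans ?_
      linarith [norm_add_le (Φ (x (i, false))) (Φ (x (i, true))), hx (i, false), hx (i, true), hxy i]
    · simp [hm, mul_comm]
  have e : L * D - M = α * D + c ^ 2 • (su * sp) + (1 - c • su) * β - γ := by
    rw [hαdef, hβdef, hγdef, ← hsum]
    simp only [Algebra.smul_def, map_pow]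
    ring
  have hD' : ‖Φ D‖ ≤ 1 + m + 4 ^ m := by
    have e1 : D = 1 - c • sp + β := by rw [hβdef]; ring
    rw [e1, map_add, map_sub, map_one, map_smul]
    refine (norm_add_le _ _).trans (add_le_add ((norm_sub_le _ _).trans (add_le_add h1 ?_)) ?_)
    · rw [norm_smul, Real.norm_of_nonneg hc0]
      calc c * ‖Φ sp‖ ≤ 1 * m := by gcongr
        _ = m := one_mul _
    · refine hβ.trans (mul_le_of_le_one_left (by positivity) (pow_le_one₀ hc0 hc1))
  have t1 : ‖Φ (α * D)‖ ≤ c ^ 2 * ((m : ℝ) ^ 2 * (4 ^ m + 1 + 3 * m)) * (1 + m + 4 ^ m) := by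
    rw [map_mul]
    exact (norm_mul_le _ _).trans (mul_le_mul hα hD' (norm_nonneg _) (by positivity))
  have t2 : ‖Φ (c ^ 2 • (su * sp))‖ ≤ c ^ 2 * (3 * m * m) := by
    rw [map_smul, norm_smul, Real.norm_of_nonneg (by positivity), map_mul]
    gcongr
    exact (norm_mul_le _ _).trans (mul_le_mul hsu' hsp' (norm_nonneg _) (by positivity))
  have t3 : ‖Φ ((1 - c • su) * β)‖ ≤ (1 + 3 * m) * (c ^ 2 * 4 ^ m) := by
    rw [map_mul]
    refine (norm_mul_le _ _).trans (mul_le_mul ?_ hβ (norm_nonneg _) (by positivity))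
    rw [map_sub, map_one, map_smul]
    refine (norm_sub_le _ _).trans (add_le_add h1 ?_)
    rw [norm_smul, Real.norm_of_nonneg hc0]
    calc c * ‖Φ su‖ ≤ 1 * (3 * m) := by gcongr
      _ = 3 * m := one_mul _
  rw [e, map_sub, map_add, map_add]
  refine (norm_sub_le _ _).trans ?_
  refine (add_le_add (norm_add₃_le) hγ).trans ?_
  rw [localErrorConst]
  linarith

end LocalFactor

/-! ### Dilation operators on bounded functions -/

section Dilation

set_option linter.unusedSectionVars false

variable {ι : Type*} [Fintype ι]

/-- The dilation operator `F ↦ F (c * ·)` on bounded functions of `ι → ℕ`. -/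
noncomputable def dilation (c : ι → ℕ) :
    BoundedContinuousFunction (ι → ℕ) ℝ →L[ℝ] BoundedContinuousFunction (ι → ℕ) ℝ :=
  LinearMap.mkContinuous
    { toFun := fun F => F.compContinuous ⟨fun e => c * e, continuous_of_discreteTopology⟩
      map_add' := fun _ _ => rfl
      map_smul' := fun _ _ => rfl } 1
    (fun F => by
      rw [one_mul]
      exact (BoundedContinuousFunction.norm_le (norm_nonneg F)).mpr fun e => F.norm_coe_le_norm _)

theorem dilation_apply (c : ι → ℕ) (F : BoundedContinuousFunction (ι → ℕ) ℝ) (e : ι → ℕ) :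
    dilation c F e = F (c * e) := rfl

theorem norm_dilation_le (c : ι → ℕ) : ‖dilation c‖ ≤ 1 :=
  LinearMap.mkContinuous_norm_le _ zero_le_one _

/-- The dilation operators, as a monoid homomorphism. -/
noncomputable def dilationHom : (ι → ℕ) →*
    (BoundedContinuousFunction (ι → ℕ) ℝ →L[ℝ] BoundedContinuousFunction (ι → ℕ) ℝ) where
  toFun := dilation
  map_one' := by
    ext F e
    rw [dilation_apply, one_mul]
    rfl
  map_mul' c c' := by
    ext F e
    change F (c * c' * e) = F (c' * (c * e))
    rw [mul_comm c c', mul_assoc]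

/-- The action of the monoid algebra on bounded functions by dilations. -/
noncomputable def dilationAct : MonoidAlgebra ℝ (ι → ℕ) →ₐ[ℝ]
    (BoundedContinuousFunction (ι → ℕ) ℝ →L[ℝ] BoundedContinuousFunction (ι → ℕ) ℝ) :=
  MonoidAlgebra.lift ℝ _ _ dilationHom

theorem dilationAct_of (c : ι → ℕ) :
    dilationAct (MonoidAlgebra.of ℝ (ι → ℕ) c) = dilation c := by
  rw [dilationAct, MonoidAlgebra.of_apply, MonoidAlgebra.lift_single, one_smul]
  rfl

theorem norm_one_dilation_le :
    ‖(1 : BoundedContinuousFunction (ι → ℕ) ℝ →L[ℝ] BoundedContinuousFunction (ι → ℕ) ℝ)‖ ≤ 1 :=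
  ContinuousLinearMap.norm_id_le

theorem dilationAct_sum_apply {κ : Type*} (s : Finset κ) (a : κ → ℝ) (c : κ → ι → ℕ)
    (F : BoundedContinuousFunction (ι → ℕ) ℝ) (e : ι → ℕ) :
    dilationAct (∑ k ∈ s, a k • MonoidAlgebra.of ℝ (ι → ℕ) (c k)) F e =
      ∑ k ∈ s, a k * F (c k * e) := by
  rw [map_sum, _root_.sum_apply, BoundedContinuousFunction.sum_apply]
  refine Finset.sum_congr rfl fun k _ => ?_
  rw [map_smul, dilationAct_of]
  rfl

theorem posLog_div_natCast_le (R : ℝ) (n : ℕ) : Real.posLog (R / n) ≤ Real.posLog R := by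
  rcases Nat.eq_zero_or_pos n with rfl | hn
  · simp [Real.posLog_nonneg]
  · rw [← Real.posLog_abs (R / n), ← Real.posLog_abs R]
    refine Real.posLog_le_posLog (abs_nonneg _) ?_
    rw [abs_div, Nat.abs_cast]
    exact div_le_self (abs_nonneg _) (by exact_mod_cast hn)

/-- The function `e ↦ ∏ j, log⁺ (R / e j)`. -/
noncomputable def logWeight (ι : Type*) [Fintype ι] (R : ℝ) :
    BoundedContinuousFunction (ι → ℕ) ℝ :=
  BoundedContinuousFunction.ofNormedAddCommGroupDiscrete
    (fun e => ∏ j, Real.posLog (R / e j)) (∏ _j : ι, Real.posLog R) (fun e => by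
      rw [Real.norm_of_nonneg (Finset.prod_nonneg fun _ _ => Real.posLog_nonneg)]
      exact Finset.prod_le_prod (fun _ _ => Real.posLog_nonneg)
        fun j _ => posLog_div_natCast_le R (e j))

theorem logWeight_apply (R : ℝ) (e : ι → ℕ) :
    logWeight ι R e = ∏ j, Real.posLog (R / e j) := rfl

variable [DecidableEq ι]

/-- The monomial dilating the coordinate `j`. -/
noncomputable def coordMonomial (j : ι) : ℕ →* MonoidAlgebra ℝ (ι → ℕ) :=
  (MonoidAlgebra.of ℝ (ι → ℕ)).comp (MonoidHom.mulSingle (fun _ => ℕ) j)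

theorem coordMonomial_apply (j : ι) (d : ℕ) :
    coordMonomial j d = MonoidAlgebra.of ℝ (ι → ℕ) (Pi.mulSingle j d) := rfl

theorem norm_dilationAct_coordMonomial_le (j : ι) (d : ℕ) :
    ‖dilationAct (coordMonomial j d)‖ ≤ 1 := by
  rw [coordMonomial_apply, dilationAct_of]
  exact norm_dilation_le _

theorem prod_coordMonomial (d : ι → ℕ) :
    ∏ j, coordMonomial j (d j) = MonoidAlgebra.of ℝ (ι → ℕ) d := by
  simp_rw [coordMonomial_apply]
  rw [← map_prod, Finset.univ_prod_mulSingle]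

theorem prod_sum_coordMonomial (T : Finset ℕ) (a : ι → ℕ → ℝ) :
    ∏ j : ι, ∑ d ∈ T, a j d • coordMonomial j d =
      ∑ d ∈ Fintype.piFinset fun _ : ι => T,
        (∏ j, a j (d j)) • MonoidAlgebra.of ℝ (ι → ℕ) d := by
  rw [Finset.prod_univ_sum]
  refine Finset.sum_congr rfl fun d _ => ?_
  rw [← prod_coordMonomial, ← Finset.prod_smul]

/-- The action on `logWeight` of a product of one-variable factors. -/
theorem dilationAct_prod_logWeight (T : Finset ℕ) (a : ι → ℕ → ℝ) (R : ℝ) (e : ι → ℕ) :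
    dilationAct (∏ j : ι, ∑ d ∈ T, a j d • coordMonomial j d) (logWeight ι R) e =
      ∏ j, ∑ d ∈ T, a j d * Real.posLog (R / (d * e j : ℕ)) := by
  rw [prod_sum_coordMonomial, dilationAct_sum_apply, Finset.prod_univ_sum]
  refine Finset.sum_congr rfl fun d _ => ?_
  rw [logWeight_apply, ← Finset.prod_mul_distrib]
  rfl

end Dilation

/-! ### Euler products over the sieving primes -/

section Pairs

set_option linter.unusedSectionVars false

variable {I : Type*} [Fintype I] [DecidableEq I]

/-- The monomial dilating both coordinates belonging to `i`. -/
noncomputable def pairMonomial (i : I) : ℕ →* MonoidAlgebra ℝ (I × Bool → ℕ) :=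
  coordMonomial (i, false) * coordMonomial (i, true)

theorem pairMonomial_apply (i : I) (d : ℕ) :
    pairMonomial i d = coordMonomial (i, false) d * coordMonomial (i, true) d := rfl

theorem pairMonomial_eq_of (i : I) (d : ℕ) :
    pairMonomial i d = MonoidAlgebra.of ℝ (I × Bool → ℕ)
      (Pi.mulSingle (i, false) d * Pi.mulSingle (i, true) d) := by
  rw [pairMonomial_apply, coordMonomial_apply, coordMonomial_apply, map_mul]

theorem prod_pairMonomial (d : I → ℕ) :
    ∏ i, pairMonomial i (d i) = MonoidAlgebra.of ℝ (I × Bool → ℕ) (fun j => d j.1) := by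
  rw [← prod_coordMonomial, Fintype.prod_prod_type]
  refine Finset.prod_congr rfl fun i _ => ?_
  rw [Fintype.prod_bool, pairMonomial_apply, mul_comm]

theorem prod_sum_pairMonomial (T : Finset ℕ) (a : ℕ → ℝ) :
    ∏ i : I, ∑ g ∈ T, a g • pairMonomial i g =
      ∑ g ∈ Fintype.piFinset fun _ : I => T,
        (∏ i, a (g i)) • MonoidAlgebra.of ℝ (I × Bool → ℕ) (fun j => g j.1) := by
  rw [Finset.prod_univ_sum]
  refine Finset.sum_congr rfl fun d _ => ?_
  rw [← prod_pairMonomial, ← Finset.prod_smul]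

end Pairs

theorem squarefree_prod_primes {P : Finset ℕ} (hP : ∀ p ∈ P, p.Prime) :
    Squarefree (∏ p ∈ P, p) := by
  classical
  induction P using Finset.induction_on with
  | empty => simp
  | insert p P hpP ih =>
    have hP' : ∀ r ∈ P, r.Prime := fun r hr => hP r (Finset.mem_insert_of_mem hr)
    have hp := hP p (Finset.mem_insert_self p P)
    rw [Finset.prod_insert hpP, Nat.squarefree_mul_iff]
    exact ⟨(Nat.Prime.coprime_iff_not_dvd hp).mpr (not_dvd_prod_primes hP' hp hpP),
      hp.prime.squarefree, ih hP'⟩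

/-- The expansion of an Euler product over the divisors of a squarefree number, for the
multiplicative function `d ↦ X d / d`. -/
theorem prod_one_sub_smul_eq_sum {A : Type*} [CommRing A] [Algebra ℝ A] {P : Finset ℕ}
    (hP : ∀ p ∈ P, p.Prime) (X : ℕ →* A) :
    ∏ p ∈ P, (1 - (1 / (p : ℝ)) • X p) =
      ∑ d ∈ (∏ p ∈ P, p).divisors, ((ArithmeticFunction.moebius d : ℝ) / d) • X d := by
  set f : ArithmeticFunction A :=
    ⟨fun d => if d = 0 then 0 else (1 / (d : ℝ)) • X d, if_pos rfl⟩ with hf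
  have hfa : ∀ d, d ≠ 0 → f d = (1 / (d : ℝ)) • X d := fun d hd => if_neg hd
  have hmul : f.IsMultiplicative := by
    rw [ArithmeticFunction.IsMultiplicative.iff_ne_zero]
    refine ⟨by rw [hfa 1 one_ne_zero]; simp, fun {m n} hm hn _ => ?_⟩
    rw [hfa _ hm, hfa _ hn, hfa _ (mul_ne_zero hm hn), map_mul, smul_mul_smul_comm]
    congr 1
    push_cast
    rw [one_div_mul_one_div]
  have h := ArithmeticFunction.IsMultiplicative.prodPrimeFactors_one_sub_of_squarefree f hmul
    (squarefree_prod_primes hP)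
  rw [Nat.primeFactors_prod hP] at h
  rw [Finset.prod_congr rfl fun p hp => by rw [← hfa p (hP p hp).ne_zero], h]
  refine Finset.sum_congr rfl fun d hd => ?_
  rw [hfa d (Nat.pos_of_mem_divisors hd).ne', mul_smul_comm, ← zsmul_eq_mul, ← Int.cast_smul_eq_zsmul ℝ,
    smul_smul]
  congr 1
  ring

/-- The primes `p` with `w < p ≤ R`. -/
noncomputable def sievePrimes (w R : ℝ) : Finset ℕ :=
  {p ∈ Finset.Icc 1 ⌊R⌋₊ | p.Prime ∧ ⌊w⌋₊ < p}

theorem prime_of_mem_sievePrimes {w R : ℝ} : ∀ p ∈ sievePrimes w R, p.Prime :=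
  fun _ hp => (Finset.mem_filter.mp hp).2.1

theorem coprime_primeProduct_of_prime {w : ℝ} {p : ℕ} (hp : p.Prime) :
    p.Coprime (primeProduct w) ↔ ⌊w⌋₊ < p := by
  rw [Nat.Prime.coprime_iff_not_dvd hp]
  constructor
  · intro h
    by_contra hle
    refine h (Finset.dvd_prod_of_mem (fun p => p) ?_)
    simp only [Finset.mem_filter, Finset.mem_range]
    exact ⟨by omega, hp⟩
  · intro h
    refine not_dvd_prod_primes (fun q hq => (Finset.mem_filter.mp hq).2) hp ?_
    simp only [Finset.mem_filter, Finset.mem_range, not_and]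
    omega

theorem coprime_of_dvd_prod_sievePrimes {w R : ℝ} {d : ℕ} (hd : d ∣ ∏ p ∈ sievePrimes w R, p) :
    d.Coprime (primeProduct w) := by
  refine Nat.Coprime.coprime_dvd_left hd (Nat.Coprime.prod_left fun p hp => ?_)
  exact (coprime_primeProduct_of_prime (prime_of_mem_sievePrimes p hp)).mpr
    (Finset.mem_filter.mp hp).2.2

theorem dvd_prod_sievePrimes {w R : ℝ} {n : ℕ} (hn : n ≤ ⌊R⌋₊) (hsq : Squarefree n)
    (hc : n.Coprime (primeProduct w)) : n ∣ ∏ p ∈ sievePrimes w R, p := by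
  rw [← Nat.prod_primeFactors_of_squarefree hsq]
  refine Finset.prod_dvd_prod_of_subset _ _ _ fun p hp => ?_
  have hp' := Nat.mem_primeFactors.mp hp
  simp only [sievePrimes, Finset.mem_filter, Finset.mem_Icc]
  refine ⟨⟨hp'.1.one_le, (Nat.le_of_dvd (Nat.pos_of_ne_zero hp'.2.2) hp'.2.1).trans hn⟩, hp'.1, ?_⟩
  exact (coprime_primeProduct_of_prime hp'.1).mp (Nat.Coprime.coprime_dvd_left hp'.2.1 hc)

theorem sum_divisors_eq_mobiusLogSum {w R : ℝ} (hR : 0 ≤ R) (c : ℕ) :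
    ∑ d ∈ (∏ p ∈ sievePrimes w R, p).divisors,
      (ArithmeticFunction.moebius d : ℝ) / d * Real.posLog (R / (d * c : ℕ)) =
      mobiusLogSum (primeProduct w) (R / c) := by
  rw [mobiusLogSum_eq_sum (by positivity) (∏ p ∈ sievePrimes w R, p).divisors]
  · refine Finset.sum_congr rfl fun d _ => ?_
    rw [div_div]
    push_cast
    rw [mul_comm (d : ℝ)]
  · intro n hn
    exact ⟨Nat.pos_of_mem_divisors hn,
      coprime_of_dvd_prod_sievePrimes (Nat.dvd_of_mem_divisors hn)⟩
  · intro n _ hn hc hsq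
    rw [Nat.mem_divisors]
    refine ⟨dvd_prod_sievePrimes (hn.trans ?_) hsq hc,
      (Finset.prod_pos fun p hp => (prime_of_mem_sievePrimes p hp).pos).ne'⟩
    rw [Nat.floor_div_natCast]
    exact Nat.div_le_self _ _

section EulerProduct

variable {I : Type*} [Fintype I] [DecidableEq I]

/-- The two series are formally inverse to each other. Truncating them at `R` is harmless because
`logWeight` vanishes once a coordinate exceeds `R`. -/
theorem dilationAct_sum_mul_sum_pairMonomial_logWeight {w R : ℝ} (hR : 1 ≤ R) (i : I) :
    dilationAct ((∑ d ∈ (∏ p ∈ sievePrimes w R, p).divisors,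
        ((ArithmeticFunction.moebius d : ℝ) / d) • pairMonomial i d) *
      ∑ g ∈ Finset.Icc 1 ⌊R⌋₊ with g.Coprime (primeProduct w), (1 / (g : ℝ)) • pairMonomial i g)
      (logWeight (I × Bool) R) = logWeight (I × Bool) R := by
  classical
  have hR0 : 0 ≤ R := by linarith
  set N := ⌊R⌋₊ with hN
  have hN1 : 1 ≤ N := (Nat.one_le_floor_iff R).mpr hR
  set Q := ∏ p ∈ sievePrimes w R, p with hQ
  set W := primeProduct w with hW
  have hQ0 : Q ≠ 0 := (Finset.prod_pos fun p hp => (prime_of_mem_sievePrimes p hp).pos).ne'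
  ext e
  set F : ℕ → ℝ := fun n => logWeight (I × Bool) R
    (Pi.mulSingle (i, false) n * Pi.mulSingle (i, true) n * e) with hF
  have hF1 : F 1 = logWeight (I × Bool) R e := by simp [hF]
  have hFN : ∀ n, N < n → F n = 0 := by
    intro n hn
    simp only [hF, logWeight_apply]
    refine Finset.prod_eq_zero (Finset.mem_univ (i, false)) ?_
    rcases Nat.eq_zero_or_pos (e (i, false)) with h | h
    · simp [h]
    · refine posLog_div_eq_zero hR0 ?_
      simpa using lt_of_lt_of_le hn (Nat.le_mul_of_pos_right n h)
  set f : ℕ → ℝ := fun n => if n.Coprime W then 1 / (n : ℝ) * F n else 0 with hf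
  have hfN : ∀ n, N < n → f n = 0 := by
    intro n hn
    simp [hf, hFN n hn]
  have hmain := sum_moebius_mul_sum hN1 hfN
  have hf1 : f 1 = logWeight (I × Bool) R e := by simp [hf, hF1]
  rw [hf1] at hmain
  rw [← hmain, Finset.sum_mul]
  simp_rw [Finset.mul_sum, smul_mul_smul_comm, ← map_mul, pairMonomial_eq_of]
  rw [map_sum, _root_.sum_apply, BoundedContinuousFunction.sum_apply]
  have hterm : ∀ d, dilationAct (∑ g ∈ Finset.Icc 1 N with g.Coprime W,
      ((ArithmeticFunction.moebius d : ℝ) / d * (1 / (g : ℝ))) •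
      MonoidAlgebra.of ℝ (I × Bool → ℕ) (Pi.mulSingle (i, false) (d * g) *
        Pi.mulSingle (i, true) (d * g))) (logWeight (I × Bool) R) e =
      ∑ g ∈ Finset.Icc 1 N with g.Coprime W,
        (ArithmeticFunction.moebius d : ℝ) * (1 / ((d * g : ℕ) : ℝ) * F (d * g)) := by
    intro d
    rw [dilationAct_sum_apply]
    refine Finset.sum_congr rfl fun g _ => ?_
    simp only [hF]
    push_cast
    rw [← mul_assoc]
    congr 1
    field_simp
  simp_rw [hterm]
  have hinner : ∀ d ∈ Q.divisors, ∑ g ∈ Finset.Icc 1 N with g.Coprime W,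
      (ArithmeticFunction.moebius d : ℝ) * (1 / ((d * g : ℕ) : ℝ) * F (d * g)) =
      ∑ g ∈ Finset.Icc 1 N, (ArithmeticFunction.moebius d : ℝ) * f (d * g) := by
    intro d hd
    have hdW := coprime_of_dvd_prod_sievePrimes (Nat.dvd_of_mem_divisors hd)
    rw [Finset.sum_filter]
    refine Finset.sum_congr rfl fun g _ => ?_
    have hiff : (d * g).Coprime W ↔ g.Coprime W := by
      rw [Nat.coprime_mul_iff_left]
      exact and_iff_right hdW
    simp only [hf, hiff, mul_ite, mul_zero]
  rw [Finset.sum_congr rfl hinner]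
  have h1 : ∑ d ∈ Q.divisors ∩ Finset.Icc 1 N, ∑ g ∈ Finset.Icc 1 N,
      (ArithmeticFunction.moebius d : ℝ) * f (d * g) = ∑ d ∈ Q.divisors, ∑ g ∈ Finset.Icc 1 N,
      (ArithmeticFunction.moebius d : ℝ) * f (d * g) := by
    refine Finset.sum_subset Finset.inter_subset_left fun d hd hd' => ?_
    refine Finset.sum_eq_zero fun g hg => ?_
    have hdN : N < d := by
      by_contra h
      exact hd' (Finset.mem_inter.mpr ⟨hd, Finset.mem_Icc.mpr
        ⟨Nat.pos_of_mem_divisors hd, not_lt.mp h⟩⟩)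
    rw [hfN _ (hdN.trans_le (Nat.le_mul_of_pos_right d (Finset.mem_Icc.mp hg).1)), mul_zero]
  have h2 : ∑ d ∈ Q.divisors ∩ Finset.Icc 1 N, ∑ g ∈ Finset.Icc 1 N,
      (ArithmeticFunction.moebius d : ℝ) * f (d * g) = ∑ d ∈ Finset.Icc 1 N, ∑ g ∈ Finset.Icc 1 N,
      (ArithmeticFunction.moebius d : ℝ) * f (d * g) := by
    refine Finset.sum_subset Finset.inter_subset_right fun d hd hd' => ?_
    refine Finset.sum_eq_zero fun g hg => ?_
    by_cases hsq : Squarefree d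
    · by_cases hc : d.Coprime W
      · refine absurd (Finset.mem_inter.mpr ⟨?_, hd⟩) hd'
        exact Nat.mem_divisors.mpr ⟨dvd_prod_sievePrimes (Finset.mem_Icc.mp hd).2 hsq hc, hQ0⟩
      · rw [show f (d * g) = 0 from if_neg fun h => hc (Nat.Coprime.coprime_mul_right h), mul_zero]
    · rw [ArithmeticFunction.moebius_eq_zero_of_not_squarefree hsq]
      simp
  rw [← h1, h2]

theorem prod_prod_one_sub_pairMonomial (w R : ℝ) :
    ∏ p ∈ sievePrimes w R, ∏ i : I, (1 - (1 / (p : ℝ)) • pairMonomial i p) =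
      ∏ i : I, ∑ d ∈ (∏ p ∈ sievePrimes w R, p).divisors,
        ((ArithmeticFunction.moebius d : ℝ) / d) • pairMonomial i d := by
  rw [Finset.prod_comm]
  exact Finset.prod_congr rfl fun i _ =>
    prod_one_sub_smul_eq_sum prime_of_mem_sievePrimes (pairMonomial i)

theorem prod_prod_one_sub_coordMonomial {ι : Type*} [Fintype ι] [DecidableEq ι] (w R : ℝ) :
    ∏ p ∈ sievePrimes w R, ∏ j : ι, (1 - (1 / (p : ℝ)) • coordMonomial j p) =
      ∏ j : ι, ∑ d ∈ (∏ p ∈ sievePrimes w R, p).divisors,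
        ((ArithmeticFunction.moebius d : ℝ) / d) • coordMonomial j d := by
  rw [Finset.prod_comm]
  exact Finset.prod_congr rfl fun i _ =>
    prod_one_sub_smul_eq_sum prime_of_mem_sievePrimes (coordMonomial i)

theorem dilationAct_comm_apply {ι : Type*} [Fintype ι] (a b : MonoidAlgebra ℝ (ι → ℕ))
    (F : BoundedContinuousFunction (ι → ℕ) ℝ) :
    dilationAct a (dilationAct b F) = dilationAct b (dilationAct a F) := by
  rw [← mul_apply_eq_comp, ← map_mul, mul_comm a b, map_mul, mul_apply_eq_comp]

/-- The function `e ↦ ∏ i, bilinearSieveSum W R (e (i, false)) (e (i, true))`, as the image of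
`logWeight` under the dilation action. -/
theorem dilationAct_model_apply {w R : ℝ} (hR : 1 ≤ R) (e : I × Bool → ℕ) :
    dilationAct (∏ p ∈ sievePrimes w R, ∏ j : I × Bool, (1 - (1 / (p : ℝ)) • coordMonomial j p))
      (dilationAct (∏ i : I, ∑ g ∈ Finset.Icc 1 ⌊R⌋₊ with g.Coprime (primeProduct w),
        (1 / (g : ℝ)) • pairMonomial i g) (logWeight (I × Bool) R)) e =
      ∏ i, bilinearSieveSum (primeProduct w) R (e (i, false)) (e (i, true)) := by
  rw [dilationAct_comm_apply, prod_sum_pairMonomial, dilationAct_sum_apply,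
    prod_prod_one_sub_coordMonomial]
  simp_rw [bilinearSieveSum]
  conv_rhs => rw [Finset.prod_univ_sum]
  refine Finset.sum_congr rfl fun g _ => ?_
  rw [dilationAct_prod_logWeight, Fintype.prod_prod_type, ← Finset.prod_mul_distrib]
  refine Finset.prod_congr rfl fun i _ => ?_
  rw [Fintype.prod_bool]
  simp only [Pi.mul_apply]
  rw [sum_divisors_eq_mobiusLogSum (by linarith), sum_divisors_eq_mobiusLogSum (by linarith)]
  ring

/-- This exhibits `logWeight` as an image of the correcting factors `1 - x y / p`, which supplies
the factors by which the local factors must be multiplied before comparison with the model. -/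
theorem dilationAct_prod_pairMonomial_logWeight {w R : ℝ} (hR : 1 ≤ R) :
    dilationAct (∏ p ∈ sievePrimes w R, ∏ i : I, (1 - (1 / (p : ℝ)) • pairMonomial i p))
      (dilationAct (∏ i : I, ∑ g ∈ Finset.Icc 1 ⌊R⌋₊ with g.Coprime (primeProduct w),
        (1 / (g : ℝ)) • pairMonomial i g) (logWeight (I × Bool) R)) = logWeight (I × Bool) R := by
  rw [← mul_apply_eq_comp, ← map_mul, prod_prod_one_sub_pairMonomial,
    ← Finset.prod_mul_distrib]
  have key : ∀ s : Finset I, dilationAct (∏ i ∈ s,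
      ((∑ d ∈ (∏ p ∈ sievePrimes w R, p).divisors,
        ((ArithmeticFunction.moebius d : ℝ) / d) • pairMonomial i d) *
      ∑ g ∈ Finset.Icc 1 ⌊R⌋₊ with g.Coprime (primeProduct w),
        (1 / (g : ℝ)) • pairMonomial i g)) (logWeight (I × Bool) R) = logWeight (I × Bool) R := by
    intro s
    induction s using Finset.induction_on with
    | empty => simp
    | insert i s hi ih =>
      rw [Finset.prod_insert hi, map_mul, mul_apply_eq_comp, ih,
        dilationAct_sum_mul_sum_pairMonomial_logWeight hR]
  exact key Finset.univ

/-- If the local factors `a p` are close to those of the model, the Euler product of the `a p` acts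
on `logWeight` almost as the model does. -/
theorem abs_dilationAct_prod_sub_le {w R : ℝ} (hR : 1 ≤ R) (a : ℕ → MonoidAlgebra ℝ (I × Bool → ℕ))
    {K C : ℝ}
    (ha : ∀ p ∈ sievePrimes w R, ‖dilationAct (a p * ∏ i : I, (1 - (1 / (p : ℝ)) • pairMonomial i p)
      - ∏ j : I × Bool, (1 - (1 / (p : ℝ)) • coordMonomial j p))‖ ≤ K * (1 / (p : ℝ)) ^ 2)
    (hC : ∀ c d : ℕ, |bilinearSieveSum (primeProduct w) R c d| ≤ C) :
    |dilationAct (∏ p ∈ sievePrimes w R, a p) (logWeight (I × Bool) R) 1 -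
      bilinearSieveSum (primeProduct w) R 1 1 ^ Fintype.card I| ≤
      (∏ p ∈ sievePrimes w R, (1 + K * 4 ^ Fintype.card I * (1 / (p : ℝ)) ^ 2) - 1) *
        C ^ Fintype.card I := by
  -- There are `2 * |I|` factors, each with an inverse of norm at most `2`; hence `4 ^ |I|`.
  have hinv : ∀ p ∈ sievePrimes w R, ∃ v, v * dilationAct
      (∏ j : I × Bool, (1 - (1 / (p : ℝ)) • coordMonomial j p)) = 1 ∧
      ‖v‖ ≤ 4 ^ Fintype.card I := by
    intro p hp
    have hp2 : (2 : ℝ) ≤ p := by exact_mod_cast (prime_of_mem_sievePrimes p hp).two_le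
    obtain ⟨v, hv1, hv2⟩ := exists_left_inverse_prod_one_sub (c := 1 / (p : ℝ))
      (B := BoundedContinuousFunction (I × Bool → ℕ) ℝ →L[ℝ] BoundedContinuousFunction (I × Bool → ℕ) ℝ)
      (dilationAct (ι := I × Bool))
      norm_one_dilation_le Finset.univ (fun j : I × Bool => coordMonomial j p)
      (fun j _ => norm_dilationAct_coordMonomial_le j p) (by positivity)
      (one_div_le_one_div_of_le two_pos hp2)
    refine ⟨v, hv1, hv2.trans_eq ?_⟩
    rw [Finset.card_univ, Fintype.card_prod, Fintype.card_bool, mul_comm, pow_mul]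
    norm_num
  choose! v hv1 hv2 using hinv
  obtain ⟨H, hH1, hH2⟩ := exists_mul_eq_mul_prod dilationAct (sievePrimes w R) a
    (fun p => ∏ i : I, (1 - (1 / (p : ℝ)) • pairMonomial i p))
    (fun p => ∏ j : I × Bool, (1 - (1 / (p : ℝ)) • coordMonomial j p)) v
    (fun p => K * 4 ^ Fintype.card I * (1 / (p : ℝ)) ^ 2) hv1 (by
      intro p hp
      have hK : 0 ≤ K * (1 / (p : ℝ)) ^ 2 := by
        refine le_trans ?_ (ha p hp)
        exact ContinuousLinearMap.opNorm_nonneg _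
      calc _ ≤ K * (1 / (p : ℝ)) ^ 2 * 4 ^ Fintype.card I :=
            mul_le_mul (ha p hp) (hv2 p hp) (ContinuousLinearMap.opNorm_nonneg _) hK
        _ = _ := by ring)
  set N := dilationAct (∏ i : I, ∑ g ∈ Finset.Icc 1 ⌊R⌋₊ with g.Coprime (primeProduct w),
        (1 / (g : ℝ)) • pairMonomial i g) (logWeight (I × Bool) R) with hN
  set G := dilationAct (∏ p ∈ sievePrimes w R, ∏ j : I × Bool,
    (1 - (1 / (p : ℝ)) • coordMonomial j p)) N with hG
  have hGe : ∀ e, G e = ∏ i : I,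
      bilinearSieveSum (primeProduct w) R (e (i, false)) (e (i, true)) :=
    fun e => dilationAct_model_apply hR e
  have hLN := dilationAct_prod_pairMonomial_logWeight (I := I) (w := w) hR
  have hC0 : 0 ≤ C := (abs_nonneg _).trans (hC 0 0)
  have hGn : ‖G‖ ≤ C ^ Fintype.card I := by
    refine (BoundedContinuousFunction.norm_le (by positivity)).mpr fun e => ?_
    rw [hGe, Real.norm_eq_abs, Finset.abs_prod, ← Finset.card_univ]
    refine (Finset.prod_le_prod (fun _ _ => abs_nonneg _) fun i _ => hC _ _).trans_eq ?_
    rw [Finset.prod_const]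
  -- With `D` the correcting product and `m` the model product, `logWeight = D N`, so `a logWeight =
  -- a D N = H m N = H G`, and `H` is close to the identity.
  have hmain : dilationAct (∏ p ∈ sievePrimes w R, a p) (logWeight (I × Bool) R) = H G := by
    rw [hG, ← mul_apply_eq_comp, ← hH1, mul_apply_eq_comp, hN, hLN]
  have hG1 : G 1 = bilinearSieveSum (primeProduct w) R 1 1 ^ Fintype.card I := by
    rw [hGe]; simp
  rw [hmain, ← hG1]
  calc |H G 1 - G 1| = ‖((H - 1) G) 1‖ := rfl
    _ ≤ ‖(H - 1) G‖ := BoundedContinuousFunction.norm_coe_le_norm _ _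
    _ ≤ ‖H - 1‖ * ‖G‖ := ContinuousLinearMap.le_opNorm _ _
    _ ≤ _ := mul_le_mul hH2 hGn (norm_nonneg _) (by
        refine le_trans ?_ hH2
        exact ContinuousLinearMap.opNorm_nonneg _)

end EulerProduct

/-! ### Linear forms over finite fields -/

theorem card_fiber_mul_card_of_surjective {G M : Type*} [AddGroup G] [Fintype G] [AddMonoid M]
    [Fintype M] [DecidableEq M] (f : G →+ M) (hf : Function.Surjective f) (y : M) :
    (Finset.univ.filter fun g => f g = y).card * Fintype.card M = Fintype.card G := by
  have h : ∀ x : M, (Finset.univ.filter fun g => f g = x).card =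
      (Finset.univ.filter fun g => f g = y).card := fun x =>
    AddMonoidHom.card_fiber_eq_of_mem_range f (hf x) (hf y)
  have h2 := Finset.card_eq_sum_card_fiberwise (f := f) (s := Finset.univ) (t := Finset.univ)
    (fun _ _ => Finset.mem_univ _)
  rw [Finset.card_univ] at h2
  rw [h2, Finset.sum_congr rfl fun x _ => h x, Finset.sum_const, Finset.card_univ, smul_eq_mul,
    mul_comm]

section Field

set_option linter.unusedSectionVars false

variable {F : Type*} [Field F] [Fintype F] [DecidableEq F] {t : ℕ}

/-- The linear functional with coefficients `a`, as an additive homomorphism. -/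
def linearForm (a : Fin t → F) : (Fin t → F) →+ F where
  toFun z := ∑ j, a j * z j
  map_zero' := by simp
  map_add' x y := by simp [mul_add, Finset.sum_add_distrib]

theorem linearForm_apply (a : Fin t → F) (z : Fin t → F) : linearForm a z = ∑ j, a j * z j := rfl

theorem linearForm_single (a : Fin t → F) (j : Fin t) (x : F) :
    linearForm a (Pi.single j x) = a j * x := by
  rw [linearForm_apply, Finset.sum_eq_single j]
  · rw [Pi.single_eq_same]
  · intro i _ hi
    rw [Pi.single_eq_of_ne hi, mul_zero]
  · simp

theorem linearForm_surjective {a : Fin t → F} (ha : a ≠ 0) :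
    Function.Surjective (linearForm a) := by
  obtain ⟨j, hj⟩ := Function.ne_iff.mp ha
  intro y
  refine ⟨Pi.single j (y / a j), ?_⟩
  rw [linearForm_single, mul_div_cancel₀ _ hj]

theorem linearForm_prod_surjective {a b : Fin t → F} {i j : Fin t}
    (h : a i * b j ≠ a j * b i) :
    Function.Surjective ((linearForm a).prod (linearForm b)) := by
  rintro ⟨u, v⟩
  have hD : a i * b j - a j * b i ≠ 0 := sub_ne_zero.mpr h
  -- Cramer's rule in the coordinates `i` and `j`.
  refine ⟨Pi.single i ((u * b j - a j * v) / (a i * b j - a j * b i)) +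
    Pi.single j ((a i * v - u * b i) / (a i * b j - a j * b i)), ?_⟩
  rw [map_add, AddMonoidHom.prod_apply, AddMonoidHom.prod_apply, linearForm_single,
    linearForm_single, linearForm_single, linearForm_single]
  ext
  · simp only [Prod.mk_add_mk]
    rw [mul_div_assoc', mul_div_assoc', ← add_div, div_eq_iff hD]
    ring
  · simp only [Prod.mk_add_mk]
    rw [mul_div_assoc', mul_div_assoc', ← add_div, div_eq_iff hD]
    ring

theorem card_linearForm_eq {a : Fin t → F} (ha : a ≠ 0) (y : F) :
    ((Finset.univ.filter fun z : Fin t → F => linearForm a z = y).card : ℝ) =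
      1 / (Fintype.card F : ℝ) * Fintype.card (Fin t → F) := by
  have h := card_fiber_mul_card_of_surjective _ (linearForm_surjective ha) y
  have hF : (Fintype.card F : ℝ) ≠ 0 := by exact_mod_cast Fintype.card_ne_zero
  rw [← h]
  push_cast
  field_simp

theorem card_linearForm_and_eq {a b : Fin t → F} {i j : Fin t} (h : a i * b j ≠ a j * b i)
    (u v : F) :
    ((Finset.univ.filter fun z : Fin t → F => linearForm a z = u ∧ linearForm b z = v).card : ℝ) =
      (1 / (Fintype.card F : ℝ)) ^ 2 * Fintype.card (Fin t → F) := by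
  have h := card_fiber_mul_card_of_surjective _ (linearForm_prod_surjective h) (u, v)
  have hF : (Fintype.card F : ℝ) ≠ 0 := by exact_mod_cast Fintype.card_ne_zero
  simp only [AddMonoidHom.prod_apply, Prod.mk.injEq, Fintype.card_prod] at h
  rw [← h]
  push_cast
  field_simp

end Field

/-! ### Averages of periodic functions over boxes -/

/-- The points of `ℕ^t` with all coordinates less than `H`. -/
def box (t H : ℕ) : Finset (Fin t → ℕ) := Fintype.piFinset fun _ => Finset.range H

theorem mem_box {t H : ℕ} {z : Fin t → ℕ} : z ∈ box t H ↔ ∀ j, z j < H := by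
  simp [box]

theorem card_box (t H : ℕ) : (box t H).card = H ^ t := by
  simp [box]

/-- The Chinese remainder theorem for sums over boxes. -/
theorem sum_box_prod {A : Type*} [CommSemiring A] {κ : Type*} [Fintype κ] [DecidableEq κ]
    (q : κ → ℕ) [∀ k, NeZero (q k)] (hq : Pairwise (Function.onFun Nat.Coprime q)) {t : ℕ}
    (Φ : ∀ k, (Fin t → ZMod (q k)) → A) :
    ∑ z ∈ box t (∏ k, q k), ∏ k, Φ k (fun j => (z j : ZMod (q k))) =
      ∏ k, ∑ y : Fin t → ZMod (q k), Φ k y := by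
  classical
  have hQ : NeZero (∏ k, q k) := ⟨Finset.prod_ne_zero_iff.mpr fun k _ => NeZero.ne _⟩
  rw [Finset.prod_univ_sum, Fintype.piFinset_univ]
  set e := ZMod.prodEquivPi q hq with he
  refine Finset.sum_nbij' (fun z k j => (z j : ZMod (q k)))
    (fun y j => (e.symm fun k => y k j).val) ?_ ?_ ?_ ?_ ?_
  · exact fun _ _ => Finset.mem_univ _
  · exact fun y _ => mem_box.mpr fun j => ZMod.val_lt _
  · intro z hz
    ext j
    have : e.symm (fun k => (z j : ZMod (q k))) = (z j : ZMod (∏ k, q k)) := by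
      rw [RingEquiv.symm_apply_eq, map_natCast]
      rfl
    simp only [this]
    exact ZMod.val_natCast_of_lt (mem_box.mp hz j)
  · intro y _
    ext k j
    have h1 : e (((e.symm fun k => y k j).val : ℕ) : ZMod (∏ k, q k)) = fun k => y k j := by
      rw [ZMod.natCast_zmod_val, RingEquiv.apply_symm_apply]
    rw [map_natCast] at h1
    exact congrFun h1 k
  · exact fun _ _ => rfl

theorem sum_box_eq_sum_mul_prod_count {t H D : ℕ} (hD : 0 < D) (f : (Fin t → ℕ) → ℝ)
    (hf : ∀ z, f z = f fun j => z j % D) :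
    ∑ z ∈ box t H, f z = ∑ r ∈ box t D, f r *
      ∏ j, ((H.count (fun n => n ≡ r j [MOD D]) : ℕ) : ℝ) := by
  classical
  have hmaps : ∀ z ∈ box t H, (fun j => z j % D) ∈ box t D :=
    fun z _ => mem_box.mpr fun j => Nat.mod_lt _ hD
  rw [← Finset.sum_fiberwise_of_maps_to hmaps]
  refine Finset.sum_congr rfl fun r hr => ?_
  have h1 : ∀ z ∈ {z ∈ box t H | (fun j => z j % D) = r}, f z = f r := by
    intro z hz
    rw [hf z, (Finset.mem_filter.mp hz).2]
  rw [Finset.sum_congr rfl h1, Finset.sum_const, nsmul_eq_mul, mul_comm]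
  congr 1
  have h2 : {z ∈ box t H | (fun j => z j % D) = r} =
      Fintype.piFinset fun j => {n ∈ Finset.range H | n ≡ r j [MOD D]} := by
    ext z
    simp only [Finset.mem_filter, mem_box, Fintype.mem_piFinset, Finset.mem_range, funext_iff]
    have hrj : ∀ j, r j % D = r j := fun j => Nat.mod_eq_of_lt (mem_box.mp hr j)
    constructor
    · rintro ⟨h3, h4⟩ j
      exact ⟨h3 j, by rw [Nat.ModEq, hrj, h4 j]⟩
    · intro h
      exact ⟨fun j => (h j).1, fun j => by have := (h j).2; rwa [Nat.ModEq, hrj] at this⟩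
  rw [h2, Fintype.card_piFinset]
  push_cast
  simp_rw [Nat.count_eq_card_filter_range]

/-- The average of a periodic function over a box is close to its average over a full period. -/
theorem abs_average_box_sub_le {t H D Q : ℕ} (hH : 0 < H) (hQ : 0 < Q) (hDQ : D ∣ Q)
    (f : (Fin t → ℕ) → ℝ) (hf : ∀ z, f z = f fun j => z j % D) (hf1 : ∀ z, |f z| ≤ 1) :
    |1 / (H : ℝ) ^ t * ∑ z ∈ box t H, f z - 1 / (Q : ℝ) ^ t * ∑ z ∈ box t Q, f z| ≤
      Real.exp (t * (D / H)) - 1 := by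
  have hD : 0 < D := Nat.pos_of_dvd_of_pos hDQ hQ
  have hDr : (0 : ℝ) < D := by exact_mod_cast hD
  have hHr : (0 : ℝ) < H := by exact_mod_cast hH
  have hQr : (0 : ℝ) < Q := by exact_mod_cast hQ
  have hcountQ : ∀ v : ℕ, ((Q.count (fun n => n ≡ v [MOD D]) : ℕ) : ℝ) = Q / D := by
    intro v
    rw [Nat.count_modEq_card Q hD, Nat.mod_eq_zero_of_dvd hDQ]
    simp only [not_lt_zero, if_false, add_zero]
    exact Nat.cast_div hDQ hDr.ne'
  -- A residue class modulo `D` has `H / D + O(1)` members below `H`, so each coordinate contributes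
  -- a factor `1 + O(D / H)`.
  have hcountH : ∀ v : ℕ, |((H.count (fun n => n ≡ v [MOD D]) : ℕ) : ℝ) * (D / H) - 1| ≤ D / H := by
    intro v
    rw [Nat.count_modEq_card H hD]
    have h1 : (((H / D + if v % D < H % D then 1 else 0 : ℕ)) : ℝ) * D ≤ H + D := by
      have : (H / D + if v % D < H % D then 1 else 0) * D ≤ H + D := by
        have := Nat.div_mul_le_self H D
        rw [add_mul]
        split_ifs <;> omega
      exact_mod_cast this
    have h2 : (H : ℝ) ≤ (((H / D + if v % D < H % D then 1 else 0 : ℕ)) : ℝ) * D + D := by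
      have : H ≤ (H / D + if v % D < H % D then 1 else 0) * D + D := by
        have := Nat.div_add_mod H D
        have := Nat.mod_lt H hD
        rw [add_mul, mul_comm (H / D)]
        omega
      exact_mod_cast this
    set c : ℝ := (((H / D + if v % D < H % D then 1 else 0 : ℕ)) : ℝ) with hc
    rw [show c * (D / H) - 1 = (c * D - H) / H by field_simp, abs_div, abs_of_pos hHr,
      div_le_div_iff_of_pos_right hHr, abs_le]
    constructor <;> linarith
  have hQsum : 1 / (Q : ℝ) ^ t * ∑ z ∈ box t Q, f z = ∑ r ∈ box t D, 1 / (D : ℝ) ^ t * f r := by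
    rw [sum_box_eq_sum_mul_prod_count hD f hf, Finset.mul_sum]
    refine Finset.sum_congr rfl fun r _ => ?_
    simp_rw [hcountQ]
    rw [Finset.prod_const, Finset.card_univ, Fintype.card_fin, div_pow]
    field_simp
  have hHsum : 1 / (H : ℝ) ^ t * ∑ z ∈ box t H, f z = ∑ r ∈ box t D, 1 / (D : ℝ) ^ t *
      (f r * ∏ j, (1 + (((H.count (fun n => n ≡ r j [MOD D]) : ℕ) : ℝ) * (D / H) - 1))) := by
    rw [sum_box_eq_sum_mul_prod_count hD f hf, Finset.mul_sum]
    refine Finset.sum_congr rfl fun r _ => ?_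
    have : ∏ j : Fin t, (1 + (((H.count (fun n => n ≡ r j [MOD D]) : ℕ) : ℝ) * (D / H) - 1)) =
        (∏ j : Fin t, ((H.count (fun n => n ≡ r j [MOD D]) : ℕ) : ℝ)) * ((D : ℝ) / H) ^ t := by
      simp_rw [add_sub_cancel]
      rw [Finset.prod_mul_distrib, Finset.prod_const, Finset.card_univ, Fintype.card_fin]
    rw [this, div_pow]
    field_simp
  rw [hQsum, hHsum, ← Finset.sum_sub_distrib]
  refine (Finset.abs_sum_le_sum_abs _ _).trans ?_
  have hterm : ∀ r ∈ box t D, |1 / (D : ℝ) ^ t *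
      (f r * ∏ j, (1 + (((H.count (fun n => n ≡ r j [MOD D]) : ℕ) : ℝ) * (D / H) - 1))) -
      1 / (D : ℝ) ^ t * f r| ≤ 1 / (D : ℝ) ^ t * (Real.exp (t * (D / H)) - 1) := by
    intro r _
    have h1 := Finset.univ.norm_prod_one_add_sub_one_le
      (fun j : Fin t => ((H.count (fun n => n ≡ r j [MOD D]) : ℕ) : ℝ) * ((D : ℝ) / H) - 1)
    have h2 : ∑ j : Fin t, ‖((H.count (fun n => n ≡ r j [MOD D]) : ℕ) : ℝ) * ((D : ℝ) / H) - 1‖ ≤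
        t * (D / H) := by
      refine (Finset.sum_le_sum fun j _ => hcountH (r j)).trans ?_
      simp
    have h3 := h1.trans (sub_le_sub_right (Real.exp_le_exp.mpr h2) 1)
    rw [← mul_sub, ← mul_sub_one, abs_mul, abs_mul,
      abs_of_pos (by positivity : 0 < 1 / (D : ℝ) ^ t)]
    gcongr
    refine (mul_le_mul_of_nonneg_right (hf1 r) (abs_nonneg _)).trans ?_
    rw [one_mul]
    exact h3
  refine (Finset.sum_le_sum hterm).trans ?_
  rw [Finset.sum_const, card_box, nsmul_eq_mul]
  push_cast
  rw [← mul_assoc, mul_one_div_cancel (by positivity), one_mul]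

/-! ### Sieve sums along affine forms -/

/-- The truncated divisor sum restricted to divisors composed of the primes in `(w, R]`. -/
noncomputable def sieveSum (w R : ℝ) (n : ℤ) : ℝ :=
  ∑ d ∈ (∏ p ∈ sievePrimes w R, p).divisors.filter (fun d : ℕ => (d : ℤ) ∣ n),
    (ArithmeticFunction.moebius d : ℝ) * Real.posLog (R / d)

theorem prod_sievePrimes_pos (w R : ℝ) : 0 < ∏ p ∈ sievePrimes w R, p :=
  Finset.prod_pos fun p hp => (prime_of_mem_sievePrimes p hp).pos

/-- A squarefree divisor `d ≤ R` of a number coprime to `W` is composed of primes in `(w, R]`, and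
divisors beyond `R` have `log⁺ (R / d) = 0`. Unlike the original sum, `sieveSum` makes sense at
every integer, so affine forms may take any constant terms. -/
theorem sieveSum_natCast {w R : ℝ} (hR : 0 < R) {n : ℕ} (hn : n ≠ 0)
    (hc : n.Coprime (primeProduct w)) : sieveSum w R n = truncatedDivisorSum R n := by
  rw [sieveSum, truncatedDivisorSum]
  have hlog : ∀ d ∈ n.divisors.filter (fun d : ℕ => (d : ℝ) ≤ R),
      ((ArithmeticFunction.moebius d : ℤ) : ℝ) * Real.log (R / d) =
      (ArithmeticFunction.moebius d : ℝ) * Real.posLog (R / d) := by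
    intro d hd
    have hd' := Finset.mem_filter.mp hd
    have hd0 : (0 : ℝ) < d := by exact_mod_cast Nat.pos_of_mem_divisors hd'.1
    rw [Real.posLog_eq_log]
    rw [abs_of_pos (by positivity)]
    exact (one_le_div hd0).mpr hd'.2
  rw [Finset.sum_congr rfl hlog]
  set A := (∏ p ∈ sievePrimes w R, p).divisors.filter (fun d : ℕ => (d : ℤ) ∣ n)
  set B := n.divisors.filter (fun d : ℕ => (d : ℝ) ≤ R)
  have h1 := Finset.sum_subset (s₁ := A ∩ B) (s₂ := A)
    (f := fun d => (ArithmeticFunction.moebius d : ℝ) * Real.posLog (R / d))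
    Finset.inter_subset_left (by
      intro d hd hd'
      have hdn : d ∣ n := Int.natCast_dvd_natCast.mp (Finset.mem_filter.mp hd).2
      have hdR : R < d := by
        by_contra h
        exact hd' (Finset.mem_inter.mpr ⟨hd, Finset.mem_filter.mpr
          ⟨Nat.mem_divisors.mpr ⟨hdn, hn⟩, not_lt.mp h⟩⟩)
      rw [posLog_div_eq_zero hR.le (by exact_mod_cast (Nat.floor_lt hR.le).mpr hdR), mul_zero])
  have h2 := Finset.sum_subset (s₁ := A ∩ B) (s₂ := B)
    (f := fun d => (ArithmeticFunction.moebius d : ℝ) * Real.posLog (R / d))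
    Finset.inter_subset_right (by
      intro d hd hd'
      have hd1 := Finset.mem_filter.mp hd
      have hdn := Nat.dvd_of_mem_divisors hd1.1
      by_cases hsq : Squarefree d
      · refine absurd (Finset.mem_inter.mpr ⟨Finset.mem_filter.mpr ⟨Nat.mem_divisors.mpr
          ⟨dvd_prod_sievePrimes (Nat.le_floor hd1.2) hsq (Nat.Coprime.coprime_dvd_left hdn hc),
            (prod_sievePrimes_pos w R).ne'⟩, Int.natCast_dvd_natCast.mpr hdn⟩, hd⟩) hd'
      · rw [ArithmeticFunction.moebius_eq_zero_of_not_squarefree hsq]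
        simp)
  rw [← h1, h2]

theorem prod_one_sub_eq_sum {A : Type*} [CommRing A] [Algebra ℝ A] {P : Finset ℕ}
    (hP : ∀ p ∈ P, p.Prime) (X : ℕ →* A) :
    ∏ p ∈ P, (1 - X p) =
      ∑ d ∈ (∏ p ∈ P, p).divisors, (ArithmeticFunction.moebius d : ℝ) • X d := by
  -- Multiplying `X d` by `d` cancels the weights `1 / d` of the weighted expansion.
  let Y : ℕ →* A := 
    { toFun := fun d => (d : ℝ) • X d
      map_one' := by simp
      map_mul' := fun a b => by
        rw [map_mul, smul_mul_smul_comm]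
        push_cast
        rfl }
  have hY : ∀ d, Y d = (d : ℝ) • X d := fun _ => rfl
  have h := prod_one_sub_smul_eq_sum hP Y
  simp_rw [hY, smul_smul] at h
  rw [Finset.prod_congr rfl fun p hp => by
    rw [one_div_mul_cancel (by exact_mod_cast (hP p hp).ne_zero : (p : ℝ) ≠ 0), one_smul]] at h
  rw [h]
  refine Finset.sum_congr rfl fun d hd => ?_
  rw [div_mul_cancel₀ _ (by exact_mod_cast (Nat.pos_of_mem_divisors hd).ne')]

theorem divisors_prod_filter_dvd {P : Finset ℕ} (hP : ∀ p ∈ P, p.Prime) (n : ℤ) :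
    (∏ p ∈ P.filter (fun p : ℕ => (p : ℤ) ∣ n), p).divisors =
      (∏ p ∈ P, p).divisors.filter (fun d : ℕ => (d : ℤ) ∣ n) := by
  have hpos : ∀ P' ⊆ P, ∏ p ∈ P', p ≠ 0 := fun P' h =>
    (Finset.prod_pos fun p hp => (hP p (h hp)).pos).ne'
  ext d
  rw [Finset.mem_filter, Nat.mem_divisors, Nat.mem_divisors]
  constructor
  · rintro ⟨h, -⟩
    refine ⟨⟨h.trans (Finset.prod_dvd_prod_of_subset _ _ _ (Finset.filter_subset _ _)),
      hpos P subset_rfl⟩, (Int.natCast_dvd_natCast.mpr h).trans ?_⟩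
    push_cast
    refine Finset.prod_dvd_of_coprime ?_ fun p hp => (Finset.mem_filter.mp hp).2
    intro p hp r hr hpr
    rw [Function.onFun, Nat.isCoprime_iff_coprime]
    exact (Nat.coprime_primes (hP p (Finset.filter_subset _ _ hp))
      (hP r (Finset.filter_subset _ _ hr))).mpr hpr
  · rintro ⟨⟨h, h0⟩, hn⟩
    refine ⟨?_, hpos _ (Finset.filter_subset _ _)⟩
    have hsq : Squarefree d := (squarefree_prod_primes hP).squarefree_of_dvd h
    rw [← Nat.prod_primeFactors_of_squarefree hsq]
    refine Finset.prod_dvd_prod_of_subset _ _ _ fun p hp => ?_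
    have hp' := Nat.mem_primeFactors.mp hp
    refine Finset.mem_filter.mpr ⟨?_, (Int.natCast_dvd_natCast.mpr hp'.2.1).trans hn⟩
    rw [← Nat.primeFactors_prod hP]
    exact Nat.mem_primeFactors.mpr ⟨hp'.1, hp'.2.1.trans h, h0⟩

section Forms

variable {I : Type*} [Fintype I] [DecidableEq I]

/-- The product of squares of sieve sums as the value of a dilation operator on `logWeight`. -/
theorem prod_sieveSum_sq_eq (w R : ℝ) (n : I → ℤ) :
    ∏ i, sieveSum w R (n i) ^ 2 =
      dilationAct (∏ p ∈ sievePrimes w R, ∏ i with (p : ℤ) ∣ n i,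
        ((1 - coordMonomial (i, false) p) * (1 - coordMonomial (i, true) p)))
        (logWeight (I × Bool) R) 1 := by
  have h1 : ∏ p ∈ sievePrimes w R, ∏ i with (p : ℤ) ∣ n i,
      ((1 - coordMonomial (i, false) p) * (1 - coordMonomial (i, true) p)) =
      ∏ j : I × Bool, ∑ d ∈ (∏ p ∈ sievePrimes w R, p).divisors,
        (if (d : ℤ) ∣ n j.1 then (ArithmeticFunction.moebius d : ℝ) else 0) •
          coordMonomial j d := by
    have h2 : ∀ j : I × Bool, ∑ d ∈ (∏ p ∈ sievePrimes w R, p).divisors,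
        (if (d : ℤ) ∣ n j.1 then (ArithmeticFunction.moebius d : ℝ) else 0) •
          coordMonomial j d =
        ∏ p ∈ sievePrimes w R, if (p : ℤ) ∣ n j.1 then 1 - coordMonomial j p else 1 := by
      intro j
      rw [← Finset.prod_filter, prod_one_sub_eq_sum (fun p hp =>
        prime_of_mem_sievePrimes p (Finset.mem_of_mem_filter p hp)),
        divisors_prod_filter_dvd prime_of_mem_sievePrimes, Finset.sum_filter]
      refine Finset.sum_congr rfl fun d _ => ?_
      split_ifs
      · rfl
      · rw [zero_smul]
    simp_rw [h2]
    rw [Finset.prod_comm]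
    refine Finset.prod_congr rfl fun p _ => ?_
    rw [Finset.prod_filter, Fintype.prod_prod_type]
    refine Finset.prod_congr rfl fun i _ => ?_
    rw [Fintype.prod_bool]
    split_ifs
    · rw [mul_comm]
    · rw [one_mul]
  rw [h1, dilationAct_prod_logWeight, Fintype.prod_prod_type]
  refine Finset.prod_congr rfl fun i _ => ?_
  rw [Fintype.prod_bool, sq]
  simp only [sieveSum, Finset.sum_filter, Pi.one_apply, mul_one, ite_mul, zero_mul]

variable {t : ℕ}

/-- The affine form `∑ j, α j * z j + γ`. -/
def affineForm (α : Fin t → ℤ) (γ : ℤ) (z : Fin t → ℕ) : ℤ := ∑ j, α j * z j + γ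

theorem dvd_affineForm_iff (α : Fin t → ℤ) (γ : ℤ) (z : Fin t → ℕ) (p : ℕ) [NeZero p] :
    (p : ℤ) ∣ affineForm α γ z ↔
      ∑ j, (α j : ZMod p) * (z j : ZMod p) + (γ : ZMod p) = 0 := by
  rw [← ZMod.intCast_zmod_eq_zero_iff_dvd, affineForm]
  push_cast
  rfl

/-- The local factor at `p` of a system of affine forms. -/
noncomputable def affineLocalFactor (α : I → Fin t → ℤ) (γ : I → ℤ) (p : ℕ) :
    MonoidAlgebra ℝ (I × Bool → ℕ) :=
  (1 / (p : ℝ) ^ t) • ∑ y ∈ box t p, ∏ i with (p : ℤ) ∣ affineForm (α i) (γ i) y,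
    ((1 - coordMonomial (i, false) p) * (1 - coordMonomial (i, true) p))

theorem sum_box_eq_sum_zmod {A : Type*} [CommSemiring A] (q : ℕ) [NeZero q]
    (Φ : (Fin t → ZMod q) → A) :
    ∑ z ∈ box t q, Φ (fun j => (z j : ZMod q)) = ∑ y, Φ y := by
  have h := sum_box_prod (κ := Unit) (fun _ => q) (fun i j hij => absurd (Subsingleton.elim i j) hij)
    (fun _ => Φ)
  simpa using h

theorem affineLocalFactor_eq (α : I → Fin t → ℤ) (γ : I → ℤ) (p : ℕ) [NeZero p] :
    affineLocalFactor α γ p = (1 / (p : ℝ) ^ t) • ∑ y : Fin t → ZMod p,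
      ∏ i with ∑ j, (α i j : ZMod p) * y j + (γ i : ZMod p) = 0,
        ((1 - coordMonomial (i, false) p) * (1 - coordMonomial (i, true) p)) := by
  rw [affineLocalFactor, ← sum_box_eq_sum_zmod]
  simp_rw [dvd_affineForm_iff]

/-- The average over a full period factors as an Euler product. -/
theorem average_prod_sieveSum_sq_eq (w R : ℝ) (α : I → Fin t → ℤ) (γ : I → ℤ) :
    1 / ((∏ p ∈ sievePrimes w R, p : ℕ) : ℝ) ^ t * ∑ z ∈ box t (∏ p ∈ sievePrimes w R, p),
      ∏ i, sieveSum w R (affineForm (α i) (γ i) z) ^ 2 =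
      dilationAct (∏ p ∈ sievePrimes w R, affineLocalFactor α γ p)
        (logWeight (I × Bool) R) 1 := by
  classical
  have hne : ∀ p : sievePrimes w R, NeZero p.1 :=
    fun p => ⟨(prime_of_mem_sievePrimes p.1 p.2).ne_zero⟩
  have h1 : ∏ p ∈ sievePrimes w R, affineLocalFactor α γ p =
      (1 / ((∏ p ∈ sievePrimes w R, p : ℕ) : ℝ) ^ t) •
        ∑ z ∈ box t (∏ p ∈ sievePrimes w R, p),
          ∏ p ∈ sievePrimes w R, ∏ i with (p : ℤ) ∣ affineForm (α i) (γ i) z,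
            ((1 - coordMonomial (i, false) p) * (1 - coordMonomial (i, true) p)) := by
    rw [← Finset.prod_coe_sort]
    simp_rw [affineLocalFactor_eq]
    rw [Finset.prod_smul, ← sum_box_prod (fun p : sievePrimes w R => p.1)]
    · congr 1
      · push_cast
        rw [Finset.prod_div_distrib, Finset.prod_const_one, Finset.prod_pow,
          Finset.prod_coe_sort _ (fun p : ℕ => (p : ℝ))]
      · rw [Finset.prod_coe_sort _ (fun p : ℕ => p)]
        refine Finset.sum_congr rfl fun z _ => ?_
        rw [← Finset.prod_coe_sort (sievePrimes w R)]
        simp_rw [dvd_affineForm_iff]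
    · intro p r hpr
      exact (Nat.coprime_primes (prime_of_mem_sievePrimes p.1 p.2)
        (prime_of_mem_sievePrimes r.1 r.2)).mpr fun h => hpr (Subtype.ext h)
  rw [h1, map_smul, map_sum]
  simp_rw [prod_sieveSum_sq_eq]
  rw [_root_.smul_apply, BoundedContinuousFunction.smul_apply, _root_.sum_apply,
    BoundedContinuousFunction.sum_apply, smul_eq_mul]

/-- The forms `α i` are nonzero and pairwise non-proportional modulo `p`. -/
def NondegenerateMod (α : I → Fin t → ℤ) (p : ℕ) : Prop :=
  (∀ i, ∃ j, (α i j : ZMod p) ≠ 0) ∧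
    ∀ i i', i ≠ i' → ∃ j j', (α i j : ZMod p) * α i' j' ≠ (α i j' : ZMod p) * α i' j

/-- Nondegeneracy makes the forms nonzero and pairwise independent over the field with `p` elements,
so the vanishing probabilities are exactly `1 / p` and `1 / p ^ 2`, whatever the constant terms. -/
theorem norm_affineLocalFactor_mul_sub_le (α : I → Fin t → ℤ) (γ : I → ℤ) {p : ℕ} (hp : p.Prime)
    (hα : NondegenerateMod α p) :
    ‖dilationAct (affineLocalFactor α γ p * ∏ i : I, (1 - (1 / (p : ℝ)) • pairMonomial i p)
      - ∏ j : I × Bool, (1 - (1 / (p : ℝ)) • coordMonomial j p))‖ ≤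
      localErrorConst (Fintype.card I) * (1 / (p : ℝ)) ^ 2 := by
  classical
  have : Fact p.Prime := ⟨hp⟩
  have hp1 : (1 : ℝ) ≤ p := by exact_mod_cast hp.one_le
  set S : (Fin t → ZMod p) → Finset I :=
    fun y => {i | ∑ j, (α i j : ZMod p) * y j + (γ i : ZMod p) = 0} with hS
  have hmem : ∀ i y, i ∈ S y ↔ linearForm (fun j => (α i j : ZMod p)) y = -(γ i : ZMod p) := by
    intro i y
    simp only [hS, Finset.mem_filter, Finset.mem_univ, true_and]
    rw [linearForm_apply, eq_neg_iff_add_eq_zero]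
  have h := norm_map_localFactor_mul_sub_le
    (B := BoundedContinuousFunction (I × Bool → ℕ) ℝ →L[ℝ] BoundedContinuousFunction (I × Bool → ℕ) ℝ)
    (dilationAct (ι := I × Bool)) norm_one_dilation_le S (fun j => coordMonomial j p)
    (fun j => norm_dilationAct_coordMonomial_le j p) (c := 1 / (p : ℝ)) (by positivity)
    (by rw [div_le_one (by linarith)]; exact hp1)
    (by
      intro i
      obtain ⟨j, hj⟩ := hα.1 i
      simp_rw [hmem]
      rw [card_linearForm_eq (fun h => hj (congrFun h j)), ZMod.card])
    (by
      intro i i' hii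
      obtain ⟨j, j', hj⟩ := hα.2 i i' hii
      simp_rw [hmem]
      rw [card_linearForm_and_eq (i := j) (j := j') hj, ZMod.card])
  have hloc : affineLocalFactor α γ p = localFactor S (fun j => coordMonomial j p) := by
    rw [affineLocalFactor_eq, localFactor, Fintype.card_fun, ZMod.card, Fintype.card_fin]
    push_cast
    rfl
  rw [hloc]
  exact h

theorem abs_average_period_sub_le {w R : ℝ} (hR : 1 ≤ R) (α : I → Fin t → ℤ) (γ : I → ℤ)
    (hα : ∀ p ∈ sievePrimes w R, NondegenerateMod α p) {C : ℝ}
    (hC : ∀ c d : ℕ, |bilinearSieveSum (primeProduct w) R c d| ≤ C) :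
    |1 / ((∏ p ∈ sievePrimes w R, p : ℕ) : ℝ) ^ t * ∑ z ∈ box t (∏ p ∈ sievePrimes w R, p),
      ∏ i, sieveSum w R (affineForm (α i) (γ i) z) ^ 2 -
      bilinearSieveSum (primeProduct w) R 1 1 ^ Fintype.card I| ≤
      (∏ p ∈ sievePrimes w R, (1 + localErrorConst (Fintype.card I) * 4 ^ Fintype.card I *
        (1 / (p : ℝ)) ^ 2) - 1) * C ^ Fintype.card I := by
  rw [average_prod_sieveSum_sq_eq]
  exact abs_dilationAct_prod_sub_le hR _ (fun p hp =>
    norm_affineLocalFactor_mul_sub_le α γ (prime_of_mem_sievePrimes p hp) (hα p hp)) hC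

end Forms

section Forms

set_option linter.unusedSectionVars false

variable {I : Type*} [Fintype I] [DecidableEq I] {t : ℕ}

theorem dvd_affineForm_mod_iff (α : Fin t → ℤ) (γ : ℤ) (z : Fin t → ℕ) {d D : ℕ} (hd : d ∣ D) :
    (d : ℤ) ∣ affineForm α γ z ↔ (d : ℤ) ∣ affineForm α γ fun j => z j % D := by
  refine dvd_iff_dvd_of_dvd_sub ?_
  rw [affineForm, affineForm, add_sub_add_right_eq_sub, ← Finset.sum_sub_distrib]
  refine Finset.dvd_sum fun j _ => ?_
  rw [← mul_sub]
  refine Dvd.dvd.mul_left ((Int.natCast_dvd_natCast.mpr hd).trans ?_) _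
  push_cast
  exact Int.dvd_self_sub_emod

theorem prod_sieveSum_sq_eq_sum (w R : ℝ) (n : I → ℤ) :
    ∏ i, sieveSum w R (n i) ^ 2 =
      ∑ d ∈ Fintype.piFinset fun _ : I × Bool => (∏ p ∈ sievePrimes w R, p).divisors,
        (∏ j, (ArithmeticFunction.moebius (d j) : ℝ) * Real.posLog (R / d j)) *
          if ∀ j, (d j : ℤ) ∣ n j.1 then 1 else 0 := by
  have h1 : ∏ i, sieveSum w R (n i) ^ 2 = ∏ j : I × Bool, sieveSum w R (n j.1) := by
    rw [Fintype.prod_prod_type]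
    exact Finset.prod_congr rfl fun i _ => by rw [Fintype.prod_bool, sq]
  rw [h1]
  simp only [sieveSum, Finset.sum_filter]
  rw [Finset.prod_univ_sum]
  refine Finset.sum_congr rfl fun d _ => ?_
  by_cases h : ∀ j, (d j : ℤ) ∣ n j.1
  · rw [if_pos h, mul_one]
    exact Finset.prod_congr rfl fun j _ => if_pos (h j)
  · rw [if_neg h, mul_zero]
    obtain ⟨j, hj⟩ := not_forall.mp h
    exact Finset.prod_eq_zero (Finset.mem_univ j) (if_neg hj)

/-- The average over a box of side `H` is close to the average over a full period. -/
theorem abs_average_box_sub_period_le {w R : ℝ} (hR : 1 ≤ R) {H : ℕ} (hH : 0 < H)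
    (α : I → Fin t → ℤ) (γ : I → ℤ) :
    |1 / (H : ℝ) ^ t * ∑ z ∈ box t H, ∏ i, sieveSum w R (affineForm (α i) (γ i) z) ^ 2 -
      1 / ((∏ p ∈ sievePrimes w R, p : ℕ) : ℝ) ^ t * ∑ z ∈ box t (∏ p ∈ sievePrimes w R, p),
        ∏ i, sieveSum w R (affineForm (α i) (γ i) z) ^ 2| ≤
      R ^ (2 * Fintype.card I) * (Real.log R ^ (2 * Fintype.card I) *
        (Real.exp (t * (R ^ (2 * Fintype.card I) / H)) - 1)) := by
  classical
  set Q := ∏ p ∈ sievePrimes w R, p with hQ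
  have hQ0 : 0 < Q := prod_sievePrimes_pos w R
  have hR0 : 0 ≤ R := by linarith
  have hHr : (0 : ℝ) < H := by exact_mod_cast hH
  have hL : 0 ≤ Real.log R := Real.log_nonneg hR
  have hcard : Fintype.card (I × Bool) = 2 * Fintype.card I := by
    rw [Fintype.card_prod, Fintype.card_bool, mul_comm]
  set c : (I × Bool → ℕ) → ℝ :=
    fun d => ∏ j, (ArithmeticFunction.moebius (d j) : ℝ) * Real.posLog (R / d j) with hc
  set f : (I × Bool → ℕ) → (Fin t → ℕ) → ℝ :=
    fun d z => if ∀ j, (d j : ℤ) ∣ affineForm (α j.1) (γ j.1) z then 1 else 0 with hf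
  set E : ℝ := Real.exp (t * (R ^ (2 * Fintype.card I) / H)) - 1 with hE
  have hE0 : 0 ≤ E := by
    rw [hE, sub_nonneg, Real.one_le_exp_iff]
    positivity
  have hexp : ∀ H' : ℕ, 1 / (H' : ℝ) ^ t * ∑ z ∈ box t H',
      ∏ i, sieveSum w R (affineForm (α i) (γ i) z) ^ 2 =
      ∑ d ∈ Fintype.piFinset fun _ : I × Bool => Q.divisors,
        c d * (1 / (H' : ℝ) ^ t * ∑ z ∈ box t H', f d z) := by
    intro H'
    simp_rw [prod_sieveSum_sq_eq_sum]
    rw [Finset.sum_comm, Finset.mul_sum]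
    refine Finset.sum_congr rfl fun d _ => ?_
    rw [← Finset.mul_sum]
    ring
  rw [hexp, hexp, ← Finset.sum_sub_distrib]
  refine (Finset.abs_sum_le_sum_abs _ _).trans ?_
  -- Only tuples with all `d j ≤ R` contribute. For these the divisibility condition is periodic
  -- modulo the lcm, which is at most `R ^ (2 |I|)`, and the coefficient is at most `(log R) ^ (2
  -- |I|)`.
  have hterm : ∀ d ∈ Fintype.piFinset fun _ : I × Bool => Q.divisors,
      |c d * (1 / (H : ℝ) ^ t * ∑ z ∈ box t H, f d z) -
        c d * (1 / (Q : ℝ) ^ t * ∑ z ∈ box t Q, f d z)| ≤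
      if ∀ j, d j ∈ Finset.Icc 1 ⌊R⌋₊ then Real.log R ^ (2 * Fintype.card I) * E else 0 := by
    intro d hd
    have hdj : ∀ j, d j ∈ Q.divisors := Fintype.mem_piFinset.mp hd
    split_ifs with h
    · have hDQ : Finset.univ.lcm d ∣ Q :=
        Finset.lcm_dvd fun j _ => Nat.dvd_of_mem_divisors (hdj j)
      have hdD : ∀ j, d j ∣ Finset.univ.lcm d := fun j => Finset.dvd_lcm (Finset.mem_univ j)
      have hDR : ((Finset.univ.lcm d : ℕ) : ℝ) ≤ R ^ (2 * Fintype.card I) := by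
        have h1 : Finset.univ.lcm d ≤ ∏ j, d j :=
          Nat.le_of_dvd (Finset.prod_pos fun j _ => (Finset.mem_Icc.mp (h j)).1)
            (Finset.lcm_dvd fun j hj => Finset.dvd_prod_of_mem d hj)
        calc ((Finset.univ.lcm d : ℕ) : ℝ) ≤ ((∏ j, d j : ℕ) : ℝ) := by exact_mod_cast h1
          _ = ∏ j, (d j : ℝ) := by push_cast; rfl
          _ ≤ ∏ _j : I × Bool, R := Finset.prod_le_prod (fun _ _ => Nat.cast_nonneg _)
              fun j _ => (Nat.le_floor_iff hR0).mp (Finset.mem_Icc.mp (h j)).2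
          _ = _ := by rw [Finset.prod_const, Finset.card_univ, hcard]
      have h2 := abs_average_box_sub_le hH hQ0 hDQ (f d) (by
        intro z
        simp only [hf]
        congr 1
        refine propext (forall_congr' fun j => ?_)
        exact dvd_affineForm_mod_iff _ _ _ (hdD j)) (by
        intro z
        simp only [hf]
        split_ifs <;> simp)
      have h3 : |c d| ≤ Real.log R ^ (2 * Fintype.card I) := by
        rw [hc, Finset.abs_prod, ← hcard, ← Finset.card_univ]
        refine (Finset.prod_le_prod (fun _ _ => abs_nonneg _) fun j _ => ?_).trans_eq
          (Finset.prod_const _)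
        rw [abs_mul, abs_of_nonneg Real.posLog_nonneg]
        calc _ ≤ 1 * Real.posLog R := mul_le_mul (abs_moebius_le_one _)
              (posLog_div_natCast_le R _) Real.posLog_nonneg zero_le_one
          _ = Real.log R := by
            rw [one_mul, Real.posLog_eq_log]
            rwa [abs_of_nonneg hR0]
      rw [← mul_sub, abs_mul]
      refine mul_le_mul h3 (h2.trans ?_) (abs_nonneg _) (by positivity)
      rw [hE]
      gcongr
    · obtain ⟨j, hj⟩ := not_forall.mp h
      have hc0 : c d = 0 := by
        refine Finset.prod_eq_zero (Finset.mem_univ j) ?_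
        rw [posLog_div_eq_zero hR0, mul_zero]
        by_contra h4
        exact hj (Finset.mem_Icc.mpr ⟨Nat.pos_of_mem_divisors (hdj j), not_lt.mp h4⟩)
      simp [hc0]
  refine (Finset.sum_le_sum hterm).trans ?_
  rw [← Finset.sum_filter, Finset.sum_const, nsmul_eq_mul]
  refine mul_le_mul_of_nonneg_right ?_ (by positivity)
  have hsub : (Fintype.piFinset fun _ : I × Bool => Q.divisors).filter
      (fun d => ∀ j, d j ∈ Finset.Icc 1 ⌊R⌋₊) ⊆
      Fintype.piFinset fun _ : I × Bool => Finset.Icc 1 ⌊R⌋₊ :=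
    fun d hd => Fintype.mem_piFinset.mpr (Finset.mem_filter.mp hd).2
  refine (Nat.cast_le.mpr (Finset.card_le_card hsub)).trans ?_
  rw [Fintype.card_piFinset, Finset.prod_const, Finset.card_univ, hcard, Nat.card_Icc]
  push_cast
  exact pow_le_pow_left₀ (Nat.cast_nonneg _) (Nat.floor_le hR0) _

/-- For `p > w` the factor `W` is invertible modulo `p`, and a nonzero coefficient or `2 × 2` minor,
being smaller than `p` in absolute value, stays nonzero modulo `p`. -/
theorem nondegenerateMod_of_abs_le {w : ℝ} {K : ℤ} {A : I → Fin t → ℤ} (hK : ∀ i j, |A i j| ≤ K)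
    (hA1 : ∀ i, ∃ j, A i j ≠ 0)
    (hA2 : ∀ i i', i ≠ i' → ∃ j j', A i j * A i' j' ≠ A i j' * A i' j) {p : ℕ} (hp : p.Prime)
    (hwp : ⌊w⌋₊ < p) (hKp : K < p) (hKp2 : 2 * K ^ 2 < p) :
    NondegenerateMod (fun i j => (primeProduct w : ℤ) * A i j) p := by
  have : Fact p.Prime := ⟨hp⟩
  have hW : ((primeProduct w : ℕ) : ZMod p) ≠ 0 := by
    rw [Ne, ZMod.natCast_eq_zero_iff, ← Nat.Prime.coprime_iff_not_dvd hp]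
    exact (coprime_primeProduct_of_prime hp).mpr hwp
  have hzero : ∀ x : ℤ, x ≠ 0 → |x| < p → (x : ZMod p) ≠ 0 := by
    intro x hx hxp h
    rw [ZMod.intCast_zmod_eq_zero_iff_dvd] at h
    exact hx (Int.eq_zero_of_abs_lt_dvd h hxp)
  refine ⟨fun i => ?_, fun i i' hii => ?_⟩
  · obtain ⟨j, hj⟩ := hA1 i
    refine ⟨j, ?_⟩
    push_cast
    exact mul_ne_zero hW (hzero _ hj ((hK i j).trans_lt hKp))
  · obtain ⟨j, j', hj⟩ := hA2 i i' hii
    refine ⟨j, j', fun h => ?_⟩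
    have hmul : ∀ a b c d, |A a b * A c d| ≤ K ^ 2 := by
      intro a b c d
      rw [abs_mul, sq]
      exact mul_le_mul (hK a b) (hK c d) (abs_nonneg _) ((abs_nonneg _).trans (hK a b))
    refine hzero (A i j * A i' j' - A i j' * A i' j) (sub_ne_zero.mpr hj) ?_ ?_
    · calc _ ≤ |A i j * A i' j'| + |A i j' * A i' j| := abs_sub _ _
        _ ≤ K ^ 2 + K ^ 2 := add_le_add (hmul _ _ _ _) (hmul _ _ _ _)
        _ < p := by linarith
    · push_cast at h ⊢
      have h2 : ((primeProduct w : ℕ) : ZMod p) ^ 2 * ((A i j : ZMod p) * A i' j' -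
          (A i j' : ZMod p) * A i' j) = 0 := by linear_combination h
      exact (mul_eq_zero.mp h2).resolve_left (pow_ne_zero 2 hW)

end Forms

/-! ### Box averages of the normalized sieve weight -/

/-- The sum of `1 / n ^ 2` over `n > w` is at most `2 / w`. This is where `w → ∞` makes the singular
series trivial. -/
theorem prod_sievePrimes_one_add_le {w R C : ℝ} (hw : 0 < w) (hC : 0 ≤ C) :
    ∏ p ∈ sievePrimes w R, (1 + C * (1 / (p : ℝ)) ^ 2) ≤ Real.exp (C * (2 / w)) := by
  have h1 : ∑ p ∈ sievePrimes w R, C * (1 / (p : ℝ)) ^ 2 ≤ C * (2 / w) := by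
    rw [← Finset.mul_sum]
    refine mul_le_mul_of_nonneg_left ?_ hC
    calc _ ≤ ∑ n ∈ Finset.Ioo ⌊w⌋₊ (⌊R⌋₊ + 1), ((n : ℝ) ^ 2)⁻¹ := by
          simp_rw [one_div, inv_pow]
          refine Finset.sum_le_sum_of_subset_of_nonneg ?_ fun _ _ _ => by positivity
          intro p hp
          simp only [sievePrimes, Finset.mem_filter, Finset.mem_Icc] at hp
          exact Finset.mem_Ioo.mpr ⟨hp.2.2, by omega⟩
      _ ≤ 2 / (⌊w⌋₊ + 1) := sum_Ioo_inv_sq_le _ _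
      _ ≤ 2 / w := div_le_div_of_nonneg_left zero_le_two hw (Nat.lt_floor_add_one w).le
  refine le_trans ?_ (Real.exp_le_exp.mpr h1)
  rw [Real.exp_sum]
  refine Finset.prod_le_prod (fun _ _ => by positivity) fun p _ => ?_
  rw [add_comm]
  exact Real.add_one_le_exp _

theorem localErrorConst_nonneg (m : ℕ) : 0 ≤ localErrorConst m := by
  unfold localErrorConst
  positivity

/-- The normalized square of the sieve sum. -/
noncomputable def normalizedSieve (w R : ℝ) (n : ℤ) : ℝ :=
  coprimeDensity w * (sieveSum w R n ^ 2 / Real.log R)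

theorem normalizedSieve_nonneg {w R : ℝ} (hR : 1 ≤ R) (n : ℤ) : 0 ≤ normalizedSieve w R n :=
  mul_nonneg (coprimeDensity_pos w).le (div_nonneg (sq_nonneg _) (Real.log_nonneg hR))

section Core

variable {α : Type*} {l : Filter α} {w R : α → ℝ} {H : α → ℕ}
  {I : Type*} [Fintype I] [DecidableEq I] {t : ℕ}

theorem tendsto_bilinearSieveSum_pow (m : ℕ) (hw : Tendsto w l atTop) (hR : Tendsto R l atTop)
    (hκ : Tendsto (fun a => primeProduct (w a) * (⌊w a⌋₊ + 1 : ℝ) ^ 2 / Real.log (R a)) l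
      (nhds 0)) :
    Tendsto (fun a => (coprimeDensity (w a) * bilinearSieveSum (primeProduct (w a)) (R a) 1 1 /
      Real.log (R a)) ^ m) l (nhds 1) := by
  suffices h : Tendsto (fun a => coprimeDensity (w a) *
      bilinearSieveSum (primeProduct (w a)) (R a) 1 1 / Real.log (R a)) l (nhds 1) by
    simpa using h.pow m
  rw [Metric.tendsto_nhds]
  intro δ hδ
  filter_upwards [eventually_abs_bilinearSieveSum_sub_le hw hR hκ (half_pos hδ)] with a ha
  rw [Real.dist_eq]
  linarith

/-- Averages over boxes of products of normalized sieve weights along non-degenerate systems of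
affine forms are close to `1`. -/
theorem eventually_abs_average_normalizedSieve_sub_le (K : ℤ) (hw : Tendsto w l atTop)
    (hR : Tendsto R l atTop)
    (hκ : Tendsto (fun a => primeProduct (w a) * (⌊w a⌋₊ + 1 : ℝ) ^ 2 / Real.log (R a)) l
      (nhds 0)) (hH0 : ∀ᶠ a in l, 0 < H a)
    (hH : Tendsto (fun a => R a ^ (5 * Fintype.card I) / (H a : ℝ)) l (nhds 0))
    {δ : ℝ} (hδ : 0 < δ) :
    ∀ᶠ a in l, ∀ A : I → Fin t → ℤ, (∀ i j, |A i j| ≤ K) → (∀ i, ∃ j, A i j ≠ 0) →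
      (∀ i i', i ≠ i' → ∃ j j', A i j * A i' j' ≠ A i j' * A i' j) → ∀ c : I → ℤ,
      |1 / (H a : ℝ) ^ t * ∑ z ∈ box t (H a), ∏ i,
        normalizedSieve (w a) (R a) (primeProduct (w a) * affineForm (A i) (c i) z + 1) - 1|
        ≤ δ := by
  set m := Fintype.card I with hm
  set C' : ℝ := localErrorConst m * 4 ^ m with hC'
  have hC'0 : 0 ≤ C' := mul_nonneg (localErrorConst_nonneg m) (by positivity)
  have hprod : Tendsto (fun a => 98 ^ m * (Real.exp (C' * (2 / w a)) - 1)) l (nhds 0) := by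
    have h1 : Tendsto (fun a => C' * (2 / w a)) l (nhds 0) := by
      simpa using (hw.const_div_atTop 2).const_mul C'
    have h2 := ((Real.continuous_exp.tendsto 0).comp h1).sub_const 1
    simpa using h2.const_mul (98 ^ m)
  have hbox : Tendsto (fun a => 2 * t * (R a ^ (5 * m) / (H a : ℝ))) l (nhds 0) := by
    simpa using hH.const_mul (2 * t : ℝ)
  have hmain := tendsto_bilinearSieveSum_pow m hw hR hκ
  have hδ3 : 0 < δ / 3 := by positivity
  filter_upwards [hprod.eventually_le_const hδ3, hbox.eventually_le_const hδ3,
    hbox.eventually_le_const one_pos, Metric.tendsto_nhds.mp hmain _ hδ3,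
    eventually_abs_bilinearSieveSum_le hR hκ, hw.eventually_ge_atTop (2 * (K : ℝ) ^ 2 + |(K : ℝ)| + 1),
    hw.eventually_gt_atTop 0, hR.eventually_gt_atTop 1, hH0]
    with a h1 h2 h2' h3 h4 hwK hw0 hR1 hH0 A hK hA1 hA2 c
  set L := Real.log (R a) with hL
  have hL0 : 0 < L := Real.log_pos hR1
  set κ := coprimeDensity (w a) with hκd
  have hκ0 : 0 < κ := coprimeDensity_pos _
  have hκ1 : κ ≤ 1 := coprimeDensity_le_one _
  set W := primeProduct (w a) with hW
  have hHr : (0 : ℝ) < H a := by exact_mod_cast hH0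
  have hform : ∀ i z, (W : ℤ) * affineForm (A i) (c i) z + 1 =
      affineForm (fun j => (W : ℤ) * A i j) ((W : ℤ) * c i + 1) z := by
    intro i z
    simp only [affineForm, mul_add, Finset.mul_sum, mul_assoc, add_assoc]
  -- Eventually `w` exceeds both `K` and `2 * K ^ 2`, so no sieving prime is degenerate.
  have hnd : ∀ p ∈ sievePrimes (w a) (R a), NondegenerateMod (fun i j => (W : ℤ) * A i j) p := by
    intro p hp
    have hwp := (Finset.mem_filter.mp hp).2.2
    have hwp' : w a < p := (Nat.floor_lt hw0.le).mp hwp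
    have hKr : (K : ℝ) ≤ |(K : ℝ)| := le_abs_self _
    have hK2 : (0 : ℝ) ≤ (K : ℝ) ^ 2 := sq_nonneg _
    have hKa : (0 : ℝ) ≤ |(K : ℝ)| := abs_nonneg _
    refine nondegenerateMod_of_abs_le hK hA1 hA2 (prime_of_mem_sievePrimes p hp) hwp ?_ ?_
    · have : (K : ℝ) < p := by linarith
      exact_mod_cast this
    · have : 2 * (K : ℝ) ^ 2 < p := by linarith
      exact_mod_cast this
  simp_rw [hform]
  set γ : I → ℤ := fun i => (W : ℤ) * c i + 1 with hγ
  set Al : I → Fin t → ℤ := fun i j => (W : ℤ) * A i j with hAl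
  have e1 := abs_average_box_sub_period_le (w := w a) hR1.le hH0 Al γ
  have e2 := abs_average_period_sub_le hR1.le Al γ hnd (C := 98 * L / κ) (by
    intro u v
    rw [le_div_iff₀ hκ0, mul_comm]
    have := h4 u v
    rwa [abs_mul, abs_of_pos hκ0] at this)
  set avH := 1 / (H a : ℝ) ^ t * ∑ z ∈ box t (H a),
    ∏ i, sieveSum (w a) (R a) (affineForm (Al i) (γ i) z) ^ 2 with havH
  set avQ := 1 / ((∏ p ∈ sievePrimes (w a) (R a), p : ℕ) : ℝ) ^ t *
    ∑ z ∈ box t (∏ p ∈ sievePrimes (w a) (R a), p),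
      ∏ i, sieveSum (w a) (R a) (affineForm (Al i) (γ i) z) ^ 2 with havQ
  set B := bilinearSieveSum W (R a) 1 1 with hB
  have hs : 1 / (H a : ℝ) ^ t * ∑ z ∈ box t (H a), ∏ i,
      normalizedSieve (w a) (R a) (affineForm (Al i) (γ i) z) = (κ / L) ^ m * avH := by
    rw [havH, mul_left_comm, Finset.mul_sum _ _ ((κ / L) ^ m)]
    congr 1
    refine Finset.sum_congr rfl fun z _ => ?_
    simp only [normalizedSieve]
    rw [hm, ← Finset.card_univ, ← Finset.prod_const, ← Finset.prod_mul_distrib]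
    refine Finset.prod_congr rfl fun i _ => ?_
    ring
  rw [hs]
  have hq0 : 0 ≤ (κ / L) ^ m := by positivity
  -- Box against period: there are at most `R ^ (2 m)` divisor tuples, each with relative error
  -- about `R ^ (2 m) / H`, and the remaining power `L ^ m` is at most `R ^ m`. This explains the
  -- exponent `5 * m`.
  have b1 : (κ / L) ^ m * |avH - avQ| ≤ δ / 3 := by
    refine le_trans ?_ h2
    have hx : (t : ℝ) * (R a ^ (2 * m) / H a) ≤ 1 := by
      refine le_trans ?_ h2'
      have : R a ^ (2 * m) ≤ R a ^ (5 * m) := pow_le_pow_right₀ hR1.le (by omega)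
      have h5 : (t : ℝ) * (R a ^ (2 * m) / H a) ≤ t * (R a ^ (5 * m) / H a) := by gcongr
      have h6 : 0 ≤ (t : ℝ) * (R a ^ (5 * m) / H a) := by positivity
      linarith
    have hx0 : 0 ≤ (t : ℝ) * (R a ^ (2 * m) / H a) := by positivity
    have hE : Real.exp (t * (R a ^ (2 * m) / H a)) - 1 ≤ 2 * (t * (R a ^ (2 * m) / H a)) := by
      have := Real.abs_exp_sub_one_le (x := t * (R a ^ (2 * m) / H a)) (by rwa [abs_of_nonneg hx0])
      rw [abs_of_nonneg hx0] at this
      exact (le_abs_self _).trans this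
    have hLR : L ≤ R a := (Real.log_le_sub_one_of_pos (by linarith)).trans (by linarith)
    calc (κ / L) ^ m * |avH - avQ|
        ≤ (1 / L) ^ m * (R a ^ (2 * m) * (L ^ (2 * m) * (2 * (t * (R a ^ (2 * m) / H a))))) := by
          refine mul_le_mul ?_ (e1.trans ?_) (abs_nonneg _) (by positivity)
          · gcongr
          · gcongr
      _ = L ^ m * (R a ^ (2 * m) * (2 * (t * (R a ^ (2 * m) / H a)))) := by
          rw [one_div, inv_pow, two_mul m, pow_add L]
          field_simp
      _ ≤ R a ^ m * (R a ^ (2 * m) * (2 * (t * (R a ^ (2 * m) / H a)))) := by gcongr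
      _ = _ := by
          rw [show 5 * m = m + 2 * m + 2 * m by ring, pow_add, pow_add]
          ring
  -- Period against model: the normalization turns the sup norm bound `98 * L / κ` into the constant
  -- `98`.
  have b2 : (κ / L) ^ m * |avQ - B ^ m| ≤ δ / 3 := by
    refine le_trans ?_ h1
    calc (κ / L) ^ m * |avQ - B ^ m| ≤ (κ / L) ^ m * ((Real.exp (C' * (2 / w a)) - 1) *
          (98 * L / κ) ^ m) := by
          refine mul_le_mul_of_nonneg_left (e2.trans ?_) hq0
          refine mul_le_mul_of_nonneg_right ?_ (by positivity)
          exact sub_le_sub_right (prod_sievePrimes_one_add_le hw0 hC'0) 1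
      _ = ((κ / L) * (98 * L / κ)) ^ m * (Real.exp (C' * (2 / w a)) - 1) := by
          rw [mul_pow]
          ring
      _ = _ := by
          rw [show κ / L * (98 * L / κ) = 98 by field_simp]
  have b3 : |(κ / L) ^ m * B ^ m - 1| ≤ δ / 3 := by
    rw [← mul_pow, show κ / L * B = κ * B / L by ring, ← Real.dist_eq]
    exact h3.le
  have hsplit : (κ / L) ^ m * avH - 1 = (κ / L) ^ m * (avH - avQ) + (κ / L) ^ m * (avQ - B ^ m) +
      ((κ / L) ^ m * B ^ m - 1) := by ring
  rw [hsplit]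
  refine (abs_add_three _ _ _).trans ?_
  rw [abs_mul, abs_mul, abs_of_nonneg hq0]
  linarith

end Core

/-! ### Growth of the parameters -/

theorem tendsto_of_rpow_lt {M : ℕ → ℕ} {ε : ℝ} (hε : 0 < ε)
    (hM : ∀ᶠ N : ℕ in atTop, (N : ℝ) ^ ε < (M N : ℝ) ∧ M N ≤ N) : Tendsto M atTop atTop := by
  have h1 : Tendsto (fun N : ℕ => (N : ℝ) ^ ε) atTop atTop :=
    (tendsto_rpow_atTop hε).comp tendsto_natCast_atTop_atTop
  exact tendsto_natCast_atTop_iff.mp (tendsto_atTop_mono' _ (hM.mono fun N h => h.1.le) h1)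

theorem sieveLevel_exponent_pos {k : ℕ} (hk : 0 < k) : 0 < 1 / ((k : ℝ) * 2 ^ (k + 4)) := by
  have : (0 : ℝ) < k := by exact_mod_cast hk
  positivity

theorem tendsto_sieveLevel {k : ℕ} (hk : 0 < k) : Tendsto (sieveLevel k) atTop atTop :=
  (tendsto_rpow_atTop (sieveLevel_exponent_pos hk)).comp tendsto_natCast_atTop_atTop

theorem log_sieveLevel {k M : ℕ} (hM : 0 < M) :
    Real.log (sieveLevel k M) = 1 / ((k : ℝ) * 2 ^ (k + 4)) * Real.log M :=
  Real.log_rpow (by exact_mod_cast hM) _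

/-- The exponent of `R` is chosen for this: `5 * m / (k * 2 ^ (k + 4)) ≤ 5 / 32`, which leaves `M ^
(5 / 32 - 1 / 2) = M ^ (-11 / 32)`. -/
theorem tendsto_sieveLevel_pow_div_sqrt {k m : ℕ} (hk : 0 < k) (hm : m ≤ k * 2 ^ (k - 1)) :
    Tendsto (fun M : ℕ => sieveLevel k M ^ (5 * m) / ((Nat.sqrt M + 1 : ℕ) : ℝ)) atTop
      (nhds 0) := by
  have hk0 : (0 : ℝ) < k := by exact_mod_cast hk
  have h1 : Tendsto (fun M : ℕ => (M : ℝ) ^ (-(11 / 32) : ℝ)) atTop (nhds 0) :=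
    (tendsto_rpow_neg_atTop (by norm_num)).comp tendsto_natCast_atTop_atTop
  refine squeeze_zero' (Eventually.of_forall fun M => ?_) ?_ h1
  · have : 0 ≤ sieveLevel k M := Real.rpow_nonneg (Nat.cast_nonneg _) _
    positivity
  · filter_upwards [eventually_gt_atTop 0] with M hM
    have hM1 : (1 : ℝ) ≤ M := by exact_mod_cast hM
    have hM0 : (0 : ℝ) < M := by linarith
    have hsq : (M : ℝ) ^ (1 / 2 : ℝ) ≤ ((Nat.sqrt M + 1 : ℕ) : ℝ) := by
      rw [← Real.sqrt_eq_rpow, Real.sqrt_le_left (by positivity)]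
      exact_mod_cast (Nat.lt_succ_sqrt' M).le
    have hpow : sieveLevel k M ^ (5 * m) ≤ (M : ℝ) ^ (5 / 32 : ℝ) := by
      rw [sieveLevel, ← Real.rpow_natCast, ← Real.rpow_mul hM0.le]
      refine Real.rpow_le_rpow_of_exponent_le hM1 ?_
      have hm' : (m : ℝ) ≤ k * 2 ^ (k - 1) := by exact_mod_cast hm
      have h2 : (2 : ℝ) ^ (k + 4) = 32 * 2 ^ (k - 1) := by
        rw [show k + 4 = (k - 1) + 5 by omega, pow_add]
        ring
      rw [h2]
      push_cast
      rw [div_mul_eq_mul_div, one_mul, div_le_div_iff₀ (by positivity) (by norm_num)]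
      linarith
    rw [div_le_iff₀ (by positivity)]
    calc _ ≤ (M : ℝ) ^ (5 / 32 : ℝ) := hpow
      _ = (M : ℝ) ^ (-(11 / 32) : ℝ) * (M : ℝ) ^ (1 / 2 : ℝ) := by
        rw [← Real.rpow_add hM0]
        norm_num
      _ ≤ _ := by gcongr

/-- From `W ≤ 4 ^ w`, `log 4 ≤ 7 / 5` and `w ≤ (log log N) / 2` follows `W ≤ (log N) ^ (7 / 10)`,
while `log R` is at least a constant times `log N`. The spare `(log N) ^ (3 / 10)` beats the square
of `log log N`. -/
theorem tendsto_primeProduct_mul_sq_div_log {k : ℕ} (hk : 0 < k) {w : ℕ → ℝ}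
    (hw : Tendsto w atTop atTop)
    (hw_le : ∀ᶠ N : ℕ in atTop, w N ≤ 1 / 2 * Real.log (Real.log N)) {M : ℕ → ℕ} {ε : ℝ}
    (hε : 0 < ε) (hM : ∀ᶠ N : ℕ in atTop, (N : ℝ) ^ ε < (M N : ℝ) ∧ M N ≤ N) :
    Tendsto (fun N => primeProduct (w N) * (⌊w N⌋₊ + 1 : ℝ) ^ 2 /
      Real.log (sieveLevel k (M N))) atTop (nhds 0) := by
  have hk0 : (0 : ℝ) < k := by exact_mod_cast hk
  have hc := sieveLevel_exponent_pos hk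
  set c := 1 / ((k : ℝ) * 2 ^ (k + 4)) with hcd
  set x : ℕ → ℝ := fun N => 3 / 10 * Real.log (Real.log N) with hx
  have hxt : Tendsto x atTop atTop :=
    (Real.tendsto_log_atTop.comp (Real.tendsto_log_atTop.comp
      tendsto_natCast_atTop_atTop)).const_mul_atTop (by norm_num)
  have hlim : Tendsto (fun N => 400 / 9 / (c * ε) * (x N ^ 2 * Real.exp (-x N))) atTop (nhds 0) := by
    simpa using ((Real.tendsto_pow_mul_exp_neg_atTop_nhds_zero 2).comp hxt).const_mul
      (400 / 9 / (c * ε))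
  have hR : Tendsto (fun N => sieveLevel k (M N)) atTop atTop :=
    (tendsto_sieveLevel hk).comp (tendsto_of_rpow_lt hε hM)
  refine squeeze_zero' ?_ ?_ hlim
  · filter_upwards [hR.eventually_ge_atTop 1] with N hN
    exact div_nonneg (by positivity) (Real.log_nonneg hN)
  · filter_upwards [hw_le, hM, hw.eventually_ge_atTop 0, hxt.eventually_ge_atTop 1,
      eventually_gt_atTop 2] with N h1 h2 h3 h4 h5
    have hN0 : (0 : ℝ) < N := by exact_mod_cast (by omega : 0 < N)
    have hlogN : 0 < Real.log N := Real.log_pos (by exact_mod_cast (by omega : 1 < N))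
    set y := Real.log (Real.log N) with hy
    have hxy : x N = 3 / 10 * y := rfl
    have hy1 : 10 / 3 ≤ y := by rw [hxy] at h4; linarith
    have hlogM : ε * Real.log N ≤ Real.log (M N) := by
      rw [← Real.log_rpow hN0]
      exact Real.log_le_log (Real.rpow_pos_of_pos hN0 _) h2.1.le
    have hM0 : 0 < M N := by
      have : (0 : ℝ) < M N := (Real.rpow_pos_of_pos hN0 _).trans h2.1
      exact_mod_cast this
    have hlogNy : Real.log N = Real.exp y := (Real.exp_log hlogN).symm
    have hfl : (⌊w N⌋₊ : ℝ) ≤ 1 / 2 * y := (Nat.floor_le h3).trans h1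
    have hW : (primeProduct (w N) : ℝ) ≤ Real.exp (7 / 10 * y) := by
      calc (primeProduct (w N) : ℝ) ≤ 4 ^ ⌊w N⌋₊ := by exact_mod_cast primeProduct_le_four_pow _
        _ = Real.exp (⌊w N⌋₊ * Real.log 4) := by
          rw [mul_comm, Real.exp_mul, Real.exp_log (by norm_num), Real.rpow_natCast]
        _ ≤ Real.exp (7 / 10 * y) := by
          refine Real.exp_le_exp.mpr ?_
          have h4' : Real.log 4 ≤ 14 / 10 := by
            rw [show (4 : ℝ) = 2 ^ 2 by norm_num, Real.log_pow]
            have := Real.log_two_lt_d9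
            push_cast
            linarith
          calc (⌊w N⌋₊ : ℝ) * Real.log 4 ≤ (1 / 2 * y) * (14 / 10) :=
                mul_le_mul hfl h4' (Real.log_nonneg (by norm_num)) (by linarith)
            _ = _ := by ring
    have hsq : ((⌊w N⌋₊ : ℝ) + 1) ^ 2 ≤ (2 * y) ^ 2 :=
      pow_le_pow_left₀ (by positivity) (by linarith) 2
    rw [log_sieveLevel hM0, ← hcd]
    have hden : c * (ε * Real.exp y) ≤ c * Real.log (M N) := by
      rw [← hlogNy]
      gcongr
    calc primeProduct (w N) * (⌊w N⌋₊ + 1 : ℝ) ^ 2 / (c * Real.log (M N))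
        ≤ Real.exp (7 / 10 * y) * (2 * y) ^ 2 / (c * (ε * Real.exp y)) := by
          refine div_le_div₀ (by positivity) ?_ (by positivity) hden
          exact mul_le_mul hW hsq (by positivity) (by positivity)
      _ = 400 / 9 / (c * ε) * (x N ^ 2 * Real.exp (-x N)) := by
          rw [hxy, show Real.exp y = Real.exp (7 / 10 * y) * Real.exp (3 / 10 * y) by
            rw [← Real.exp_add]; ring_nf, Real.exp_neg]
          field_simp
          ring

/-! ### From sieve weights on boxes to the majorant -/

section Average

variable {ι ζ : Type*} [Fintype ι] {Z : Finset ζ} {r δ : ℝ} {s ν : ι → ζ → ℝ}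

/-- For boxes that no form leaves its piece on: the factors equal to `1` drop out, and a subsystem
of sieve weights remains. -/
theorem abs_average_prod_sub_one_le
    (hs : ∀ S : Finset ι, |r * ∑ z ∈ Z, ∏ i ∈ S, s i z - 1| ≤ δ)
    (hν : ∀ i, (∀ z ∈ Z, ν i z = s i z) ∨ ∀ z ∈ Z, ν i z = 1) :
    |r * ∑ z ∈ Z, ∏ i, ν i z - 1| ≤ δ := by
  classical
  have h1 : ∀ z ∈ Z, ∏ i, ν i z = ∏ i with ∀ z ∈ Z, ν i z = s i z, s i z := by
    intro z hz
    rw [Finset.prod_filter]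
    refine Finset.prod_congr rfl fun i _ => ?_
    split_ifs with h
    · exact h z hz
    · exact (hν i).resolve_left h z hz
  rw [Finset.sum_congr rfl h1]
  exact hs _

/-- For boxes straddling an endpoint: expand `∏ (1 + s i)` over subsets, each of which averages to
at most `2`. -/
theorem abs_average_prod_sub_one_le_two_pow (hr : 0 ≤ r) (hδ : δ ≤ 1)
    (hs : ∀ S : Finset ι, |r * ∑ z ∈ Z, ∏ i ∈ S, s i z - 1| ≤ δ)
    (hν0 : ∀ i, ∀ z ∈ Z, 0 ≤ ν i z) (hν : ∀ i, ∀ z ∈ Z, ν i z ≤ 1 + s i z) :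
    |r * ∑ z ∈ Z, ∏ i, ν i z - 1| ≤ 2 ^ Fintype.card ι * 2 + 1 := by
  have h0 : 0 ≤ r * ∑ z ∈ Z, ∏ i, ν i z :=
    mul_nonneg hr (Finset.sum_nonneg fun z hz => Finset.prod_nonneg fun i _ => hν0 i z hz)
  have h1 : r * ∑ z ∈ Z, ∏ i, ν i z ≤ 2 ^ Fintype.card ι * 2 := by
    calc r * ∑ z ∈ Z, ∏ i, ν i z ≤ r * ∑ z ∈ Z, ∏ i, (1 + s i z) := by
          refine mul_le_mul_of_nonneg_left (Finset.sum_le_sum fun z hz => ?_) hr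
          exact Finset.prod_le_prod (fun i _ => hν0 i z hz) fun i _ => hν i z hz
      _ = ∑ S : Finset ι, r * ∑ z ∈ Z, ∏ i ∈ S, s i z := by
          simp_rw [Finset.prod_one_add, Finset.powerset_univ]
          rw [Finset.sum_comm, Finset.mul_sum]
      _ ≤ ∑ _S : Finset ι, (2 : ℝ) := by
          refine Finset.sum_le_sum fun S _ => ?_
          have := (abs_le.mp (hs S)).2
          linarith
      _ = _ := by simp
  rw [abs_le]
  constructor <;> linarith [pow_pos (two_pos : (0 : ℝ) < 2) (Fintype.card ι)]

end Average

/-- Translation invariance localizes the average to boxes on which every form with small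
coefficients moves only a short way around `ℤ/Mℤ`. -/
theorem average_box_shift {M t H : ℕ} [NeZero M] (hH : 0 < H) (G : (Fin t → ZMod M) → ℝ) :
    𝔼 x, G x = 𝔼 a, 1 / (H : ℝ) ^ t * ∑ z ∈ box t H, G (a + fun j => (z j : ZMod M)) := by
  have hHr : (0 : ℝ) < H := by exact_mod_cast hH
  rw [← Finset.mul_expect, Finset.expect_sum_comm]
  have h1 : ∀ z ∈ box t H, 𝔼 a, G (a + fun j => (z j : ZMod M)) = 𝔼 x, G x := fun z _ =>
    Fintype.expect_equiv (Equiv.addRight _) _ _ fun _ => rfl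
  rw [Finset.sum_congr rfl h1, Finset.sum_const, card_box, nsmul_eq_mul]
  push_cast
  field_simp

theorem card_filter_abs_sub_le {M : ℕ} [NeZero M] (N : ℕ) (y : ℝ) {B : ℝ} (hB : 0 ≤ B) :
    ((Finset.univ.filter fun x : ZMod M => |(representative N M x : ℝ) - N - y| ≤ B).card : ℝ) ≤
      2 * B + 1 := by
  have h1 : (Finset.univ.filter fun x : ZMod M =>
      |(representative N M x : ℝ) - N - y| ≤ B).card ≤ (Finset.Icc ⌈y - B⌉ ⌊y + B⌋).card := by
    refine Finset.card_le_card_of_injOn (fun x => ((x - (N : ZMod M)).val : ℤ)) ?_ ?_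
    · intro x hx
      have hx := (Finset.mem_filter.mp hx).2
      rw [representative] at hx
      push_cast at hx
      rw [add_sub_cancel_left, abs_le] at hx
      simp only [Finset.coe_Icc, Set.mem_Icc, Int.ceil_le, Int.le_floor]
      push_cast
      constructor <;> linarith
    · intro x _ x' _ h
      have h := ZMod.val_injective _ (Nat.cast_injective h)
      exact sub_left_injective h
  refine (Nat.cast_le.mpr h1).trans ?_
  rw [Int.card_Icc]
  have h2 := Int.ceil_lt_add_one (y - B)
  have h3 := Int.le_ceil (y - B)
  have h4 := Int.floor_le (y + B)
  rcases le_total 0 (⌊y + B⌋ + 1 - ⌈y - B⌉) with h | h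
  · have h5 : (((⌊y + B⌋ + 1 - ⌈y - B⌉).toNat : ℤ) : ℝ) = ((⌊y + B⌋ + 1 - ⌈y - B⌉ : ℤ) : ℝ) := by
      rw [Int.toNat_of_nonneg h]
    rw [Int.cast_natCast] at h5
    rw [h5]
    push_cast
    linarith
  · rw [Int.toNat_of_nonpos h]
    push_cast
    linarith

theorem epsilon_pos (k : ℕ) : 0 < epsilon k := by
  unfold epsilon
  positivity

/-- Leaves room beyond the window, so that a short shift wrapping around the residue system cannot
enter it. -/
theorem epsilon_le (k : ℕ) : epsilon k ≤ 1 / 4 := by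
  unfold epsilon
  refine one_div_le_one_div_of_le (by norm_num) ?_
  have h1 : (1 : ℝ) ≤ 2 ^ k := one_le_pow₀ one_le_two
  have h2 : 4 ≤ Nat.factorial (k + 4) := le_trans (by omega) (Nat.self_le_factorial (k + 4))
  have h2' : (4 : ℝ) ≤ (Nat.factorial (k + 4) : ℝ) := by exact_mod_cast h2
  nlinarith

theorem majorant_eq_normalizedSieve {k N M : ℕ} (hM : 0 < M) (w : ℝ) (x : ZMod M) :
    majorant k N M w x = if epsilon k * M ≤ (representative N M x : ℝ) - N ∧
      (representative N M x : ℝ) - N ≤ 2 * epsilon k * M then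
      normalizedSieve w (sieveLevel k M) (primeProduct w * (representative N M x : ℤ) + 1)
    else 1 := by
  have hR : 0 < sieveLevel k M := Real.rpow_pos_of_pos (by exact_mod_cast hM) _
  have h := sieveSum_natCast (w := w) hR
    (n := primeProduct w * representative N M x + 1) (by omega) (by simp)
  push_cast at h
  rw [majorant, normalizedSieve, h]
  rfl

/-- The value of the majorant at a short shift of `x`, in terms of the representative of `x`. -/
theorem majorant_add_intCast {k N M : ℕ} (hM : 0 < M) (w : ℝ) (x : ZMod M) {h : ℤ} {B : ℝ}
    (hh : |(h : ℝ)| ≤ B) (hB1 : B < epsilon k * M) (hB2 : B + 2 * epsilon k * M < M) :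
    majorant k N M w (x + (h : ZMod M)) =
      if epsilon k * M ≤ (representative N M x : ℝ) - N + h ∧
        (representative N M x : ℝ) - N + h ≤ 2 * epsilon k * M then
        normalizedSieve w (sieveLevel k M)
          (primeProduct w * ((representative N M x : ℤ) + h) + 1)
      else 1 := by
  have : NeZero M := ⟨hM.ne'⟩
  rw [majorant_eq_normalizedSieve hM]
  set u := (x - (N : ZMod M)).val with hu
  set v := (x + (h : ZMod M) - (N : ZMod M)).val with hv
  have hru : (representative N M x : ℤ) = N + u := by rw [representative]; push_cast; rfl
  have hrv : (representative N M (x + (h : ZMod M)) : ℤ) = N + v := by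
    rw [representative]; push_cast; rfl
  have hru' : (representative N M x : ℝ) = N + u := by exact_mod_cast hru
  have hrv' : (representative N M (x + (h : ZMod M)) : ℝ) = N + v := by exact_mod_cast hrv
  have huM : (u : ℝ) < M := by exact_mod_cast ZMod.val_lt _
  have hvM : (v : ℝ) < M := by exact_mod_cast ZMod.val_lt _
  have hu0 : (0 : ℝ) ≤ u := Nat.cast_nonneg _
  have hv0 : (0 : ℝ) ≤ v := Nat.cast_nonneg _
  obtain ⟨q, hq⟩ : ∃ q : ℤ, (v : ℤ) = u + h + M * q := by
    have h1 : ((u + h : ℤ) : ZMod M) = ((v : ℤ) : ZMod M) := by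
      push_cast
      rw [hu, hv, ZMod.natCast_zmod_val, ZMod.natCast_zmod_val]
      ring
    obtain ⟨q, hq⟩ := (ZMod.intCast_eq_intCast_iff_dvd_sub _ _ _).mp h1
    exact ⟨q, by linarith⟩
  have hqr : (v : ℝ) = u + h + M * q := by exact_mod_cast hq
  have hMr : (0 : ℝ) < M := by exact_mod_cast hM
  have hh' := abs_le.mp hh
  have hε : 0 < epsilon k * M := mul_pos (epsilon_pos k) hMr
  rw [hrv', hru', hrv, hru]
  -- The integer `q` records wrapping around the interval of representatives. If `q ≠ 0`, both the
  -- wrapped and the unwrapped value lie outside the window, so both sides equal `1`.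
  rcases lt_trichotomy q 0 with hq0 | hq0 | hq0
  · have hq1 : (q : ℝ) ≤ -1 := by exact_mod_cast (by omega : q ≤ -1)
    have h2 : (M : ℝ) * q ≤ -M := by nlinarith
    rw [if_neg (by rintro ⟨h3, -⟩; linarith), if_neg (by rintro ⟨-, h3⟩; linarith)]
  · rw [hq0, Int.cast_zero, mul_zero, add_zero] at hqr
    rw [hq0, mul_zero, add_zero] at hq
    rw [hqr, hq, add_assoc, show (N : ℝ) + (u + h) - N = N + u - N + h by ring]
  · have hq1 : (1 : ℝ) ≤ q := by exact_mod_cast (by omega : 1 ≤ q)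
    have h2 : (M : ℝ) ≤ M * q := by nlinarith
    rw [if_neg (by rintro ⟨-, h3⟩; linarith), if_neg (by rintro ⟨h3, -⟩; linarith)]

theorem expect_linearForm_add {M t : ℕ} [Fact M.Prime] {a : Fin t → ZMod M} (ha : a ≠ 0)
    (b : ZMod M) (f : ZMod M → ℝ) : 𝔼 x, f (linearForm a x + b) = 𝔼 y, f y := by
  have hM : (M : ℝ) ≠ 0 := by exact_mod_cast (Fact.out : M.Prime).ne_zero
  have h1 : 𝔼 y, f y = 𝔼 y, f (y + b) :=
    (Fintype.expect_equiv (Equiv.addRight b) _ _ fun _ => rfl).symm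
  rw [h1, Fintype.expect_eq_sum_div_card, Fintype.expect_eq_sum_div_card,
    ← Finset.sum_fiberwise Finset.univ (linearForm a)]
  have h2 : ∀ y : ZMod M, ∑ x with linearForm a x = y, f (linearForm a x + b) =
      1 / (M : ℝ) * (M : ℝ) ^ t * f (y + b) := by
    intro y
    rw [Finset.sum_congr rfl fun x hx => by rw [(Finset.mem_filter.mp hx).2], Finset.sum_const,
      nsmul_eq_mul, card_linearForm_eq ha, ZMod.card, Fintype.card_fun, ZMod.card,
      Fintype.card_fin]
    push_cast
    rfl
  simp_rw [h2]
  rw [← Finset.mul_sum, ZMod.card, Fintype.card_fun, ZMod.card, Fintype.card_fin]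
  push_cast
  field_simp

theorem abs_affineForm_zero_le {t K H : ℕ} {A : Fin t → ℤ} (hA : ∀ j, |A j| ≤ K)
    {z : Fin t → ℕ} (hz : z ∈ box t H) : |((affineForm A 0 z : ℤ) : ℝ)| ≤ t * K * H := by
  have h1 : |affineForm A 0 z| ≤ t * K * H := by
    rw [affineForm, add_zero]
    refine (Finset.abs_sum_le_sum_abs _ _).trans ?_
    calc ∑ j, |A j * (z j : ℤ)| ≤ ∑ _j : Fin t, (K : ℤ) * H := by
          refine Finset.sum_le_sum fun j _ => ?_
          rw [abs_mul, Nat.abs_cast]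
          exact mul_le_mul (hA j) (by exact_mod_cast (mem_box.mp hz j).le) (by positivity)
            (by positivity)
      _ = _ := by simp [mul_assoc]
  exact_mod_cast h1

/-- The average of the majorant along integer forms, given the averages of the sieve weights
over boxes. -/
theorem abs_expect_prod_majorant_sub_one_le {k N M m t H K : ℕ} [Fact M.Prime] {w : ℝ}
    {A : Fin m → Fin t → ℤ} (hK : ∀ i j, |A i j| ≤ K) (hKM : K < M) (hA : ∀ i, ∃ j, A i j ≠ 0)
    {δ : ℝ} (hδ : δ ≤ 1) (hH : 0 < H) (hR : 1 ≤ sieveLevel k M)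
    (hcore : ∀ (c : Fin m → ℤ) (S : Finset (Fin m)), |1 / (H : ℝ) ^ t * ∑ z ∈ box t H, ∏ i ∈ S,
      normalizedSieve w (sieveLevel k M) (primeProduct w * affineForm (A i) (c i) z + 1) - 1| ≤ δ)
    (hB1 : (t * K * H : ℝ) < epsilon k * M) (hB2 : (t * K * H : ℝ) + 2 * epsilon k * M < M)
    (b : Fin m → ZMod M) :
    |(𝔼 x : Fin t → ZMod M, ∏ i, majorant k N M w (∑ j, (A i j : ZMod M) * x j + b i)) - 1| ≤
      δ + (2 ^ m * 2 + 1) * (m * (2 * (2 * (t * K * H) + 1) / M)) := by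
  classical
  set B : ℝ := t * K * H with hB
  have hB0 : 0 ≤ B := by positivity
  have hM0 : 0 < M := (Fact.out : M.Prime).pos
  have hMr : (0 : ℝ) < M := by exact_mod_cast hM0
  -- Within one box a form moves by at most `B`, so it can cross an endpoint of the window only if
  -- it starts within `B` of it.
  set bad : ZMod M → Prop := fun x =>
    |(representative N M x : ℝ) - N - epsilon k * M| ≤ B ∨
      |(representative N M x : ℝ) - N - 2 * epsilon k * M| ≤ B with hbad
  set ℓ : Fin m → (Fin t → ZMod M) → ZMod M :=
    fun i a => linearForm (fun j => (A i j : ZMod M)) a + b i with hℓ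
  have hA0 : ∀ i, (fun j => (A i j : ZMod M)) ≠ 0 := by
    intro i h0
    obtain ⟨j, hj⟩ := hA i
    have h1 : (A i j : ZMod M) = 0 := congrFun h0 j
    rw [ZMod.intCast_zmod_eq_zero_iff_dvd] at h1
    exact hj (Int.eq_zero_of_abs_lt_dvd h1 ((hK i j).trans_lt (by exact_mod_cast hKM)))
  have hshift : ∀ i a (z : Fin t → ℕ), linearForm (fun j => (A i j : ZMod M))
      (a + fun j => (z j : ZMod M)) + b i = ℓ i a + ((affineForm (A i) 0 z : ℤ) : ZMod M) := by
    intro i a z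
    rw [map_add, hℓ, affineForm, add_zero]
    push_cast
    rw [linearForm_apply _ fun j => (z j : ZMod M)]
    ring
  -- A nonzero form is equidistributed, and the two intervals around the endpoints contain at most
  -- `2 * (2 * B + 1)` residues.
  have hbadexp : ∀ i, 𝔼 a, (if bad (ℓ i a) then (1 : ℝ) else 0) ≤ 2 * (2 * B + 1) / M := by
    intro i
    rw [expect_linearForm_add (hA0 i) (b i) fun x => if bad x then (1 : ℝ) else 0,
      Fintype.expect_eq_sum_div_card, ZMod.card]
    refine div_le_div_of_nonneg_right ?_ hMr.le
    rw [Finset.sum_boole]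
    have h1 := card_filter_abs_sub_le (M := M) N (epsilon k * M) hB0
    have h2 := card_filter_abs_sub_le (M := M) N (2 * epsilon k * M) hB0
    simp only [hbad, Finset.filter_or]
    refine (Nat.cast_le.mpr (Finset.card_union_le _ _)).trans ?_
    push_cast
    linarith
  set C : ℝ := 2 ^ m * 2 + 1 with hC
  have hC0 : 0 ≤ C := by positivity
  -- On a box with no bad form the error is `δ`. On any other box it is at most `C`, and the sum of
  -- indicators is at least `1`.
  have hpt : ∀ a : Fin t → ZMod M, |1 / (H : ℝ) ^ t * ∑ z ∈ box t H, ∏ i,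
      majorant k N M w (ℓ i a + ((affineForm (A i) 0 z : ℤ) : ZMod M)) - 1| ≤
      δ + C * ∑ i, if bad (ℓ i a) then (1 : ℝ) else 0 := by
    intro a
    set c : Fin m → ℤ := fun i => representative N M (ℓ i a) with hc
    have haff : ∀ i z, affineForm (A i) (c i) z = c i + affineForm (A i) 0 z := by
      intro i z
      rw [affineForm, affineForm, add_zero, add_comm]
    have hval : ∀ i, ∀ z ∈ box t H,
        majorant k N M w (ℓ i a + ((affineForm (A i) 0 z : ℤ) : ZMod M)) =
        if epsilon k * M ≤ (representative N M (ℓ i a) : ℝ) - N + (affineForm (A i) 0 z : ℤ) ∧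
          (representative N M (ℓ i a) : ℝ) - N + (affineForm (A i) 0 z : ℤ) ≤ 2 * epsilon k * M then
          normalizedSieve w (sieveLevel k M) (primeProduct w * affineForm (A i) (c i) z + 1)
        else 1 := by
      intro i z hz
      rw [majorant_add_intCast hM0 w (ℓ i a) (abs_affineForm_zero_le (hK i) hz) hB1 hB2, haff]
    by_cases hgood : ∀ i, ¬ bad (ℓ i a)
    · have h1 := abs_average_prod_sub_one_le (hcore c)
        (ν := fun i z => majorant k N M w (ℓ i a + ((affineForm (A i) 0 z : ℤ) : ZMod M))) (by
        intro i
        have hg := hgood i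
        simp only [hbad, not_or, not_le] at hg
        by_cases hcond : epsilon k * M < (representative N M (ℓ i a) : ℝ) - N ∧
            (representative N M (ℓ i a) : ℝ) - N < 2 * epsilon k * M
        · left
          intro z hz
          have hz' := abs_le.mp (abs_affineForm_zero_le (hK i) hz)
          rw [abs_of_pos (by linarith), abs_of_neg (by linarith)] at hg
          rw [hval i z hz, if_pos ⟨by linarith, by linarith⟩]
        · right
          intro z hz
          have hz' := abs_le.mp (abs_affineForm_zero_le (hK i) hz)
          rw [hval i z hz, if_neg]
          rintro ⟨h2, h3⟩
          refine hcond ⟨?_, ?_⟩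
          · rcases lt_abs.mp hg.1 with h | h <;> linarith
          · rcases lt_abs.mp hg.2 with h | h <;> linarith)
      refine h1.trans (le_add_of_nonneg_right (mul_nonneg hC0 (Finset.sum_nonneg fun i _ => ?_)))
      split_ifs <;> norm_num
    · simp only [not_forall, not_not] at hgood
      obtain ⟨i₀, hi₀⟩ := hgood
      have h1 := abs_average_prod_sub_one_le_two_pow (by positivity) hδ (hcore c)
        (ν := fun i z => majorant k N M w (ℓ i a + ((affineForm (A i) 0 z : ℤ) : ZMod M)))
        (fun i z _ => majorant_nonneg k N M hM0 w _) (by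
          intro i z hz
          rw [hval i z hz]
          have := normalizedSieve_nonneg (w := w) hR
            (primeProduct w * affineForm (A i) (c i) z + 1)
          split_ifs <;> linarith)
      rw [Fintype.card_fin] at h1
      have hδ0 : 0 ≤ δ := (abs_nonneg _).trans (hcore c ∅)
      have h2 : (1 : ℝ) ≤ ∑ i, if bad (ℓ i a) then (1 : ℝ) else 0 := by
        refine le_trans (by rw [if_pos hi₀]) (Finset.single_le_sum (f := fun i =>
          if bad (ℓ i a) then (1 : ℝ) else 0) (fun i _ => by split_ifs <;> norm_num)
          (Finset.mem_univ i₀))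
      have h3 : C * 1 ≤ C * ∑ i, if bad (ℓ i a) then (1 : ℝ) else 0 := by gcongr
      linarith
  have hG := average_box_shift hH (fun x : Fin t → ZMod M =>
    ∏ i, majorant k N M w (linearForm (fun j => (A i j : ZMod M)) x + b i))
  simp_rw [hshift] at hG
  simp_rw [← linearForm_apply]
  have hsub : ∀ g : (Fin t → ZMod M) → ℝ, 𝔼 a, g a - 1 = 𝔼 a, (g a - 1) := fun g => by
    rw [Finset.expect_sub_distrib, Fintype.expect_const]
  rw [hG, hsub]
  refine (Finset.abs_expect_le _ _).trans ((Finset.expect_le_expect fun a _ => hpt a).trans ?_)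
  rw [Finset.expect_add_distrib, Fintype.expect_const, ← Finset.mul_expect,
    Finset.expect_sum_comm]
  gcongr
  refine (Finset.sum_le_sum fun i _ => hbadexp i).trans ?_
  simp

/-- Averages of sieve weights over boxes, uniformly over bounded systems and their subsystems. -/
theorem eventually_forall_subsystem {w R : ℕ → ℝ} {H : ℕ → ℕ} (K : ℤ) (m₀ t₀ : ℕ)
    (hw : Tendsto w atTop atTop) (hR : Tendsto R atTop atTop)
    (hκ : Tendsto (fun a => primeProduct (w a) * (⌊w a⌋₊ + 1 : ℝ) ^ 2 / Real.log (R a)) atTop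
      (nhds 0)) (hH0 : ∀ᶠ a in atTop, 0 < H a)
    (hH : ∀ m ≤ m₀, Tendsto (fun a => R a ^ (5 * m) / (H a : ℝ)) atTop (nhds 0))
    {δ : ℝ} (hδ : 0 < δ) :
    ∀ᶠ a in atTop, ∀ m ≤ m₀, ∀ t ≤ t₀, ∀ S : Finset (Fin m), ∀ A : Fin m → Fin t → ℤ,
      (∀ i j, |A i j| ≤ K) → (∀ i, ∃ j, A i j ≠ 0) →
      (∀ i i', i ≠ i' → ∃ j j', A i j * A i' j' ≠ A i j' * A i' j) → ∀ c : Fin m → ℤ,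
      |1 / (H a : ℝ) ^ t * ∑ z ∈ box t (H a), ∏ i ∈ S,
        normalizedSieve (w a) (R a) (primeProduct (w a) * affineForm (A i) (c i) z + 1) - 1|
        ≤ δ := by
  -- Only finitely many `m`, `t` and `S` occur, so a single threshold serves them all.
  refine (eventually_all_finite (Set.finite_Iic m₀)).mpr fun m hm => ?_
  refine (eventually_all_finite (Set.finite_Iic t₀)).mpr fun t _ => ?_
  refine eventually_all.mpr fun S => ?_
  have hS : Fintype.card S ≤ m₀ := by
    rw [Fintype.card_coe]
    exact ((Finset.card_le_univ S).trans_eq (Fintype.card_fin m)).trans hm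
  filter_upwards [eventually_abs_average_normalizedSieve_sub_le (I := S) (t := t) K hw hR hκ hH0
    (hH _ hS) hδ] with a ha A hA1 hA2 hA3 c
  have h := ha (fun i => A i) (fun i => hA1 i) (fun i => hA2 i)
    (fun i i' hii => hA3 i i' fun h => hii (Subtype.ext h)) (fun i => c i)
  have h1 : ∀ z, ∏ i : S, normalizedSieve (w a) (R a)
      (primeProduct (w a) * affineForm (A i) (c i) z + 1) = ∏ i ∈ S, normalizedSieve (w a) (R a)
      (primeProduct (w a) * affineForm (A i) (c i) z + 1) := fun z =>
    Finset.prod_coe_sort S fun i => normalizedSieve (w a) (R a)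
      (primeProduct (w a) * affineForm (A i) (c i) z + 1)
  simp_rw [h1] at h
  exact h

/-! ### Clearing denominators -/

section ClearDenominators

variable {m t k : ℕ} {L : Fin m → Fin t → ℚ}

/-- The integer coefficients `k! * L i j`. -/
def clearedCoefficient (k : ℕ) (L : Fin m → Fin t → ℚ) (i : Fin m) (j : Fin t) : ℤ :=
  (L i j).num * (k.factorial / (L i j).den : ℕ)

theorem den_dvd_factorial (hL : ∀ i j, |(L i j).num| ≤ (k : ℤ) ∧ (L i j).den ≤ k) (i : Fin m)
    (j : Fin t) : (L i j).den ∣ k.factorial :=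
  Nat.dvd_factorial (L i j).den_pos (hL i j).2

theorem abs_clearedCoefficient_le (hL : ∀ i j, |(L i j).num| ≤ (k : ℤ) ∧ (L i j).den ≤ k)
    (i : Fin m) (j : Fin t) : |clearedCoefficient k L i j| ≤ ((k * k.factorial : ℕ) : ℤ) := by
  rw [clearedCoefficient, abs_mul, Nat.abs_cast]
  push_cast
  refine mul_le_mul (hL i j).1 ?_ (by positivity) (by positivity)
  exact_mod_cast Nat.div_le_self _ _

theorem cast_clearedCoefficient (hL : ∀ i j, |(L i j).num| ≤ (k : ℤ) ∧ (L i j).den ≤ k)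
    {F : Type*} [DivisionRing F] (i : Fin m) (j : Fin t) (h0 : ((L i j).den : F) ≠ 0) :
    (clearedCoefficient k L i j : F) = (L i j : F) * (k.factorial : F) := by
  obtain ⟨e, he⟩ := den_dvd_factorial hL i j
  rw [clearedCoefficient, Rat.cast_def, he, Nat.mul_div_cancel_left _ (L i j).den_pos]
  push_cast
  rw [← mul_assoc, div_mul_cancel₀ _ h0]

theorem cast_clearedCoefficient_rat (hL : ∀ i j, |(L i j).num| ≤ (k : ℤ) ∧ (L i j).den ≤ k)
    (i : Fin m) (j : Fin t) :
    (clearedCoefficient k L i j : ℚ) = L i j * (k.factorial : ℚ) := by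
  have h := cast_clearedCoefficient hL (F := ℚ) i j (by exact_mod_cast (L i j).den_ne_zero)
  rwa [Rat.cast_id] at h

theorem exists_clearedCoefficient_ne_zero
    (hL : ∀ i j, |(L i j).num| ≤ (k : ℤ) ∧ (L i j).den ≤ k) {i : Fin m} (hi : L i ≠ 0) :
    ∃ j, clearedCoefficient k L i j ≠ 0 := by
  obtain ⟨j, hj⟩ := Function.ne_iff.mp hi
  refine ⟨j, fun h => ?_⟩
  have h1 := cast_clearedCoefficient_rat hL i j
  rw [h, Int.cast_zero] at h1
  exact mul_ne_zero hj (by exact_mod_cast k.factorial_ne_zero) h1.symm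

/-- If all minors vanished, row `i` would be the multiple of row `i'` by the ratio of their entries
in a column where row `i'` is nonzero. -/
theorem exists_minor_clearedCoefficient_ne
    (hL : ∀ i j, |(L i j).num| ≤ (k : ℤ) ∧ (L i j).den ≤ k) {i i' : Fin m} (hi' : L i' ≠ 0)
    (hii : ∀ q : ℚ, L i ≠ q • L i') :
    ∃ j j', clearedCoefficient k L i j * clearedCoefficient k L i' j' ≠
      clearedCoefficient k L i j' * clearedCoefficient k L i' j := by
  by_contra! h
  obtain ⟨j', hj'⟩ := Function.ne_iff.mp hi'
  have hj' : L i' j' ≠ 0 := hj'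
  refine hii (L i j' / L i' j') (funext fun j => ?_)
  have h1 : (clearedCoefficient k L i j * clearedCoefficient k L i' j' : ℚ) =
      clearedCoefficient k L i j' * clearedCoefficient k L i' j := by exact_mod_cast h j j'
  simp only [cast_clearedCoefficient_rat hL] at h1
  have hk : (k.factorial : ℚ) ≠ 0 := by exact_mod_cast k.factorial_ne_zero
  have h2 : L i j * L i' j' = L i j' * L i' j := by
    have : (L i j * L i' j' - L i j' * L i' j) * ((k.factorial : ℚ) * k.factorial) = 0 := by
      linear_combination h1
    exact sub_eq_zero.mp ((mul_eq_zero.mp this).resolve_right (mul_ne_zero hk hk))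
  rw [Pi.smul_apply, smul_eq_mul, div_mul_eq_mul_div, eq_div_iff hj', h2]

/-- Clearing denominators does not change the average along a system of forms over `ℤ/Mℤ`. -/
theorem expect_clearedCoefficient {M : ℕ} [Fact M.Prime]
    (hL : ∀ i j, |(L i j).num| ≤ (k : ℤ) ∧ (L i j).den ≤ k) (hkM : k < M)
    (G : (Fin m → ZMod M) → ℝ) :
    𝔼 x : Fin t → ZMod M, G (fun i => ∑ j, ((L i j : ℚ) : ZMod M) * x j) =
      𝔼 x : Fin t → ZMod M, G (fun i => ∑ j, (clearedCoefficient k L i j : ZMod M) * x j) := by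
  have hM : M.Prime := Fact.out
  have hfac : ((k.factorial : ℕ) : ZMod M) ≠ 0 := by
    rw [Ne, ZMod.natCast_eq_zero_iff, hM.dvd_factorial]
    omega
  have hden : ∀ i j, (((L i j).den : ℕ) : ZMod M) ≠ 0 := by
    intro i j h
    rw [ZMod.natCast_eq_zero_iff] at h
    have := Nat.le_of_dvd (L i j).den_pos h
    have := (hL i j).2
    omega
  -- Multiplication by `k!` permutes `ℤ/Mℤ`, since the prime `M` exceeds `k`.
  refine (Fintype.expect_equiv (Equiv.piCongrRight fun _ => Equiv.mulLeft₀ _ hfac) _ _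
    fun x => ?_).symm
  congr 1
  funext i
  refine Finset.sum_congr rfl fun j _ => ?_
  rw [cast_clearedCoefficient hL i j (hden i j), mul_assoc]
  rfl

end ClearDenominators

/-! ### Choice of the box size and conclusion -/

theorem tendsto_sqrt_add_one_div : Tendsto (fun M : ℕ => ((Nat.sqrt M + 1 : ℕ) : ℝ) / M) atTop
    (nhds 0) := by
  have h1 : Tendsto (fun M : ℕ => 2 * (M : ℝ) ^ (-(1 / 2) : ℝ)) atTop (nhds 0) := by
    simpa using ((tendsto_rpow_neg_atTop (by norm_num : (0 : ℝ) < 1 / 2)).comp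
      tendsto_natCast_atTop_atTop).const_mul 2
  refine squeeze_zero' (Eventually.of_forall fun M => by positivity) ?_ h1
  filter_upwards [eventually_gt_atTop 0] with M hM
  have hM0 : (0 : ℝ) < M := by exact_mod_cast hM
  have hs : 1 ≤ Real.sqrt M := Real.one_le_sqrt.mpr (by exact_mod_cast hM)
  have h2 : ((Nat.sqrt M : ℕ) : ℝ) ≤ Real.sqrt M := Real.nat_sqrt_le_real_sqrt
  rw [div_le_iff₀ hM0, Real.rpow_neg hM0.le, ← Real.sqrt_eq_rpow]
  push_cast
  have h3 : (Real.sqrt M)⁻¹ * M = Real.sqrt M := by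
    rw [inv_mul_eq_div, Real.div_sqrt]
  rw [mul_assoc, h3]
  linarith

end ShortIntervalPrimes

open ShortIntervalPrimes in
theorem proposition2p2 (k : ℕ) (hk : 3 < k)
    (w : ℕ → ℝ) (hw : Tendsto w atTop atTop)
    (hw_le : ∀ᶠ N : ℕ in atTop, w N ≤ 1 / 2 * Real.log (Real.log N))
    (M : ℕ → ℕ) [∀ N, Fact (M N).Prime]
    (ε : ℝ) (hε : 0 < ε)
    (hM : ∀ᶠ N : ℕ in atTop, (N : ℝ) ^ ε < (M N : ℝ) ∧ M N ≤ N) :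
    ShortIntervalPrimes.LinearFormsCondition M
      (fun N => ShortIntervalPrimes.majorant k N (M N) (w N))
      (k * 2 ^ (k - 1)) (3 * k - 4) k := by
  intro δ hδ
  set m₀ := k * 2 ^ (k - 1) with hm₀
  set t₀ := 3 * k - 4 with ht₀
  set K := k * k.factorial with hK
  have hk0 : 0 < k := by omega
  -- The value of `K` bounds the coefficients after clearing denominators: numerators are at most
  -- `k` and the multipliers at most `k!`.
  have hMt := tendsto_of_rpow_lt hε hM
  have hR := (tendsto_sieveLevel hk0).comp hMt
  -- The other half of `δ` pays for the straddling boxes, whose crude bound requires a sieve error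
  -- of at most `1`.
  set δ' := min (δ / 2) 1 with hδ'
  have hδ'0 : 0 < δ' := lt_min (half_pos hδ) one_pos
  -- The side `√M + 1` is large compared with `R ^ (5 m)` and small compared with `M`, as the two
  -- reductions demand.
  have hcore := eventually_forall_subsystem (H := fun N => Nat.sqrt (M N) + 1) (K : ℤ) m₀ t₀ hw hR
    (tendsto_primeProduct_mul_sq_div_log hk0 hw hw_le hε hM) (Eventually.of_forall fun _ => by omega)
    (fun m hm => (tendsto_sieveLevel_pow_div_sqrt hk0 hm).comp hMt) hδ'0
  set B : ℕ → ℝ := fun N => t₀ * K * ((Nat.sqrt (M N) + 1 : ℕ) : ℝ) with hB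
  have hBM : Tendsto (fun N => B N / M N) atTop (nhds 0) := by
    have h := (tendsto_sqrt_add_one_div.comp hMt).const_mul (t₀ * K : ℝ)
    rw [mul_zero] at h
    refine h.congr fun N => ?_
    simp only [hB, Function.comp]
    ring
  have herr : Tendsto (fun N => (2 ^ m₀ * 2 + 1) * (m₀ * (2 * (2 * B N + 1) / M N)))
      atTop (nhds 0) := by
    have h1 : Tendsto (fun N => 1 / (M N : ℝ)) atTop (nhds 0) :=
      tendsto_one_div_atTop_nhds_zero_nat.comp hMt
    have h2 := (((hBM.const_mul 4).add (h1.const_mul 2)).const_mul (m₀ : ℝ)).const_mul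
      ((2 : ℝ) ^ m₀ * 2 + 1)
    simp only [mul_zero, add_zero] at h2
    refine h2.congr fun N => ?_
    ring
  filter_upwards [hcore, herr.eventually_le_const (half_pos hδ),
    hBM.eventually_lt_const (epsilon_pos k), hMt.eventually_gt_atTop K, hMt.eventually_gt_atTop k,
    hR.eventually_ge_atTop 1] with N h1 h2 h3 h4 h5 h6 m hm t ht L hL hL0 hLp b
  have hM0 : (0 : ℝ) < M N := by exact_mod_cast (Fact.out : (M N).Prime).pos
  rw [div_lt_iff₀ hM0] at h3
  have hBt : (t * K * ((Nat.sqrt (M N) + 1 : ℕ) : ℝ)) ≤ B N := by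
    simp only [hB]
    have : (t : ℝ) ≤ t₀ := by exact_mod_cast ht
    gcongr
  have hε4 := mul_le_mul_of_nonneg_right (epsilon_le k) hM0.le
  have hmain := abs_expect_prod_majorant_sub_one_le (k := k) (N := N) (w := w N)
    (A := clearedCoefficient k L) (H := Nat.sqrt (M N) + 1) (abs_clearedCoefficient_le hL) h4
    (fun i => exists_clearedCoefficient_ne_zero hL (hL0 i)) (min_le_right (δ / 2) 1) (by omega) h6
    (fun c S => h1 m hm t ht S (clearedCoefficient k L) (abs_clearedCoefficient_le hL)
      (fun i => exists_clearedCoefficient_ne_zero hL (hL0 i))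
      (fun i i' hii => exists_minor_clearedCoefficient_ne hL (hL0 i') (hLp i i' hii)) c)
    (hBt.trans_lt h3) (by linarith) b
  rw [expect_clearedCoefficient hL h5 fun y => ∏ i, majorant k N (M N) (w N) (y i + b i)]
  refine hmain.trans ?_
  have h7 : ((2 : ℝ) ^ m * 2 + 1) * (m * (2 * (2 * (t * K * ((Nat.sqrt (M N) + 1 : ℕ) : ℝ)) + 1) /
      M N)) ≤ (2 ^ m₀ * 2 + 1) * (m₀ * (2 * (2 * B N + 1) / M N)) := by
    have : (m : ℝ) ≤ m₀ := by exact_mod_cast hm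
    gcongr
    exact one_le_two
  have h8 : δ' ≤ δ / 2 := min_le_left _ _
  linarith
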